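/- Let $q$ be a prime power and let $\mathrm{AG}(n,q)$ be the $n$-dimensional affine space over $\mathbb F_q$. A $d$-space is a (non-empty) affine subspace of dimension $d$; for an affine subspace $\alpha$, let $\tilde\alpha$ be its projective extension, and let $H_\infty$ be the hyperplane at infinity. Write $\binom{a}{b}_q=\frac{(q^a-1)\cdots(q^{a-b+1}-1)}{(q^b-1)\cdots(q-1)}$ (equal to $1$ if $b=0$) and $\theta_m=\binom{m+1}{1}_q$. A $t$-pencil is the set of all $k$-spaces containing a fixed $t$-space. Put $$f_a(q,n,k,t)=\max\Big\{\theta_k-\theta_{k-t}+\tbinom{n-t}{k-t}_q-q^{(k-t+1)(k-t)}\tbinom{n-k-1}{k-t}_q,\ \ \theta_{t+1}\Big(\tbinom{n-t-1}{k-t-1}_q-\tbinom{n-t-2}{k-t-2}_q\Big)+\tbinom{n-t-2}{k-t-2}_q\Big\}.$$ Example 1. Let $\delta$ be a $t$-space and $\pi$ a $k$-space such that $\pi\cap\delta$ is an affine $(t-1)$-space. Let $S_1$ be a maximal set of affine $k$-spaces in $\langle\pi,\delta\rangle$, including $\pi$, such that $\tilde\pi_1\cap H_\infty\ne\tilde\pi_2\cap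 H_\infty$ for any two distinct $\pi_1,\pi_2\in S_1$ and $\tilde\delta\cap H_\infty\not\subseteq\tilde\pi_1$ for every $\pi_1\in S_1$. Let $S_2$ be the set of all $k$-spaces through $\delta$ that meet $\langle\pi,\delta\rangle$ in at least a $(t+1)$-space. The example is $S_1\cup S_2$. Example 2. Let $\Gamma$ be an affine $(t+2)$-space and let $\mathcal R$ be a maximal set of $\theta_{t+1}$ affine $(t+1)$-spaces in $\Gamma$ such that $\tilde\sigma_1\cap H_\infty\ne\tilde\sigma_2\cap H_\infty$ for any two distinct $\sigma_1,\sigma_2\in\mathcal R$. The example is the set of all $k$-spaces that contain $\Gamma$ or meet $\Gamma$ in an element of $\mathcal R$. Theorem. Let $t>0$ and $k>t+1$, and let $q\ge 4$ and $n>2k+t+2$, or $q=3$ and $n>2k+t+3$. Let $\mathcal S_a$ be a maximal (under inclusion) set of $k$-spaces in $\mathrm{AG}(n,q)$, pairwise intersecting in at least an affine $t$-space. If $\mathcal S_a$ is not a $t$-pencil, then $$|\mathcal S_a|\le f_a(q,n,k,t).$$ If $k>2t+1$, equality holds if and only if $\mathcal S_a$ is an instance of Example 1. If $k\le 2t+1$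 and $(k,t)\ne(3,1)$, equality holds if and only if $\mathcal S_a$ is an instance of Example 2. If $(k,t)=(3,1)$, equality holds if and only if $\mathcal S_a$ is an instance of Example 1 or of Example 2. -/

import Mathlib

/-- The affine geometry `AG(n,q)` over a field `F` with `q` elements: its points are the vectors of
`F ^ n`, its subspaces are the affine subspaces of `F ^ n`. -/
abbrev AG (F : Type*) (n : ℕ) : Type _ := Fin n → F

namespace AG

variable {F : Type*} [Field F] {n : ℕ}

/-- `σ` is an affine `d`-space: a nonempty affine subspace of dimension `d`. -/
def IsSpace (d : ℕ) (σ : AffineSubspace F (AG F n)) : Prop :=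
  (σ : Set (AG F n)).Nonempty ∧ Module.finrank F σ.direction = d

/-- `σ` and `τ` meet in at least an affine `d`-space. -/
def MeetInAtLeast (d : ℕ) (σ τ : AffineSubspace F (AG F n)) : Prop :=
  ((σ ⊓ τ : AffineSubspace F (AG F n)) : Set (AG F n)).Nonempty ∧
    d ≤ Module.finrank F (σ ⊓ τ : AffineSubspace F (AG F n)).direction

/-- `S` is a set of affine `k`-spaces, pairwise intersecting in at least an affine `t`-space. -/
def IsIntersecting (k t : ℕ) (S : Set (AffineSubspace F (AG F n))) : Prop :=
  (∀ σ ∈ S, IsSpace k σ) ∧ S.Pairwise (MeetInAtLeast t)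

/-- `S` is a maximal (with respect to inclusion) set of affine `k`-spaces, pairwise intersecting in
at least an affine `t`-space. -/
def IsMaximalIntersecting (k t : ℕ) (S : Set (AffineSubspace F (AG F n))) : Prop :=
  Maximal (IsIntersecting k t) S

/-- `S` is a `t`-pencil: the set of all affine `k`-spaces through a fixed affine `t`-space. -/
def IsPencil (k t : ℕ) (S : Set (AffineSubspace F (AG F n))) : Prop :=
  ∃ δ : AffineSubspace F (AG F n), IsSpace t δ ∧ S = {σ | IsSpace k σ ∧ δ ≤ σ}

/-- The points at infinity of an affine subspace are the one-dimensional subspaces of its direction,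
so that `σ` and `τ` have the same part at infinity if and only if `σ.direction = τ.direction`.
This says that distinct elements of `A` have distinct parts at infinity. -/
def DistinctAtInfinity (A : Set (AffineSubspace F (AG F n))) : Prop :=
  A.Pairwise fun σ τ => σ.direction ≠ τ.direction

/-- The admissible sets of hyperplanes of `⟨π, δ⟩` in the first example: sets of affine `k`-spaces in
`⟨π, δ⟩`, including `π`, with distinct parts at infinity, and such that the part at infinity of `δ`
is not contained in (the projective extension of) any of them. -/
def IsAdmissible (k : ℕ) (π δ : AffineSubspace F (AG F n))
    (A : Set (AffineSubspace F (AG F n))) : Prop :=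
  π ∈ A ∧ (∀ σ ∈ A, IsSpace k σ ∧ σ ≤ π ⊔ δ ∧ ¬ δ.direction ≤ σ.direction) ∧ DistinctAtInfinity A

/-- The first example (for `0 < t < k`): `S = S₁ ∪ S₂`, where `δ` is an affine `t`-space, `π` is an
affine `k`-space that meets `δ` in an affine `(t-1)`-space, `S₁` is a maximal admissible set, and `S₂`
consists of the `k`-spaces through `δ` that meet `⟨π, δ⟩` in at least a `(t+1)`-space. -/
def IsExampleOne (k t : ℕ) (S : Set (AffineSubspace F (AG F n))) : Prop :=
  ∃ (δ π : AffineSubspace F (AG F n)) (S₁ : Set (AffineSubspace F (AG F n))),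
    IsSpace t δ ∧ IsSpace k π ∧ IsSpace (t - 1) (π ⊓ δ) ∧ Maximal (IsAdmissible k π δ) S₁ ∧
      S = S₁ ∪ {σ | IsSpace k σ ∧ δ ≤ σ ∧ MeetInAtLeast (t + 1) σ (π ⊔ δ)}

end AG

/-- The Gaussian coefficient
`[n, k]_q = ((q ^ n - 1) ⋯ (q ^ (n - k + 1) - 1)) / ((q ^ k - 1) ⋯ (q - 1))`, for `k ≤ n`. -/
def gaussCoeff (q n k : ℕ) : ℚ :=
  (∏ i ∈ Finset.range k, ((q : ℚ) ^ (n - i) - 1)) / ∏ i ∈ Finset.range k, ((q : ℚ) ^ (i + 1) - 1)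

/-- `θ_m = [m + 1, 1]_q`, the number of points of `PG(m,q)`. -/
def thetaNum (q m : ℕ) : ℚ := gaussCoeff q (m + 1) 1

/-- The bound `f_a(q,n,k,t)`, the maximum of the sizes of the two examples. All the differences of
natural numbers in it are true differences for `t + 2 ≤ k` and `2 * k - t < n`. -/
def fA (q n k t : ℕ) : ℚ :=
  max
    (thetaNum q k - thetaNum q (k - t) + gaussCoeff q (n - t) (k - t)
      - (q : ℚ) ^ ((k - t + 1) * (k - t)) * gaussCoeff q (n - k - 1) (k - t))
    (thetaNum q (t + 1) *
        (gaussCoeff q (n - t - 1) (k - t - 1) - gaussCoeff q (n - t - 2) (k - t - 2))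
      + gaussCoeff q (n - t - 2) (k - t - 2))

namespace AG

/-- Sets of affine `(t+1)`-spaces in `Γ` with distinct parts at infinity. -/
def IsParallelDistinct (t : ℕ) {F : Type*} [Field F] {n : ℕ} (Γ : AffineSubspace F (AG F n))
    (R : Set (AffineSubspace F (AG F n))) : Prop :=
  (∀ σ ∈ R, IsSpace (t + 1) σ ∧ σ ≤ Γ) ∧ DistinctAtInfinity R

/-- The second example: `Γ` is an affine `(t+2)`-space, `R` is a maximal set of `θ_{t+1}` affine
`(t+1)`-spaces in `Γ` with distinct parts at infinity, and `S` consists of the `k`-spaces that contain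
`Γ` or meet `Γ` in an element of `R`. -/
def IsExampleTwo (k t : ℕ) {F : Type*} [Field F] {n : ℕ}
    (S : Set (AffineSubspace F (AG F n))) : Prop :=
  ∃ (Γ : AffineSubspace F (AG F n)) (R : Set (AffineSubspace F (AG F n))),
    IsSpace (t + 2) Γ ∧ Maximal (IsParallelDistinct t Γ) R ∧
      (R.ncard : ℚ) = thetaNum (Nat.card F) (t + 1) ∧
      S = {σ | IsSpace k σ ∧ (Γ ≤ σ ∨ σ ⊓ Γ ∈ R)}

end AG

/-! ### Gaussian coefficients and the numbers of subspaces skew to a given one. -/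

section Gauss

variable {q : ℕ}

/-! Homogenize: affine `d`-spaces become linear subspaces of dimension `d + 1` of `V = F ^ n × F`
not contained in the hyperplane `H` at infinity. Call a subspace a cover of `S` if it meets every
member of `S` in at least an affine `t`-space. By maximality, every `k`-space through a cover lies
in `S`. The proof splits on the least linear dimension of a cover.

A cover of dimension at most `t + 1` makes `S` a pencil (`eq_pencil_of_isCover`).

If the least dimension is at least `t + 3`, then `S` is too small (`ncard_lt_of_no_small_cover`).
Every member contains a `(t + 1)`-dimensional subspace of a least cover. A subspace that is not a
cover fails against some member, and `exists_transversal` confines its one-dimensional extensions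
inside members to at most `θ_{k-t}` choices. Iterating up to the cover dimension bounds `S`.

If it equals `t + 2`, any two covers of that dimension meet in an affine `t`-space
(`meets_of_isCover`), so there are two cases.

Suppose first that all these covers share a `t`-space `δ`. Take `π ∈ S` not containing `δ` and put
`W = ⟨π, δ⟩`. If at most `q ^ (k - t)` of the `(t + 1)`-spaces between `δ` and `W` are covers,
counting gives strictly less than the size of Example 1. If there are more, all members not through
`δ` are hyperplanes of `W` meeting `δ` in an affine `(t - 1)`-space (`sup_eq_of_many_covers`), and
maximality yields Example 1 (`isExampleOne_of_sup_eq`).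

Otherwise two of them span an affine `(t + 2)`-space `Γ` that every member meets in at least a `(t +
1)`-space (`meets_sup_of_isCover`). The members not through `Γ` are sorted by the part at infinity
of their trace on `Γ`. Each class is largest when all traces agree (`parallel_class`), which gives
the bound with equality only for Example 2 (`ncard_le_sizeTwo`).

It remains to compare the two sizes. Their leading terms are `θ_{k-t}` and `θ_{t+1}` times the
number of `k`-spaces through a `(t + 1)`-space, so the sign of `k - 2t - 1` decides; for `k = 2t +
1` the second-order terms do, with a tie exactly at `(k, t) = (3, 1)`. -/

theorem q_pow_sub_one_pos (hq : 2 ≤ q) (m : ℕ) : (0 : ℚ) < (q : ℚ) ^ (m + 1) - 1 := by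
  have h : (1 : ℚ) < q := by exact_mod_cast hq
  exact sub_pos.2 (one_lt_pow₀ h (Nat.succ_ne_zero m))

@[simp] theorem gaussCoeff_zero_right (q n : ℕ) : gaussCoeff q n 0 = 1 := by
  simp [gaussCoeff]

theorem gaussCoeff_succ_succ (q a b : ℕ) :
    gaussCoeff q (a + 1) (b + 1)
      = ((q : ℚ) ^ (a + 1) - 1) / ((q : ℚ) ^ (b + 1) - 1) * gaussCoeff q a b := by
  unfold gaussCoeff
  rw [Finset.prod_range_succ', Finset.prod_range_succ (fun i => (q : ℚ) ^ (i + 1) - 1)]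
  simp only [Nat.add_sub_add_right, Nat.sub_zero]
  rw [div_mul_div_comm, mul_comm, mul_comm (∏ i ∈ Finset.range b, ((q : ℚ) ^ (i + 1) - 1))]

theorem gaussCoeff_succ_right (q a b : ℕ) :
    gaussCoeff q a (b + 1)
      = gaussCoeff q a b * (((q : ℚ) ^ (a - b) - 1) / ((q : ℚ) ^ (b + 1) - 1)) := by
  unfold gaussCoeff
  rw [Finset.prod_range_succ, Finset.prod_range_succ (fun i => (q : ℚ) ^ (i + 1) - 1),
    div_mul_div_comm]

theorem gaussCoeff_eq_zero (q : ℕ) {a b : ℕ} (h : a < b) : gaussCoeff q a b = 0 := by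
  unfold gaussCoeff
  rw [Finset.prod_eq_zero (Finset.mem_range.2 h) (by simp), zero_div]

theorem gaussCoeff_pos (hq : 2 ≤ q) {a b : ℕ} (h : b ≤ a) : 0 < gaussCoeff q a b := by
  unfold gaussCoeff
  refine div_pos (Finset.prod_pos fun i hi => ?_)
    (Finset.prod_pos fun i _ => q_pow_sub_one_pos hq i)
  obtain ⟨c, hc⟩ := Nat.exists_eq_add_of_lt ((Finset.mem_range.1 hi).trans_le h)
  have : a - i = c + 1 := by omega
  rw [this]
  exact q_pow_sub_one_pos hq c

theorem gaussCoeff_nonneg (hq : 2 ≤ q) (a b : ℕ) : 0 ≤ gaussCoeff q a b := by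
  rcases lt_or_ge a b with h | h
  · rw [gaussCoeff_eq_zero q h]
  · exact (gaussCoeff_pos hq h).le

/-- The `q`-Pascal rule. -/
theorem gaussCoeff_pascal (hq : 2 ≤ q) (a b : ℕ) :
    gaussCoeff q (a + 1) (b + 1)
      = (q : ℚ) ^ (b + 1) * gaussCoeff q a (b + 1) + gaussCoeff q a b := by
  rcases lt_or_ge a b with h | h
  · rw [gaussCoeff_eq_zero q h, gaussCoeff_eq_zero q (show a < b + 1 by omega),
      gaussCoeff_eq_zero q (show a + 1 < b + 1 by omega)]
    simp
  · rw [gaussCoeff_succ_succ, gaussCoeff_succ_right]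
    have h1 := (q_pow_sub_one_pos hq b).ne'
    obtain ⟨c, rfl⟩ := Nat.exists_eq_add_of_le h
    rw [Nat.add_sub_cancel_left]
    field_simp
    ring

theorem thetaNum_eq (q m : ℕ) : thetaNum q m = ((q : ℚ) ^ (m + 1) - 1) / ((q : ℚ) - 1) := by
  simp [thetaNum, gaussCoeff]

theorem gaussCoeff_one (q m : ℕ) : gaussCoeff q (m + 1) 1 = thetaNum q m := rfl

theorem thetaNum_succ (hq : 2 ≤ q) (m : ℕ) :
    thetaNum q (m + 1) = thetaNum q m + (q : ℚ) ^ (m + 1) := by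
  have h : (1 : ℚ) < q := by exact_mod_cast hq
  have h' : (q : ℚ) - 1 ≠ 0 := by linarith
  rw [thetaNum_eq, thetaNum_eq]
  field_simp
  ring

theorem thetaNum_succ' (hq : 2 ≤ q) (m : ℕ) :
    thetaNum q (m + 1) = q * thetaNum q m + 1 := by
  have h : (1 : ℚ) < q := by exact_mod_cast hq
  have h' : (q : ℚ) - 1 ≠ 0 := by linarith
  rw [thetaNum_eq, thetaNum_eq]
  field_simp
  ring

@[simp] theorem thetaNum_zero (hq : 2 ≤ q) : thetaNum q 0 = 1 := by
  have h : (1 : ℚ) < q := by exact_mod_cast hq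
  have h' : (q : ℚ) - 1 ≠ 0 := by linarith
  rw [thetaNum_eq]
  simp [h']

theorem thetaNum_pos (hq : 2 ≤ q) (m : ℕ) : 0 < thetaNum q m :=
  gaussCoeff_pos hq (by omega)

theorem gaussCoeff_succ_self (hq : 2 ≤ q) (b : ℕ) : gaussCoeff q (b + 1) b = thetaNum q b := by
  induction b with
  | zero => simp [hq]
  | succ b ih =>
    have h1 := (q_pow_sub_one_pos hq b).ne'
    have h : (1 : ℚ) < q := by exact_mod_cast hq
    have h' : (q : ℚ) - 1 ≠ 0 := by linarith
    rw [gaussCoeff_succ_succ, ih, thetaNum_eq, thetaNum_eq]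
    field_simp

/-- By symmetry this is the coefficient with lower entry `2`, with its denominator `q + 1` cleared;
it turns the number of `(t + 1)`-dimensional subspaces of a `(t + 3)`-dimensional cover into a
product of two theta numbers. -/
theorem gaussCoeff_add_two_self (hq : 2 ≤ q) (b : ℕ) :
    gaussCoeff q (b + 2) b * (q + 1) = thetaNum q (b + 1) * thetaNum q b := by
  have h : (1 : ℚ) < q := by exact_mod_cast hq
  have h' : (q : ℚ) - 1 ≠ 0 := by linarith
  induction b with
  | zero =>
    rw [thetaNum_zero hq, thetaNum_succ hq, thetaNum_zero hq]
    simp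
    ring
  | succ b ih =>
    have h1 := (q_pow_sub_one_pos hq b).ne'
    rw [gaussCoeff_succ_succ, mul_assoc, ih, thetaNum_eq, thetaNum_eq, thetaNum_eq]
    field_simp

theorem thetaNum_lt_pow (hq : 3 ≤ q) (m : ℕ) : thetaNum q m * (q - 1) < (q : ℚ) ^ (m + 1) := by
  have h : (3 : ℚ) ≤ q := by exact_mod_cast hq
  have h' : (q : ℚ) - 1 ≠ 0 := by linarith
  rw [thetaNum_eq, div_mul_cancel₀ _ h']
  linarith

theorem pow_le_thetaNum (hq : 2 ≤ q) (m : ℕ) : (q : ℚ) ^ m ≤ thetaNum q m := by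
  cases m with
  | zero => simp [hq]
  | succ m =>
    rw [thetaNum_succ hq]
    linarith [thetaNum_pos hq m]

/-- The quotient of the two coefficients is `(q ^ (a + 1) - 1) / (q ^ (b + 1) - 1)`. This is the
main growth estimate: it makes `k`-spaces through a `(t + 1)`-space far more numerous than those
through a `(t + 2)`-space. -/
theorem gaussCoeff_mul_pow_le (hq : 2 ≤ q) {a b : ℕ} (h : b ≤ a) :
    (q : ℚ) ^ (a - b) * gaussCoeff q a b ≤ gaussCoeff q (a + 1) (b + 1) := by
  have h0 := q_pow_sub_one_pos hq b
  rw [gaussCoeff_succ_succ]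
  refine mul_le_mul_of_nonneg_right ?_ (gaussCoeff_nonneg hq a b)
  rw [le_div_iff₀ h0]
  have : (q : ℚ) ^ (a - b) * (q : ℚ) ^ (b + 1) = (q : ℚ) ^ (a + 1) := by
    rw [← pow_add]; congr 1; omega
  have h2 : (1 : ℚ) ≤ (q : ℚ) ^ (a - b) :=
    one_le_pow₀ (by exact_mod_cast (show 1 ≤ q by omega))
  rw [mul_sub, this]
  linarith

theorem one_le_gaussCoeff (hq : 2 ≤ q) {a b : ℕ} (h : b ≤ a) : 1 ≤ gaussCoeff q a b := by
  have h1 : (1 : ℚ) ≤ q := by exact_mod_cast (show 1 ≤ q by omega)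
  induction b generalizing a with
  | zero => simp
  | succ b ih =>
    obtain ⟨a, rfl⟩ : ∃ c, a = c + 1 := ⟨a - 1, by omega⟩
    have := ih (show b ≤ a by omega)
    have h2 := gaussCoeff_mul_pow_le hq (show b ≤ a by omega)
    have h3 : (1 : ℚ) ≤ (q : ℚ) ^ (a - b) := one_le_pow₀ h1
    nlinarith

theorem pow_le_gaussCoeff (hq : 2 ≤ q) {a b : ℕ} (h : b + 1 ≤ a) :
    (q : ℚ) ^ (a - (b + 1)) ≤ gaussCoeff q a (b + 1) := by
  obtain ⟨a, rfl⟩ : ∃ c, a = c + 1 := ⟨a - 1, by omega⟩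
  have h2 := gaussCoeff_mul_pow_le hq (show b ≤ a by omega)
  have h3 := one_le_gaussCoeff hq (show b ≤ a by omega)
  have h4 : (0 : ℚ) < (q : ℚ) ^ (a - b) := pow_pos (by exact_mod_cast (show 0 < q by omega)) _
  rw [Nat.add_sub_add_right]
  nlinarith

/-- `q ^ (i * b) * [m - i, b]`, the number of `b`-dimensional subspaces of an `m`-dimensional space
that meet a given `i`-dimensional subspace trivially. -/
def skewNum (q m b i : ℕ) : ℚ := (q : ℚ) ^ (i * b) * gaussCoeff q (m - i) b

/-- Geometrically, the difference counts subspaces skew to an `i`-dimensional `U` but meeting some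
`U' ⊃ U` of one dimension more: they contain exactly one of the `q ^ i` points of `U'` off `U`, and
factoring that point out leaves a skew count. Algebraically it is the `q`-Pascal rule. -/
theorem skewNum_sub_succ (hq : 2 ≤ q) {m b i : ℕ} (h : i ≤ m) :
    skewNum q (m + 1) (b + 1) i - skewNum q (m + 1) (b + 1) (i + 1)
      = (q : ℚ) ^ i * skewNum q m b i := by
  obtain ⟨c, rfl⟩ := Nat.exists_eq_add_of_le h
  simp only [skewNum]
  rw [show i + c + 1 - i = c + 1 by omega, show i + c + 1 - (i + 1) = c by omega,
    show i + c - i = c by omega, gaussCoeff_pascal hq]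
  ring

theorem skewNum_eq_sum (hq : 2 ≤ q) {m b i : ℕ} (h : i ≤ m + 1) :
    skewNum q (m + 1) (b + 1) i
      = gaussCoeff q (m + 1) (b + 1) - ∑ j ∈ Finset.range i, (q : ℚ) ^ j * skewNum q m b j := by
  induction i with
  | zero => simp [skewNum]
  | succ i ih =>
    have := skewNum_sub_succ hq (b := b) (show i ≤ m by omega)
    rw [Finset.sum_range_succ, ← this]
    linarith [ih (by omega)]

theorem skewNum_nonneg (hq : 2 ≤ q) (m b i : ℕ) : 0 ≤ skewNum q m b i :=
  mul_nonneg (by positivity) (gaussCoeff_nonneg hq _ _)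

theorem thetaNum_eq_sum (hq : 2 ≤ q) (m : ℕ) :
    thetaNum q m = ∑ j ∈ Finset.range (m + 1), (q : ℚ) ^ j := by
  induction m with
  | zero => simp [hq]
  | succ m ih => rw [Finset.sum_range_succ, thetaNum_succ hq, ih]

theorem skewNum_le (hq : 2 ≤ q) {m b i : ℕ} (h : i ≤ m) :
    skewNum q m b i ≤ gaussCoeff q m b := by
  cases b with
  | zero => simp [skewNum]
  | succ b =>
    cases m with
    | zero => obtain rfl : i = 0 := by omega
              simp [skewNum]
    | succ m =>
      rw [skewNum_eq_sum hq h]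
      have : 0 ≤ ∑ j ∈ Finset.range i, (q : ℚ) ^ j * skewNum q m b j :=
        Finset.sum_nonneg fun j _ => mul_nonneg (by positivity) (skewNum_nonneg hq _ _ _)
      linarith

/-- A union bound: a subspace that is not skew contains one of the `θ_i` points of the given `(i +
1)`-dimensional subspace. -/
theorem le_skewNum (hq : 2 ≤ q) {m b i : ℕ} (h : i ≤ m) :
    gaussCoeff q (m + 1) (b + 1) - thetaNum q i * gaussCoeff q m b
      ≤ skewNum q (m + 1) (b + 1) (i + 1) := by
  rw [skewNum_eq_sum hq (by omega), thetaNum_eq_sum hq, Finset.sum_mul]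
  have : ∑ j ∈ Finset.range (i + 1), (q : ℚ) ^ j * skewNum q m b j
      ≤ ∑ j ∈ Finset.range (i + 1), (q : ℚ) ^ j * gaussCoeff q m b := by
    refine Finset.sum_le_sum fun j hj => ?_
    exact mul_le_mul_of_nonneg_left (skewNum_le hq (by have := Finset.mem_range.1 hj; omega))
      (by positivity)
  linarith

end Gauss

/-! ### Numerical estimates, and comparison of the sizes of the two examples. -/

section Bounds

variable {q : ℕ}

theorem thetaNum_le_pow (hq : 3 ≤ q) (m : ℕ) : 2 * thetaNum q m < (q : ℚ) ^ (m + 1) := by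
  have h : (3 : ℚ) ≤ q := by exact_mod_cast hq
  have := thetaNum_lt_pow hq m
  have := thetaNum_pos (show 2 ≤ q by omega) m
  nlinarith

theorem thetaNum_mono (hq : 2 ≤ q) {a b : ℕ} (h : a ≤ b) : thetaNum q a ≤ thetaNum q b := by
  refine monotone_nat_of_le_succ (f := thetaNum q) (fun m => ?_) h
  rw [thetaNum_succ hq]
  have : (0 : ℚ) ≤ (q : ℚ) ^ (m + 1) := by positivity
  linarith

theorem gaussCoeff_succ_left_le (hq : 2 ≤ q) {a b : ℕ} (h : b < a) :
    gaussCoeff q (a + 1) (b + 1) ≤ (q : ℚ) ^ (b + 2) * gaussCoeff q a (b + 1) := by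
  have hq' : (2 : ℚ) ≤ q := by exact_mod_cast hq
  have h0 := q_pow_sub_one_pos hq b
  have hg := gaussCoeff_nonneg hq a b
  obtain ⟨c, rfl⟩ := Nat.exists_eq_add_of_lt h
  have h1 : (q : ℚ) ≤ (q : ℚ) ^ (c + 1) := by
    calc (q : ℚ) = (q : ℚ) ^ 1 := (pow_one _).symm
      _ ≤ _ := pow_le_pow_right₀ (by linarith) (by omega)
  have key : gaussCoeff q (b + c + 1) b
      ≤ ((q : ℚ) - 1) * (q : ℚ) ^ (b + 1) * gaussCoeff q (b + c + 1) (b + 1) := by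
    rw [gaussCoeff_succ_right, show b + c + 1 - b = c + 1 by omega, mul_left_comm]
    refine le_mul_of_one_le_right hg ?_
    rw [← mul_div_assoc, one_le_div h0]
    have h2 : (1 : ℚ) ≤ ((q : ℚ) - 1) * ((q : ℚ) ^ (c + 1) - 1) := by nlinarith
    nlinarith
  rw [gaussCoeff_pascal hq, pow_succ _ (b + 1)]
  linarith

/-- The size of the first example. -/
def sizeOne (q n k t : ℕ) : ℚ :=
  thetaNum q k - thetaNum q (k - t) + gaussCoeff q (n - t) (k - t)
    - (q : ℚ) ^ ((k - t + 1) * (k - t)) * gaussCoeff q (n - k - 1) (k - t)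

/-- The size of the second example. -/
def sizeTwo (q n k t : ℕ) : ℚ :=
  thetaNum q (t + 1) *
      (gaussCoeff q (n - t - 1) (k - t - 1) - gaussCoeff q (n - t - 2) (k - t - 2))
    + gaussCoeff q (n - t - 2) (k - t - 2)

theorem fA_eq (q n k t : ℕ) : fA q n k t = max (sizeOne q n k t) (sizeTwo q n k t) := rfl

/-- The substitution `n = m + t + 2`, `k = t + b + 2` removes truncated subtraction. From here on
`gaussCoeff q (m + 1) (b + 1)` and `gaussCoeff q m b` are the numbers of `k`-spaces through a `(t +
1)`-space and through a `(t + 2)`-space, called `M` and `G` below. -/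
theorem sizeTwo_eq (q m b t : ℕ) :
    sizeTwo q (m + t + 2) (t + b + 2) t
      = thetaNum q (t + 1) * (gaussCoeff q (m + 1) (b + 1) - gaussCoeff q m b)
        + gaussCoeff q m b := by
  rw [sizeTwo, show m + t + 2 - t - 1 = m + 1 by omega, show m + t + 2 - t - 2 = m by omega,
    show t + b + 2 - t - 1 = b + 1 by omega, show t + b + 2 - t - 2 = b by omega]

/-- The subtracted term of `sizeOne` is the skew number of index `b + 3 = k - t + 1`; telescoping it
writes the size as a sum whose `i`-th term is at most `q ^ i * M`, so that it can be compared with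
`θ_{b+2} * M` term by term. -/
theorem sizeOne_eq (hq : 2 ≤ q) {m b : ℕ} (t : ℕ) (hm : b + 1 ≤ m) :
    sizeOne q (m + t + 2) (t + b + 2) t
      = thetaNum q (t + b + 2) - thetaNum q (b + 2)
        + ∑ i ∈ Finset.range (b + 3), (q : ℚ) ^ i * skewNum q (m + 1) (b + 1) i := by
  have := skewNum_eq_sum hq (b := b + 1) (show b + 3 ≤ m + 1 + 1 by omega)
  rw [skewNum, show m + 1 + 1 - (b + 3) = m - b - 1 by omega] at this
  rw [sizeOne, show m + t + 2 - t = m + 1 + 1 by omega,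
    show m + t + 2 - (t + b + 2) - 1 = m - b - 1 by omega,
    show t + b + 2 - t = b + 1 + 1 by omega, show b + 1 + 1 + 1 = b + 3 by omega, this]
  ring

theorem le_sizeOne (hq : 2 ≤ q) {m b : ℕ} (t : ℕ) (hm : b + 1 ≤ m) :
    thetaNum q (b + 2) *
        (gaussCoeff q (m + 1) (b + 1) - thetaNum q (b + 1) * gaussCoeff q m b)
      ≤ sizeOne q (m + t + 2) (t + b + 2) t := by
  rw [sizeOne_eq hq t hm]
  have h1 := thetaNum_mono hq (show b + 2 ≤ t + b + 2 by omega)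
  have h2 : thetaNum q (b + 2) *
      (gaussCoeff q (m + 1) (b + 1) - thetaNum q (b + 1) * gaussCoeff q m b)
      ≤ ∑ i ∈ Finset.range (b + 3), (q : ℚ) ^ i * skewNum q (m + 1) (b + 1) i := by
    rw [thetaNum_eq_sum hq (b + 2), Finset.sum_mul]
    refine Finset.sum_le_sum fun i hi => mul_le_mul_of_nonneg_left ?_ (by positivity)
    have hi' := Finset.mem_range.1 hi
    have hG := gaussCoeff_nonneg hq m b
    cases i with
    | zero =>
      have := thetaNum_pos hq (b + 1)
      simp only [skewNum, zero_mul, pow_zero, one_mul, Nat.sub_zero]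
      nlinarith
    | succ i =>
      refine le_trans ?_ (le_skewNum hq (show i ≤ m by omega))
      have := thetaNum_mono hq (show i ≤ b + 1 by omega)
      nlinarith
  linarith

theorem sizeOne_le (hq : 2 ≤ q) {m b : ℕ} (t : ℕ) (hm : b + 1 ≤ m) :
    sizeOne q (m + t + 2) (t + b + 2) t ≤ thetaNum q (t + b + 2) - thetaNum q (b + 2)
      + thetaNum q (b + 2) * gaussCoeff q (m + 1) (b + 1) := by
  rw [sizeOne_eq hq t hm, thetaNum_eq_sum hq (b + 2), Finset.sum_mul]
  gcongr with i hi
  exact skewNum_le hq (by have := Finset.mem_range.1 hi; omega)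

section

variable {m b t : ℕ}

/-- The lower bound on `n` enters the gap estimates here: the left side is `q ^ (2 * t + b + 5)`,
and the right side is the growth factor from `G` to `M`. -/
theorem pow_gap (hq : 3 ≤ q) (hm : 2 * t + 2 * b + 5 ≤ m) :
    (q : ℚ) * (q : ℚ) ^ (b + 2) * ((q : ℚ) ^ (t + 1)) ^ 2 ≤ (q : ℚ) ^ (m - b) := by
  have h : (1 : ℚ) ≤ q := by exact_mod_cast (show 1 ≤ q by omega)
  calc _ = (q : ℚ) ^ (2 * t + b + 5) := by ring
    _ ≤ _ := pow_le_pow_right₀ h (by omega)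

theorem sq_le_pow_succ (hq : 3 ≤ q) (ht : 0 < t) : (q : ℚ) ^ 2 ≤ (q : ℚ) ^ (t + 1) := by
  have h : (1 : ℚ) ≤ q := by exact_mod_cast (show 1 ≤ q by omega)
  exact pow_le_pow_right₀ h (by omega)

theorem large_cover_gap (hq : 3 ≤ q) (ht : 0 < t) (hm : 2 * t + 2 * b + 5 ≤ m) :
    gaussCoeff q (t + 3) (t + 1) * thetaNum q (b + 2) + thetaNum q (b + 1)
      < (q : ℚ) ^ (m - b) := by
  have h3 : (3 : ℚ) ≤ q := by exact_mod_cast hq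
  have hQ := pow_gap hq hm
  have hy := sq_le_pow_succ hq ht
  have hg := gaussCoeff_add_two_self (show 2 ≤ q by omega) (t + 1)
  have h1 := thetaNum_lt_pow hq (b + 2)
  have h2 := thetaNum_lt_pow hq (b + 1)
  have h4 := thetaNum_lt_pow hq (t + 1 + 1)
  have h5 := thetaNum_lt_pow hq (t + 1)
  have p1 := thetaNum_pos (show 2 ≤ q by omega) (b + 2)
  have p2 := thetaNum_pos (show 2 ≤ q by omega) (b + 1)
  have p3 := thetaNum_pos (show 2 ≤ q by omega) (t + 1 + 1)
  have p4 := thetaNum_pos (show 2 ≤ q by omega) (t + 1)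
  have hx0 : (0 : ℚ) < (q : ℚ) ^ (b + 2) := by positivity
  rw [show (q : ℚ) ^ (b + 2 + 1) = q * (q : ℚ) ^ (b + 2) by ring] at h1
  rw [show (q : ℚ) ^ (b + 1 + 1) = (q : ℚ) ^ (b + 2) by ring] at h2
  rw [show (q : ℚ) ^ (t + 1 + 1 + 1) = q ^ 2 * (q : ℚ) ^ (t + 1) by ring] at h4
  rw [show (q : ℚ) ^ (t + 1 + 1) = q * (q : ℚ) ^ (t + 1) by ring] at h5
  rw [show t + 1 + 2 = t + 3 by omega] at hg
  generalize gaussCoeff q (t + 3) (t + 1) = g at *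
  generalize thetaNum q (b + 2) = T at *
  generalize thetaNum q (b + 1) = T' at *
  generalize thetaNum q (t + 1 + 1) = A at *
  generalize thetaNum q (t + 1) = B at *
  generalize (q : ℚ) ^ (b + 2) = x at *
  generalize (q : ℚ) ^ (t + 1) = y at *
  refine lt_of_lt_of_le ?_ hQ
  generalize (q : ℚ) = r at *
  have hu : 0 < r - 1 := by linarith
  have hy0 : 0 < y := by nlinarith
  have e1 : g * (r + 1) * (r - 1) ^ 2 < r ^ 3 * y ^ 2 := by
    rw [hg]
    calc A * B * (r - 1) ^ 2 = (A * (r - 1)) * (B * (r - 1)) := by ring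
      _ < (r ^ 2 * y) * (r * y) := mul_lt_mul'' h4 h5 (by positivity) (by positivity)
      _ = _ := by ring
  have g0 : 0 < g := by
    have : 0 < g * (r + 1) := by rw [hg]; positivity
    exact pos_of_mul_pos_left this (by linarith)
  have e2 : g * (r + 1) * (r - 1) ^ 2 * (T * (r - 1)) < r ^ 3 * y ^ 2 * (r * x) :=
    mul_lt_mul'' e1 h1 (by positivity) (by positivity)
  have e3 : T' * (r - 1) * ((r - 1) ^ 2 * (r + 1)) ≤ x * ((r - 1) ^ 2 * (r + 1)) :=
    mul_le_mul_of_nonneg_right h2.le (by positivity)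
  have e4 : r ^ 4 * y ^ 2 + (r - 1) ^ 2 * (r + 1) ≤ r * y ^ 2 * ((r - 1) ^ 3 * (r + 1)) := by
    -- The difference of the two sides is exactly `r ^ 4 * (r - 3)`, so `q = 3` is the tight case;
    -- the summand `2 * r ^ 2 - r` is kept to absorb the `θ_{b+1}` term.
    have f1 : r ^ 4 + (2 * r ^ 2 - r) ≤ r * ((r - 1) ^ 3 * (r + 1)) := by
      have : 0 ≤ r ^ 4 * (r - 3) := mul_nonneg (by positivity) (by linarith)
      nlinarith
    have f2 : (r - 1) ^ 2 * (r + 1) ≤ y ^ 2 * (2 * r ^ 2 - r) := by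
      have : r ^ 4 ≤ y ^ 2 := by nlinarith
      nlinarith [mul_pos hu hu]
    nlinarith [mul_le_mul_of_nonneg_left f1 (sq_nonneg y)]
  have e5 := mul_le_mul_of_nonneg_left e4 hx0.le
  have : (g * T + T') * ((r - 1) ^ 3 * (r + 1)) < r * x * y ^ 2 * ((r - 1) ^ 3 * (r + 1)) := by
    nlinarith
  exact lt_of_mul_lt_mul_right this (by positivity)

/-- The left side will bound `S` when the least cover has dimension `t + 3 + j`. Raising `j` by one
multiplies it by at most `q ^ (t + 2) * θ_{b+2} / q ^ (m - b) ≤ 1`, so `j = 0` is the worst case,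
and that one is `large_cover_gap`. -/
theorem large_cover_bound (hq : 3 ≤ q) (ht : 0 < t) (hm : 2 * t + 2 * b + 5 ≤ m) {j : ℕ}
    (hj : j ≤ b) :
    gaussCoeff q (t + 3 + j) (t + 1) * (thetaNum q (b + 2) ^ (j + 2) * gaussCoeff q (m - j) (b - j))
      < sizeOne q (m + t + 2) (t + b + 2) t := by
  have hq2 : 2 ≤ q := by omega
  have hT := thetaNum_pos hq2 (b + 2)
  induction j with
  | zero =>
    refine lt_of_lt_of_le ?_ (le_sizeOne hq2 t (by omega))
    have h1 := large_cover_gap hq ht hm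
    have h2 := gaussCoeff_mul_pow_le hq2 (show b ≤ m by omega)
    have hG := gaussCoeff_pos hq2 (show b ≤ m by omega)
    simp only [add_zero, zero_add, Nat.sub_zero]
    have h3 := mul_lt_mul_of_pos_right h1 hG
    have h4 : gaussCoeff q (t + 3) (t + 1) * thetaNum q (b + 2) * gaussCoeff q m b
      < gaussCoeff q (m + 1) (b + 1) - thetaNum q (b + 1) * gaussCoeff q m b := by linarith
    have h5 := mul_lt_mul_of_pos_left h4 hT
    calc _ = _ := by ring
      _ < _ := h5
  | succ j ih =>
    refine lt_of_le_of_lt ?_ (ih (by omega))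
    have h1 := gaussCoeff_succ_left_le hq2 (show t < t + 3 + j by omega)
    have h2 := gaussCoeff_mul_pow_le hq2 (show b - (j + 1) ≤ m - (j + 1) by omega)
    rw [show m - (j + 1) - (b - (j + 1)) = m - b by omega,
      show m - (j + 1) + 1 = m - j by omega, show b - (j + 1) + 1 = b - j by omega] at h2
    have h3 := (thetaNum_le_pow hq (b + 2)).le
    have hG := gaussCoeff_nonneg hq2 (m - (j + 1)) (b - (j + 1))
    have hA := gaussCoeff_nonneg hq2 (t + 3 + j) (t + 1)
    have h4 : (q : ℚ) ^ (t + 2) * thetaNum q (b + 2) ≤ (q : ℚ) ^ (m - b) := by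
      calc (q : ℚ) ^ (t + 2) * thetaNum q (b + 2) ≤ (q : ℚ) ^ (t + 2) * (q : ℚ) ^ (b + 2 + 1) := by
            refine mul_le_mul_of_nonneg_left ?_ (by positivity)
            linarith
        _ = (q : ℚ) ^ (t + 2 + (b + 2 + 1)) := by ring
        _ ≤ _ := pow_le_pow_right₀ (by exact_mod_cast (show 1 ≤ q by omega)) (by omega)
    calc gaussCoeff q (t + 3 + (j + 1)) (t + 1) *
          (thetaNum q (b + 2) ^ (j + 1 + 2) * gaussCoeff q (m - (j + 1)) (b - (j + 1)))
        ≤ ((q : ℚ) ^ (t + 2) * gaussCoeff q (t + 3 + j) (t + 1)) *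
          (thetaNum q (b + 2) ^ (j + 1 + 2) * gaussCoeff q (m - (j + 1)) (b - (j + 1))) :=
          mul_le_mul_of_nonneg_right h1 (by positivity)
      _ = gaussCoeff q (t + 3 + j) (t + 1) * (thetaNum q (b + 2) ^ (j + 2) *
          (((q : ℚ) ^ (t + 2) * thetaNum q (b + 2)) *
            gaussCoeff q (m - (j + 1)) (b - (j + 1)))) := by ring
      _ ≤ gaussCoeff q (t + 3 + j) (t + 1) * (thetaNum q (b + 2) ^ (j + 2) *
          ((q : ℚ) ^ (m - b) * gaussCoeff q (m - (j + 1)) (b - (j + 1)))) := by gcongr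
      _ ≤ _ := by gcongr

theorem one_cover_gap (hq : 3 ≤ q) (ht : 0 < t) (hm : 2 * t + 2 * b + 5 ≤ m) :
    thetaNum q (t + 1) * thetaNum q (b + 2) * (q + 1) + 2 * thetaNum q (b + 2)
      < (q : ℚ) ^ (m - b) := by
  have h3 : (3 : ℚ) ≤ q := by exact_mod_cast hq
  have hQ := pow_gap hq hm
  have hy := sq_le_pow_succ hq ht
  have h1 := thetaNum_lt_pow hq (b + 2)
  have h5 := thetaNum_lt_pow hq (t + 1)
  have p1 := thetaNum_pos (show 2 ≤ q by omega) (b + 2)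
  have p4 := thetaNum_pos (show 2 ≤ q by omega) (t + 1)
  have hx0 : (0 : ℚ) < (q : ℚ) ^ (b + 2) := by positivity
  rw [show (q : ℚ) ^ (b + 2 + 1) = q * (q : ℚ) ^ (b + 2) by ring] at h1
  rw [show (q : ℚ) ^ (t + 1 + 1) = q * (q : ℚ) ^ (t + 1) by ring] at h5
  generalize thetaNum q (b + 2) = T at *
  generalize thetaNum q (t + 1) = B at *
  generalize (q : ℚ) ^ (b + 2) = x at *
  generalize (q : ℚ) ^ (t + 1) = y at *
  refine lt_of_lt_of_le ?_ hQ
  generalize (q : ℚ) = r at *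
  have hu : 0 < r - 1 := by linarith
  have hy0 : 0 < y := by nlinarith
  have e1 : (B * (r - 1)) * (T * (r - 1)) < (r * y) * (r * x) :=
    mul_lt_mul'' h5 h1 (by positivity) (by positivity)
  have e2 : (B * (r - 1)) * (T * (r - 1)) * (r + 1) < (r * y) * (r * x) * (r + 1) :=
    mul_lt_mul_of_pos_right e1 (by linarith)
  have e3 : T * (r - 1) * (2 * (r - 1)) < r * x * (2 * (r - 1)) :=
    mul_lt_mul_of_pos_right h1 (by linarith)
  have e4 : r * y * (r + 1) + 2 * (r - 1) ≤ y ^ 2 * (r - 1) ^ 2 := by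
    have f1 : 4 * r ^ 2 ≤ y * (r - 1) ^ 2 := by
      have : (4 : ℚ) ≤ (r - 1) ^ 2 := by nlinarith
      nlinarith
    have f2 := mul_le_mul_of_nonneg_left f1 hy0.le
    have f3 : 2 * (r - 1) ≤ y * (3 * r ^ 2 - r) := by
      have : 1 ≤ y := by nlinarith
      nlinarith
    nlinarith
  have e5 := mul_le_mul_of_nonneg_left e4 (show 0 ≤ r * x by positivity)
  have : (B * T * (r + 1) + 2 * T) * (r - 1) ^ 2 < r * x * y ^ 2 * (r - 1) ^ 2 := by
    nlinarith
  exact lt_of_mul_lt_mul_right this (by positivity)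

theorem thetaNum_le_succ_mul (hq : 2 ≤ q) (a : ℕ) :
    thetaNum q (a + 1) ≤ (q + 1) * thetaNum q a := by
  have := pow_le_thetaNum hq a
  have h : (1 : ℚ) ≤ (q : ℚ) ^ a := one_le_pow₀ (by exact_mod_cast (show 1 ≤ q by omega))
  rw [thetaNum_succ' hq]
  linarith

/-- The left side bounds `S` when exactly `c` of the `θ_{b+2}` relevant `(t + 1)`-spaces through `δ`
are covers. It increases with `c`, and the hypothesis on `c` leaves at least `θ_{b+2} - q ^ (b + 2)
= θ_{b+1}` non-covers, each costing at least `M - θ_{b+2} * G`. -/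
theorem one_cover_bound (hq : 3 ≤ q) (ht : 0 < t) (hm : 2 * t + 2 * b + 5 ≤ m) {c : ℚ}
    (hc : c ≤ (q : ℚ) ^ (b + 2)) :
    c * gaussCoeff q (m + 1) (b + 1)
        + (thetaNum q (b + 2) - c) * (thetaNum q (b + 2) * gaussCoeff q m b)
        + thetaNum q (t + 1) * (thetaNum q (b + 2) * (thetaNum q (b + 2) * gaussCoeff q m b))
      < sizeOne q (m + t + 2) (t + b + 2) t := by
  have hq2 : 2 ≤ q := by omega
  refine lt_of_lt_of_le ?_ (le_sizeOne hq2 t (by omega))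
  have hM := gaussCoeff_mul_pow_le hq2 (show b ≤ m by omega)
  have hG := gaussCoeff_pos hq2 (show b ≤ m by omega)
  have h1 := one_cover_gap hq ht hm
  have hT := thetaNum_succ hq2 (b + 1)
  have hT2 := thetaNum_le_succ_mul hq2 (b + 1)
  have p1 := thetaNum_pos hq2 (b + 2)
  have p2 := thetaNum_pos hq2 (b + 1)
  have p3 := thetaNum_pos hq2 (t + 1)
  rw [show b + 1 + 1 = b + 2 by omega] at hT hT2
  have hqp : (0 : ℚ) ≤ q := by positivity
  generalize thetaNum q (b + 2) = T at *
  generalize thetaNum q (b + 1) = T' at *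
  generalize thetaNum q (t + 1) = B at *
  generalize gaussCoeff q (m + 1) (b + 1) = M at *
  generalize gaussCoeff q m b = G at *
  generalize (q : ℚ) ^ (m - b) = Q at *
  have e0 : 0 ≤ B * T * ((q : ℚ) + 1) := by positivity
  have e1 : (Q - T) * G ≤ M - T * G := by linarith
  have e2 : T' * ((Q - T) * G) ≤ (T - c) * (M - T * G) := by
    refine mul_le_mul (by linarith) e1 (mul_nonneg (by linarith) hG.le) (by linarith)
  have e3 : B * T * T < T' * (Q - 2 * T) := by
    have : B * T * T ≤ B * T * ((q + 1) * T') := mul_le_mul_of_nonneg_left hT2 (by positivity)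
    have : T' * (B * T * (q + 1)) < T' * (Q - 2 * T) :=
      mul_lt_mul_of_pos_left (by linarith) p2
    linarith
  have e4 := mul_lt_mul_of_pos_right e3 hG
  linarith

theorem parallel_bound (hq : 3 ≤ q) (ht : 0 < t) (hm : 2 * t + 2 * b + 5 ≤ m) :
    (q + 1) * (thetaNum q (b + 2) * gaussCoeff q m b)
      < gaussCoeff q (m + 1) (b + 1) - gaussCoeff q m b := by
  have hq2 : 2 ≤ q := by omega
  have hM := gaussCoeff_mul_pow_le hq2 (show b ≤ m by omega)
  have hG := gaussCoeff_pos hq2 (show b ≤ m by omega)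
  have h1 := one_cover_gap hq ht hm
  have p1 := thetaNum_pos hq2 (b + 2)
  have p2 := pow_le_thetaNum hq2 (b + 2)
  have p3 := pow_le_thetaNum hq2 (t + 1)
  have o1 : (1 : ℚ) ≤ (q : ℚ) ^ (b + 2) :=
    one_le_pow₀ (by exact_mod_cast (show 1 ≤ q by omega))
  have o2 : (1 : ℚ) ≤ (q : ℚ) ^ (t + 1) :=
    one_le_pow₀ (by exact_mod_cast (show 1 ≤ q by omega))
  have hqp : (0 : ℚ) ≤ q := by positivity
  have e1 : thetaNum q (b + 2) * (q + 1) ≤ thetaNum q (t + 1) * (thetaNum q (b + 2) * (q + 1)) :=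
    le_mul_of_one_le_left (by positivity) (by linarith)
  have e2 : (q + 1) * thetaNum q (b + 2) + 1 < (q : ℚ) ^ (m - b) := by linarith
  have e3 := mul_lt_mul_of_pos_right e2 hG
  linarith

/-- The leading coefficients satisfy `θ_{b+2} - θ_{t+1} ≥ q ^ (b + 2)`, and that many copies of `M`
outweigh all multiples of `G`. -/
theorem sizeTwo_lt_sizeOne (hq : 3 ≤ q) (ht : 0 < t) (hm : 2 * t + 2 * b + 5 ≤ m) (hb : t ≤ b) :
    sizeTwo q (m + t + 2) (t + b + 2) t < sizeOne q (m + t + 2) (t + b + 2) t := by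
  have hq2 : 2 ≤ q := by omega
  refine lt_of_lt_of_le ?_ (le_sizeOne hq2 t (by omega))
  rw [sizeTwo_eq]
  have hM := gaussCoeff_mul_pow_le hq2 (show b ≤ m by omega)
  have hG := gaussCoeff_pos hq2 (show b ≤ m by omega)
  have h1 := one_cover_gap hq ht hm
  have hT := thetaNum_succ hq2 (b + 1)
  rw [show b + 1 + 1 = b + 2 by omega] at hT
  have hT' := thetaNum_le_pow hq (b + 1)
  have hm1 := thetaNum_mono hq2 (show t + 1 ≤ b + 1 by omega)
  have p1 := thetaNum_pos hq2 (b + 2)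
  have p2 := thetaNum_pos hq2 (b + 1)
  have p3 := pow_le_thetaNum hq2 (t + 1)
  have o2 : (1 : ℚ) ≤ (q : ℚ) ^ (t + 1) :=
    one_le_pow₀ (by exact_mod_cast (show 1 ≤ q by omega))
  have hqp : (0 : ℚ) ≤ q := by positivity
  have hx : (0 : ℚ) < (q : ℚ) ^ (b + 2) := by positivity
  rw [show b + 1 + 1 = b + 2 by omega] at hT'
  generalize thetaNum q (b + 2) = T at *
  generalize thetaNum q (b + 1) = T' at *
  generalize thetaNum q (t + 1) = B at *
  generalize gaussCoeff q (m + 1) (b + 1) = M at *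
  generalize gaussCoeff q m b = G at *
  generalize (q : ℚ) ^ (m - b) = Q at *
  generalize (q : ℚ) ^ (b + 2) = x at *
  have hB0 : 0 < B := by linarith
  have e0 : 0 ≤ B * T * ((q : ℚ) + 1) := by positivity
  have e1 : T * T' * G ≤ T * x * G :=
    mul_le_mul_of_nonneg_right (mul_le_mul_of_nonneg_left (by linarith) p1.le) hG.le
  have e2 : x * (T * G) < x * M := by
    refine mul_lt_mul_of_pos_left (lt_of_lt_of_le ?_ hM) hx
    exact mul_lt_mul_of_pos_right (by linarith) hG
  have hM0 : 0 ≤ M := le_trans (mul_nonneg (by linarith) hG.le) hM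
  have e3 : B * M ≤ T' * M := mul_le_mul_of_nonneg_right hm1 hM0
  have e4 : 1 * G ≤ B * G := mul_le_mul_of_nonneg_right (by linarith) hG.le
  subst hT
  nlinarith

theorem sizeOne_lt_sizeTwo (hq : 3 ≤ q) (ht : 0 < t) (hm : 2 * t + 2 * b + 5 ≤ m)
    (hb : b + 2 ≤ t) :
    sizeOne q (m + t + 2) (t + b + 2) t < sizeTwo q (m + t + 2) (t + b + 2) t := by
  have hq2 : 2 ≤ q := by omega
  have h3 : (3 : ℚ) ≤ q := by exact_mod_cast hq
  refine lt_of_le_of_lt (sizeOne_le hq2 t (by omega)) ?_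
  rw [sizeTwo_eq]
  have hM := gaussCoeff_mul_pow_le hq2 (show b ≤ m by omega)
  have hG := one_le_gaussCoeff hq2 (show b ≤ m by omega)
  have hT := thetaNum_succ hq2 t
  have hm1 := thetaNum_mono hq2 hb
  have p0 := thetaNum_pos hq2 (b + 2)
  have hy := sq_le_pow_succ hq ht
  have hB := thetaNum_le_pow hq (t + 1)
  have hk := thetaNum_le_pow hq (t + b + 2)
  have hQ : (q : ℚ) ^ (t + b + 2 + 1) ≤ (q : ℚ) ^ (m - b) :=
    pow_le_pow_right₀ (by linarith) (by omega)
  have hB1 : (q : ℚ) ^ (t + 1) * q * q ≤ (q : ℚ) ^ (m - b) := by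
    calc _ = (q : ℚ) ^ (t + 3) := by ring
      _ ≤ _ := pow_le_pow_right₀ (by linarith) (by omega)
  rw [pow_succ (q : ℚ) (t + 1)] at hB
  generalize thetaNum q (b + 2) = T at *
  generalize thetaNum q (t + b + 2) = K at *
  generalize thetaNum q (t + 1) = B at *
  generalize thetaNum q t = B' at *
  generalize gaussCoeff q (m + 1) (b + 1) = M at *
  generalize gaussCoeff q m b = G at *
  generalize (q : ℚ) ^ (m - b) = Q at *
  generalize (q : ℚ) ^ (t + b + 2 + 1) = z at *
  generalize (q : ℚ) ^ (t + 1) = y at *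
  generalize (q : ℚ) = r at *
  have hy9 : 9 ≤ y := by nlinarith
  have hQ0 : 81 ≤ Q := by nlinarith
  have hM0 : Q ≤ M := le_trans (le_mul_of_one_le_right (by linarith) hG) hM
  have hBQ : 2 * B ≤ Q := by nlinarith
  have e1 : 2 * B * G ≤ M := le_trans (mul_le_mul_of_nonneg_right hBQ (by linarith)) hM
  have e2 : T * M ≤ B' * M := mul_le_mul_of_nonneg_right hm1 (by linarith)
  have e3 : 9 * M ≤ y * M := mul_le_mul_of_nonneg_right hy9 (by linarith)
  subst hT
  nlinarith

/-- For `k = 2 * t + 1` both leading terms are `θ_{b+2} * M` and cancel; what remains is of second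
order. -/
theorem sizeTwo_sub_sizeOne (hq : 2 ≤ q) (hm : b + 2 ≤ m) :
    sizeTwo q (m + (b + 1) + 2) (b + 1 + b + 2) (b + 1)
        - sizeOne q (m + (b + 1) + 2) (b + 1 + b + 2) (b + 1)
      = ∑ i ∈ Finset.range (b + 3), (q : ℚ) ^ i *
            (gaussCoeff q (m + 1) (b + 1) - skewNum q (m + 1) (b + 1) i)
        - (thetaNum q (b + 2) - 1) * gaussCoeff q m b
        - (thetaNum q (b + 1 + b + 2) - thetaNum q (b + 2)) := by
  rw [sizeTwo_eq, sizeOne_eq hq _ (by omega)]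
  simp only [mul_sub, Finset.sum_sub_distrib, ← Finset.sum_mul]
  rw [← thetaNum_eq_sum hq (b + 2)]
  ring

/-- The defect of the `i`-th term, `1 ≤ i ≤ b + 2`, is at least `q ^ i * G`, and these cancel
`(θ_{b+2} - 1) * G`. The term `i = 2` contributes a further `q ^ 3 * skewNum q m b 1`, which is at
least `q ^ (m + 2)` once `b > 0` and so beats `θ_k`. For `b = 0` this surplus is only `q ^ 3 = θ_3 -
θ_2`, whence the tie at `(k, t) = (3, 1)`. -/
theorem sizeOne_lt_sizeTwo_of_eq (hq : 3 ≤ q) (hb : 0 < b) (hm : 2 * (b + 1) + 2 * b + 5 ≤ m) :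
    sizeOne q (m + (b + 1) + 2) (b + 1 + b + 2) (b + 1)
      < sizeTwo q (m + (b + 1) + 2) (b + 1 + b + 2) (b + 1) := by
  have hq2 : 2 ≤ q := by omega
  rw [← sub_pos, sizeTwo_sub_sizeOne hq2 (by omega)]
  have hs : (q : ℚ) * gaussCoeff q m b + q ^ 3 * skewNum q m b 1
      + ∑ i ∈ Finset.range (b + 1), (q : ℚ) ^ (i + 2) * gaussCoeff q m b ≤
      ∑ i ∈ Finset.range (b + 3), (q : ℚ) ^ i *
            (gaussCoeff q (m + 1) (b + 1) - skewNum q (m + 1) (b + 1) i) := by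
    rw [show b + 3 = b + 1 + 1 + 1 by omega, Finset.sum_range_succ' _ (b + 1 + 1),
      Finset.sum_range_succ' _ (b + 1), Finset.sum_range_succ' _ b, Finset.sum_range_succ' _ b]
    have h0 : skewNum q (m + 1) (b + 1) 0 = gaussCoeff q (m + 1) (b + 1) := by simp [skewNum]
    have h0' : skewNum q m b 0 = gaussCoeff q m b := by simp [skewNum]
    have h1 := skewNum_eq_sum hq2 (b := b) (show 1 ≤ m + 1 by omega)
    have h2 := skewNum_eq_sum hq2 (b := b) (show 2 ≤ m + 1 by omega)
    simp only [Finset.sum_range_succ, Finset.range_zero, Finset.sum_empty, pow_zero, one_mul,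
      zero_add, pow_one, h0'] at h1 h2
    have h3 : ∑ i ∈ Finset.range b, (q : ℚ) ^ (i + 1 + 2) * gaussCoeff q m b
        ≤ ∑ i ∈ Finset.range b, (q : ℚ) ^ (i + 1 + 1 + 1) *
          (gaussCoeff q (m + 1) (b + 1) - skewNum q (m + 1) (b + 1) (i + 1 + 1 + 1)) := by
      refine Finset.sum_le_sum fun i hi => ?_
      refine mul_le_mul_of_nonneg_left ?_ (by positivity)
      have hi' := Finset.mem_range.1 hi
      rw [skewNum_eq_sum hq2 (by omega), Finset.sum_range_succ']
      have : 0 ≤ ∑ k ∈ Finset.range (i + 1 + 1), (q : ℚ) ^ (k + 1) * skewNum q m b (k + 1) :=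
        Finset.sum_nonneg fun j _ => mul_nonneg (by positivity) (skewNum_nonneg hq2 _ _ _)
      simp only [pow_zero, one_mul, h0']
      linarith
    simp only [zero_add, h0, h1, h2, pow_zero]
    simp only [one_add_one_eq_two, pow_one] at h3 ⊢
    linarith
  have ht : thetaNum q (b + 2) - 1
      = q + ∑ i ∈ Finset.range (b + 1), (q : ℚ) ^ (i + 2) := by
    rw [thetaNum_eq_sum hq2, Finset.sum_range_succ', Finset.sum_range_succ']
    simp only [zero_add, pow_zero, pow_one]
    ring
  rw [← Finset.sum_mul] at hs
  have hS : (q : ℚ) ^ (m + 2) ≤ q ^ 3 * skewNum q m b 1 := by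
    obtain ⟨c, rfl⟩ : ∃ c, b = c + 1 := ⟨b - 1, by omega⟩
    have := pow_le_gaussCoeff hq2 (show c + 1 ≤ m - 1 by omega)
    rw [skewNum, one_mul]
    calc (q : ℚ) ^ (m + 2) = (q : ℚ) ^ 3 * ((q : ℚ) ^ (c + 1) * (q : ℚ) ^ (m - 1 - (c + 1))) := by
          rw [← pow_add, ← pow_add]; congr 1; omega
      _ ≤ _ := by gcongr
  have hK := thetaNum_le_pow hq (b + 1 + b + 2)
  have hK0 := thetaNum_pos hq2 (b + 1 + b + 2)
  have hK1 := thetaNum_pos hq2 (b + 2)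
  have hKS : (q : ℚ) ^ (b + 1 + b + 2 + 1) ≤ (q : ℚ) ^ (m + 2) :=
    pow_le_pow_right₀ (by exact_mod_cast (show 1 ≤ q by omega)) (by omega)
  rw [ht]
  linarith

theorem sizeOne_eq_sizeTwo (hq : 2 ≤ q) (hm : 2 ≤ m) :
    sizeOne q (m + 1 + 2) 3 1 = sizeTwo q (m + 1 + 2) 3 1 := by
  have := sizeTwo_sub_sizeOne hq (b := 0) hm
  obtain ⟨m, rfl⟩ := Nat.exists_eq_add_of_le' hm
  have h1 := skewNum_eq_sum hq (b := 0) (show 1 ≤ m + 2 + 1 by omega)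
  have h2 := skewNum_eq_sum hq (b := 0) (show 2 ≤ m + 2 + 1 by omega)
  simp only [zero_add, Finset.sum_range_succ, Finset.range_zero, Finset.sum_empty, pow_zero,
    pow_one, one_mul, gaussCoeff_zero_right, skewNum, mul_zero, Nat.sub_zero, mul_one]
    at this h1 h2
  rw [h1, h2, show 1 + 0 + 2 = 3 from rfl] at this
  have e1 := thetaNum_succ hq 2
  have e2 := thetaNum_succ hq 1
  have e3 := thetaNum_succ hq 0
  rw [thetaNum_zero hq] at e3
  simp only [zero_add, show 1 + 1 = 2 by rfl, show 2 + 1 = 3 by rfl, pow_one] at e1 e2 e3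
  rw [e1, e2, e3] at this
  linarith

end

end Bounds

/-! ### Counting linear subspaces over a finite field. -/

section Counting

open Module Submodule

variable {F V : Type*} [Field F] [Finite F] [AddCommGroup V] [Module F V] [Finite V]

omit [Finite F] [Finite V] in
theorem linearIndependent_mkQ_comp_iff (W : Submodule F V) {b : ℕ} (s : Fin b → V) :
    LinearIndependent F (W.mkQ ∘ s) ↔
      LinearIndependent F s ∧ Disjoint (span F (Set.range s)) W := by
  constructor
  · intro h
    refine ⟨h.of_comp _, ?_⟩
    rw [Submodule.disjoint_def]
    intro x hx hxW
    obtain ⟨l, rfl⟩ := (Finsupp.mem_span_range_iff_exists_finsupp).1 hx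
    have h1 : Finsupp.linearCombination F (W.mkQ ∘ s) l = 0 := by
      have : W.mkQ (l.sum fun i a => a • s i) = 0 := by simpa using hxW
      rw [Finsupp.linearCombination_apply]
      simpa [map_finsuppSum] using this
    have := (linearIndependent_iff.1 h) l h1
    simp [this]
  · rintro ⟨h1, h2⟩
    exact h1.map (by simpa using h2)

/-- Under a splitting `V ≃ W × (V ⧸ W)` such a tuple is an arbitrary tuple in `W` together with an
independent tuple in the quotient. -/
theorem card_linearIndependent_mkQ (W : Submodule F V) (b : ℕ) (hb : b ≤ finrank F (V ⧸ W)) :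
    (Nat.card {s : Fin b → V // LinearIndependent F (W.mkQ ∘ s)} : ℚ)
      = (Nat.card F : ℚ) ^ (finrank F W * b) *
        ∏ i ∈ Finset.range b, ((Nat.card F : ℚ) ^ finrank F (V ⧸ W) - (Nat.card F : ℚ) ^ i) := by
  have := Fintype.ofFinite F
  obtain ⟨C, hC⟩ := Submodule.exists_isCompl W
  let e : V ≃ₗ[F] W × (V ⧸ W) :=
    (prodEquivOfIsCompl W C hC).symm.trans
      ((LinearEquiv.refl F W).prodCongr (quotientEquivOfIsCompl W C hC).symm)
  have he : ∀ v, (e v).2 = W.mkQ v := by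
    intro v
    obtain ⟨⟨w, c⟩, rfl⟩ := (prodEquivOfIsCompl W C hC).surjective v
    simp [e]
  let E : (Fin b → V) ≃ (Fin b → W) × (Fin b → V ⧸ W) :=
    (Equiv.arrowCongr (Equiv.refl _) e.toEquiv).trans (Equiv.arrowProdEquivProdArrow _ _ _)
  have hE : ∀ s, (E s).2 = W.mkQ ∘ s := by
    intro s
    ext i
    simp [E, he, Equiv.arrowProdEquivProdArrow]
  let E' : {s : Fin b → V // LinearIndependent F (W.mkQ ∘ s)} ≃
      (Fin b → W) × {u : Fin b → V ⧸ W // LinearIndependent F u} :=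
    { toFun := fun s => ((E s.1).1, ⟨(E s.1).2, by rw [hE]; exact s.2⟩)
      invFun := fun p => ⟨E.symm (p.1, p.2.1), by rw [← hE]; simpa using p.2.2⟩
      left_inv := fun s => by simp
      right_inv := fun p => by simp }
  have : Finite (V ⧸ W) := Finite.of_surjective _ W.mkQ_surjective
  rw [Nat.card_congr E', Nat.card_prod, card_linearIndependent hb, Nat.card_fun,
    Module.natCard_eq_pow_finrank (K := F) (V := W)]
  simp only [Nat.card_eq_fintype_card, Fintype.card_fin, ← pow_mul]
  push_cast
  congr 1
  rw [← Fin.prod_univ_eq_prod_range (fun i => (Fintype.card F : ℚ) ^ finrank F (V ⧸ W)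
    - (Fintype.card F : ℚ) ^ i)]
  refine Finset.prod_congr rfl fun i _ => ?_
  rw [Nat.cast_sub]
  · push_cast; rfl
  · exact Nat.pow_le_pow_right Fintype.card_pos (by omega)

/-- Double counting: each tuple is an ordered basis of its span, the span is skew to `W`, and every
`b`-dimensional space has the same number of ordered bases. -/
theorem card_subspaces_mul (W : Submodule F V) (b : ℕ) :
    Nat.card {s : Fin b → V // LinearIndependent F (W.mkQ ∘ s)}
      = {A : Submodule F V | finrank F A = b ∧ Disjoint A W}.ncard *
        Nat.card {s : Fin b → (Fin b → F) // LinearIndependent F s} := by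
  classical
  have := Fintype.ofFinite F
  let X := {A : Submodule F V // finrank F A = b ∧ Disjoint A W}
  let E : {s : Fin b → V // LinearIndependent F (W.mkQ ∘ s)} ≃
      Σ A : X, {s : Fin b → A.1 // LinearIndependent F s} :=
    { toFun := fun s => ⟨⟨span F (Set.range s.1), by
          have h := (linearIndependent_mkQ_comp_iff W s.1).1 s.2
          exact ⟨by rw [finrank_span_eq_card h.1, Fintype.card_fin], h.2⟩⟩,
          ⟨fun i => ⟨s.1 i, subset_span ⟨i, rfl⟩⟩, by
            have h := (linearIndependent_mkQ_comp_iff W s.1).1 s.2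
            exact LinearIndependent.of_comp (Submodule.subtype _) h.1⟩⟩
      invFun := fun p => ⟨fun i => (p.2.1 i : V), by
        rw [linearIndependent_mkQ_comp_iff]
        refine ⟨p.2.2.map' _ (ker_subtype _), p.1.2.2.mono_left ?_⟩
        rw [span_le]
        rintro _ ⟨i, rfl⟩
        exact (p.2.1 i).2⟩
      left_inv := fun s => rfl
      right_inv := by
        rintro ⟨⟨A, hA⟩, ⟨s, hs⟩⟩
        have : span F (Set.range fun i => (s i : V)) = A := by
          refine eq_of_le_of_finrank_eq ?_ ?_
          · rw [span_le]
            rintro _ ⟨i, rfl⟩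
            exact (s i).2
          · have := finrank_span_eq_card (hs.map' A.subtype (ker_subtype _))
            rw [Fintype.card_fin] at this
            exact this.trans hA.1.symm
        have key : ∀ (B : Submodule F V) (hB : finrank F B = b ∧ Disjoint B W) (h : B = A)
            (s' : Fin b → B) (hs' : LinearIndependent F s') (_ : ∀ i, (s' i : V) = s i),
            (⟨⟨B, hB⟩, ⟨s', hs'⟩⟩ : Σ A : X, {s : Fin b → A.1 // LinearIndependent F s})
              = ⟨⟨A, hA⟩, ⟨s, hs⟩⟩ := by
          rintro B hB rfl s' hs' h
          have : s' = s := by ext i; exact h i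
          subst this
          rfl
        exact key _ _ this _ _ fun i => rfl }
  have hX : ∀ A : X, Nat.card {s : Fin b → A.1 // LinearIndependent F s}
      = Nat.card {s : Fin b → (Fin b → F) // LinearIndependent F s} := by
    intro A
    rw [card_linearIndependent A.2.1.ge, card_linearIndependent (by simp), A.2.1]
    simp
  have : Finite X := Subtype.finite
  have := Fintype.ofFinite X
  rw [Nat.card_congr E, Nat.card_sigma, Finset.sum_congr rfl fun A _ => hX A, Finset.sum_const,
    smul_eq_mul, Finset.card_univ, ← Nat.card_eq_fintype_card]
  rfl

theorem prod_pow_sub_pow (q : ℚ) (a b : ℕ) (hb : b ≤ a) :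
    ∏ i ∈ Finset.range b, (q ^ a - q ^ i)
      = (∏ i ∈ Finset.range b, q ^ i) * ∏ i ∈ Finset.range b, (q ^ (a - i) - 1) := by
  rw [← Finset.prod_mul_distrib]
  refine Finset.prod_congr rfl fun i hi => ?_
  have := Finset.mem_range.1 hi
  rw [mul_sub, ← pow_add, show i + (a - i) = a by omega, mul_one]

/-- The number of `b`-dimensional subspaces that meet `W` trivially. -/
theorem ncard_disjoint_subspaces (W : Submodule F V) (b : ℕ) :
    ({A : Submodule F V | finrank F A = b ∧ Disjoint A W}.ncard : ℚ)
      = (Nat.card F : ℚ) ^ (finrank F W * b) *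
        gaussCoeff (Nat.card F) (finrank F V - finrank F W) b := by
  have hq : 1 < Nat.card F := Finite.one_lt_card
  have hVW : finrank F (V ⧸ W) = finrank F V - finrank F W := by
    have := W.finrank_quotient_add_finrank
    omega
  rcases le_or_gt b (finrank F (V ⧸ W)) with hb | hb
  · have h1 := card_linearIndependent_mkQ W b hb
    have h2 := card_linearIndependent_mkQ (⊥ : Submodule F (Fin b → F)) b
      (by rw [(quotEquivOfEqBot _ rfl).finrank_eq]; simp)
    have h3 : Nat.card {s : Fin b → (Fin b → F) //
        LinearIndependent F ((⊥ : Submodule F (Fin b → F)).mkQ ∘ s)}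
        = Nat.card {s : Fin b → (Fin b → F) // LinearIndependent F s} := by
      simp only [linearIndependent_mkQ_comp_iff, disjoint_bot_right, and_true]
    rw [(quotEquivOfEqBot (⊥ : Submodule F (Fin b → F)) rfl).finrank_eq, h3, finrank_bot, zero_mul,
      pow_zero, one_mul, finrank_fin_fun, prod_pow_sub_pow _ _ _ le_rfl] at h2
    rw [card_subspaces_mul, Nat.cast_mul, h2, prod_pow_sub_pow _ _ _ hb, hVW] at h1
    have hp : ∏ i ∈ Finset.range b, ((Nat.card F : ℚ) ^ (b - i) - 1)
        = ∏ i ∈ Finset.range b, ((Nat.card F : ℚ) ^ (i + 1) - 1) := by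
      rw [← Finset.prod_range_reflect]
      refine Finset.prod_congr rfl fun i hi => ?_
      have := Finset.mem_range.1 hi
      congr 2
      omega
    rw [hp] at h2 h1
    have n1 : ∏ i ∈ Finset.range b, ((Nat.card F : ℚ) ^ (i + 1) - 1) ≠ 0 :=
      Finset.prod_ne_zero_iff.2 fun i _ => (q_pow_sub_one_pos (by omega) i).ne'
    have n2 : ∏ i ∈ Finset.range b, (Nat.card F : ℚ) ^ i ≠ 0 :=
      Finset.prod_ne_zero_iff.2 fun i _ => pow_ne_zero _ (by positivity)
    rw [gaussCoeff, mul_div_assoc', eq_div_iff n1]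
    refine mul_left_cancel₀ n2 ?_
    linear_combination h1
  · rw [gaussCoeff_eq_zero _ (by omega), mul_zero, Nat.cast_eq_zero, Set.ncard_eq_zero]
    refine Set.eq_empty_of_forall_notMem ?_
    rintro A ⟨hA, hAW⟩
    have h1 := Submodule.finrank_sup_add_finrank_inf_eq A W
    rw [hAW.eq_bot, finrank_bot] at h1
    have h2 := Submodule.finrank_le (A ⊔ W)
    have h3 := Submodule.finrank_le W
    omega

/-- The number of subspaces of dimension `finrank X + b` between `X` and `Y`, that meet `W` in
`X` only. -/
theorem ncard_between_skew {X Y : Submodule F V} (hXY : X ≤ Y) {W : Submodule F V} (hXW : X ≤ W)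
    (hWY : W ≤ Y) (b : ℕ) :
    ({A : Submodule F V | X ≤ A ∧ A ≤ Y ∧ finrank F A = finrank F X + b ∧ A ⊓ W = X}.ncard : ℚ)
      = (Nat.card F : ℚ) ^ ((finrank F W - finrank F X) * b) *
        gaussCoeff (Nat.card F) (finrank F Y - finrank F W) b := by
  have hm : finrank F X ≤ finrank F Y := Submodule.finrank_mono hXY
  obtain ⟨C₀, hC₀⟩ := Submodule.exists_isCompl X
  -- `C` is a complement of `X` inside `Y`. By modularity `A ↦ C ⊓ A` identifies the subspaces
  -- between `X` and `Y` with the subspaces of `C`, and turns `A ⊓ W = X` into skewness to `C ⊓ W`.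
  set C := C₀ ⊓ Y with hCdef
  have hCY : C ≤ Y := inf_le_right
  have hXC : X ⊓ C = ⊥ := by rw [hCdef, ← inf_assoc, hC₀.inf_eq_bot, bot_inf_eq]
  have hXCY : X ⊔ C = Y := by rw [hCdef, ← sup_inf_assoc_of_le _ hXY, hC₀.sup_eq_top, top_inf_eq]
  have split : ∀ A, X ≤ A → A ≤ Y → X ⊔ C ⊓ A = A := by
    intro A h1 h2
    rw [← sup_inf_assoc_of_le _ h1, hXCY, inf_eq_right.2 h2]
  have dim : ∀ A, X ≤ A → A ≤ Y → finrank F A = finrank F X + finrank F ↥(C ⊓ A) := by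
    intro A h1 h2
    have h := Submodule.finrank_sup_add_finrank_inf_eq X (C ⊓ A)
    rw [split A h1 h2, ← inf_assoc, hXC, bot_inf_eq, finrank_bot] at h
    exact h
  have fin : ∀ A : Submodule F V, finrank F (comap C.subtype A) = finrank F ↥(C ⊓ A) := by
    intro A
    rw [← map_comap_subtype]
    exact (finrank_map_subtype_eq C _).symm
  have hinj : Function.Injective fun B : Submodule F C => X ⊔ map C.subtype B := by
    have : Function.LeftInverse (fun A => comap C.subtype A)
        (fun B : Submodule F C => X ⊔ map C.subtype B) := by
      intro B
      apply map_injective_of_injective C.injective_subtype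
      have h := map_subtype_le C B
      simp only [map_comap_subtype]
      rw [inf_comm, sup_comm, sup_inf_assoc_of_le _ h, hXC, sup_bot_eq]
    exact this.injective
  have himage : {A : Submodule F V | X ≤ A ∧ A ≤ Y ∧ finrank F A = finrank F X + b ∧ A ⊓ W = X}
      = (fun B : Submodule F C => X ⊔ map C.subtype B) ''
        {B | finrank F B = b ∧ Disjoint B (comap C.subtype W)} := by
    ext A
    constructor
    · rintro ⟨h1, h2, h3, h4⟩
      refine ⟨comap C.subtype A, ⟨?_, ?_⟩, ?_⟩
      · rw [fin]
        have := dim A h1 h2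
        omega
      · rw [disjoint_iff, ← comap_inf, h4, ← disjoint_iff_comap_eq_bot, disjoint_comm, disjoint_iff]
        exact hXC
      · simp only [map_comap_subtype]
        exact split A h1 h2
    · rintro ⟨B, ⟨h1, h2⟩, rfl⟩
      have hB := map_subtype_le C B
      have e : C ⊓ (X ⊔ map C.subtype B) = map C.subtype B := by
        rw [inf_comm, sup_comm, sup_inf_assoc_of_le _ hB, hXC, sup_bot_eq]
      have g1 : X ≤ X ⊔ map C.subtype B := le_sup_left
      have g2 : X ⊔ map C.subtype B ≤ Y := sup_le hXY (hB.trans hCY)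
      refine ⟨g1, g2, ?_, ?_⟩
      · rw [dim _ g1 g2, e, finrank_map_subtype_eq, h1]
      · rw [← split ((X ⊔ map C.subtype B) ⊓ W) (le_inf g1 hXW) (inf_le_left.trans g2),
          ← inf_assoc, e]
        have : map C.subtype B ⊓ W = ⊥ := by
          rw [eq_bot_iff]
          rintro x ⟨⟨y, hy, rfl⟩, hx⟩
          have := (Submodule.disjoint_def.1 h2) y hy hx
          simp [this]
        rw [this, sup_bot_eq]
  rw [himage, Set.ncard_image_of_injective _ hinj, ncard_disjoint_subspaces, fin]
  have d1 := dim Y hXY le_rfl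
  have d2 := dim W hXW hWY
  rw [inf_eq_left.2 hCY] at d1
  congr 2
  · rw [d2, Nat.add_sub_cancel_left]
  · omega

/-- The number of subspaces of dimension `d` between `X` and `Y`. -/
theorem ncard_between {X Y : Submodule F V} (hXY : X ≤ Y) {d : ℕ} (hd : finrank F X ≤ d) :
    ({A : Submodule F V | X ≤ A ∧ A ≤ Y ∧ finrank F A = d}.ncard : ℚ)
      = gaussCoeff (Nat.card F) (finrank F Y - finrank F X) (d - finrank F X) := by
  have h := ncard_between_skew hXY le_rfl hXY (d - finrank F X)
  rw [Nat.sub_self, zero_mul, pow_zero, one_mul, Nat.add_sub_cancel' hd] at h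
  rw [← h]
  congr 2
  ext A
  refine ⟨fun ⟨h1, h2, h3⟩ => ⟨h1, h2, h3, inf_eq_right.2 h1⟩, fun ⟨h1, h2, h3, _⟩ => ⟨h1, h2, h3⟩⟩

theorem ncard_above (X : Submodule F V) {d : ℕ} (hd : finrank F X ≤ d) :
    ({A : Submodule F V | X ≤ A ∧ finrank F A = d}.ncard : ℚ)
      = gaussCoeff (Nat.card F) (finrank F V - finrank F X) (d - finrank F X) := by
  have h := ncard_between (le_top : X ≤ ⊤) hd
  rw [finrank_top] at h
  rw [← h]
  simp

theorem ncard_below (Y : Submodule F V) (d : ℕ) :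
    ({A : Submodule F V | A ≤ Y ∧ finrank F A = d}.ncard : ℚ)
      = gaussCoeff (Nat.card F) (finrank F Y) d := by
  have h := ncard_between (bot_le : ⊥ ≤ Y) (d := d) (by simp)
  rw [finrank_bot, Nat.sub_zero, Nat.sub_zero] at h
  rw [← h]
  simp

/-- Each member of `S` is related to a member of `I`, and each member of `I` is related to at most
`C` members of `S`. -/
theorem ncard_le_mul_of_rel {α ι : Type*} [Finite α] [Finite ι] {S : Set α} {I : Set ι}
    (r : ι → α → Prop) {C : ℚ} (h : ∀ a ∈ S, ∃ i ∈ I, r i a)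
    (hC : ∀ i ∈ I, ({a ∈ S | r i a}.ncard : ℚ) ≤ C) : (S.ncard : ℚ) ≤ I.ncard * C := by
  classical
  have := Fintype.ofFinite α
  have := Fintype.ofFinite ι
  have h1 : S.toFinset ⊆ I.toFinset.biUnion fun i => {a ∈ S | r i a}.toFinset := by
    intro a ha
    obtain ⟨i, hi, hr⟩ := h a (by simpa using ha)
    simp only [Finset.mem_biUnion, Set.mem_toFinset]
    exact ⟨i, hi, by simpa using ha, hr⟩
  have h2 := (Finset.card_le_card h1).trans Finset.card_biUnion_le
  rw [← Set.ncard_eq_toFinset_card'] at h2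
  calc (S.ncard : ℚ) ≤ ((∑ i ∈ I.toFinset, {a ∈ S | r i a}.toFinset.card : ℕ) : ℚ) := by
        exact_mod_cast h2
    _ = ∑ i ∈ I.toFinset, ({a ∈ S | r i a}.ncard : ℚ) := by
        push_cast
        exact Finset.sum_congr rfl fun i _ => by rw [Set.ncard_eq_toFinset_card']
    _ ≤ ∑ i ∈ I.toFinset, C := Finset.sum_le_sum fun i hi => hC i (by simpa using hi)
    _ = _ := by rw [Finset.sum_const, nsmul_eq_mul, ← Set.ncard_eq_toFinset_card']

end Counting

/-! Subspaces of a vector space that are not contained in a fixed hyperplane `H` -/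

namespace AffLin

open Module Submodule

variable {F V : Type*} [Field F] [AddCommGroup V] [Module F V]

/-- `A` represents an affine `d`-space: it has dimension `d + 1` and is not contained in `H`. -/
def IsSpace (H : Submodule F V) (d : ℕ) (A : Submodule F V) : Prop :=
  ¬ A ≤ H ∧ finrank F A = d + 1

/-- The intersection of `A` and `B` contains an affine `d`-space. -/
def Meets (H : Submodule F V) (d : ℕ) (A B : Submodule F V) : Prop :=
  ¬ A ⊓ B ≤ H ∧ d + 1 ≤ finrank F ↥(A ⊓ B)

/-- `S` is a set of `k`-spaces that pairwise meet in at least a `t`-space. -/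
def IsIntersecting (H : Submodule F V) (k t : ℕ) (S : Set (Submodule F V)) : Prop :=
  (∀ A ∈ S, IsSpace H k A) ∧ S.Pairwise (Meets H t)

/-- `E` meets every member of `S` in at least a `t`-space. -/
def IsCover (H : Submodule F V) (t : ℕ) (S : Set (Submodule F V)) (E : Submodule F V) : Prop :=
  ∀ A ∈ S, Meets H t E A

/-- Distinct members of `S` have distinct parts at infinity. -/
def DistinctAtInfinity (H : Submodule F V) (S : Set (Submodule F V)) : Prop :=
  S.Pairwise fun A B => A ⊓ H ≠ B ⊓ H

/-- The linear counterpart of `AG.IsAdmissible`. -/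
def IsAdmissible (H : Submodule F V) (k : ℕ) (π δ : Submodule F V) (S : Set (Submodule F V)) :
    Prop :=
  π ∈ S ∧ (∀ A ∈ S, IsSpace H k A ∧ A ≤ π ⊔ δ ∧ ¬ δ ⊓ H ≤ A ⊓ H) ∧ DistinctAtInfinity H S

/-- The linear counterpart of `AG.IsExampleOne`. -/
def IsExampleOne (H : Submodule F V) (k t : ℕ) (S : Set (Submodule F V)) : Prop :=
  ∃ (δ π : Submodule F V) (S₁ : Set (Submodule F V)),
    IsSpace H t δ ∧ IsSpace H k π ∧ IsSpace H (t - 1) (π ⊓ δ) ∧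
      Maximal (IsAdmissible H k π δ) S₁ ∧
      S = S₁ ∪ {A | IsSpace H k A ∧ δ ≤ A ∧ Meets H (t + 1) A (π ⊔ δ)}

/-- The linear counterpart of `AG.IsParallelDistinct`. -/
def IsParallelDistinct (H : Submodule F V) (t : ℕ) (Γ : Submodule F V)
    (R : Set (Submodule F V)) : Prop :=
  (∀ A ∈ R, IsSpace H (t + 1) A ∧ A ≤ Γ) ∧ DistinctAtInfinity H R

/-- The linear counterpart of `AG.IsExampleTwo`. -/
def IsExampleTwo (H : Submodule F V) (k t : ℕ) (S : Set (Submodule F V)) : Prop :=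
  ∃ (Γ : Submodule F V) (R : Set (Submodule F V)),
    IsSpace H (t + 2) Γ ∧ Maximal (IsParallelDistinct H t Γ) R ∧
      (R.ncard : ℚ) = thetaNum (Nat.card F) (t + 1) ∧
      S = {A | IsSpace H k A ∧ (Γ ≤ A ∨ A ⊓ Γ ∈ R)}

variable {H : Submodule F V} {k t : ℕ} {S : Set (Submodule F V)}

theorem Meets.symm {d : ℕ} {A B : Submodule F V} (h : Meets H d A B) : Meets H d B A := by
  unfold Meets at *
  rwa [inf_comm]

theorem IsIntersecting.meets (hS : IsIntersecting H k t S) (htk : t ≤ k) {A B : Submodule F V}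
    (hA : A ∈ S) (hB : B ∈ S) : Meets H t A B := by
  rcases eq_or_ne A B with rfl | h
  · have := hS.1 A hA
    refine ⟨by rw [inf_idem]; exact this.1, ?_⟩
    rw [inf_idem, this.2]
    omega
  · exact hS.2 hA hB h

theorem IsIntersecting.insert (hS : IsIntersecting H k t S) {A : Submodule F V}
    (hA : IsSpace H k A) (h : ∀ B ∈ S, Meets H t A B) : IsIntersecting H k t (insert A S) := by
  refine ⟨?_, ?_⟩
  · rintro B (rfl | hB)
    · exact hA
    · exact hS.1 B hB
  · refine hS.2.insert fun B hB _ => ⟨h B hB, (h B hB).symm⟩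

variable [Finite V]

theorem Meets.mono {d e : ℕ} {A B C D : Submodule F V} (h : Meets H d A B) (hAC : A ≤ C)
    (hBD : B ≤ D) (hde : e ≤ d) : Meets H e C D := by
  have h1 : A ⊓ B ≤ C ⊓ D := inf_le_inf hAC hBD
  refine ⟨fun h2 => h.1 (h1.trans h2), ?_⟩
  have := Submodule.finrank_mono h1
  have := h.2
  omega

/-- `A` inherits from `E` the property of meeting every member, so it could be added to `S`;
nonemptiness of `S` is what keeps `A` off infinity. -/
theorem mem_of_isCover (hS : Maximal (IsIntersecting H k t) S) (hne : S.Nonempty)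
    {E A : Submodule F V} (hE : IsCover H t S E) (hEA : E ≤ A) (hA : finrank F A = k + 1) :
    A ∈ S := by
  have hA' : IsSpace H k A := by
    obtain ⟨B, hB⟩ := hne
    refine ⟨fun h => (hE B hB).1 (inf_le_left.trans (hEA.trans h)), hA⟩
  have := hS.2 (hS.1.insert hA' fun B hB => (hE B hB).mono hEA le_rfl le_rfl)
    (Set.subset_insert _ _)
  exact this (Set.mem_insert _ _)

theorem finrank_inf_hyperplane (hH : finrank F H + 1 = finrank F V) {A : Submodule F V}
    (hA : ¬ A ≤ H) : finrank F ↥(A ⊓ H) + 1 = finrank F A := by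
  have h1 := Submodule.finrank_sup_add_finrank_inf_eq A H
  have h2 : H < A ⊔ H := lt_of_le_of_ne le_sup_right fun h => hA (h ▸ le_sup_left)
  have h3 := Submodule.finrank_lt_finrank_of_lt h2
  have h4 := Submodule.finrank_le (A ⊔ H)
  omega

theorem eq_of_le_of_finrank_ge {A B : Submodule F V} (h : A ≤ B)
    (h' : finrank F B ≤ finrank F A) : A = B :=
  Submodule.eq_of_le_of_finrank_le h h'

theorem eq_pencil_of_isCover (hS : Maximal (IsIntersecting H k t) S) (hne : S.Nonempty)
    {E : Submodule F V} (hE : IsCover H t S E) (hEt : finrank F E ≤ t + 1) :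
    IsSpace H t E ∧ S = {A | IsSpace H k A ∧ E ≤ A} := by
  have key : ∀ A ∈ S, finrank F E = t + 1 ∧ E ≤ A := by
    intro A hA
    have h1 := (hE A hA).2
    have h2 := Submodule.finrank_mono (inf_le_left : E ⊓ A ≤ E)
    exact ⟨by omega, inf_eq_left.1 (eq_of_le_of_finrank_ge inf_le_left (by omega))⟩
  refine ⟨?_, ?_⟩
  · obtain ⟨A, hA⟩ := hne
    refine ⟨fun h => (hE A hA).1 (inf_le_left.trans h), (key A hA).1⟩
  · ext A
    exact ⟨fun hA => ⟨hS.1.1 A hA, (key A hA).2⟩, fun hA => mem_of_isCover hS hne hE hA.2 hA.1.2⟩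

section

variable [Finite F]

theorem exists_between_skew {X Y W : Submodule F V} (hXW : X ≤ W) (hWY : W ≤ Y) (b : ℕ)
    (hb : b + finrank F W ≤ finrank F Y) :
    ∃ A, X ≤ A ∧ A ≤ Y ∧ finrank F A = finrank F X + b ∧ A ⊓ W = X := by
  have hq : 2 ≤ Nat.card F := Finite.one_lt_card
  have h := ncard_between_skew (hXW.trans hWY) hXW hWY b
  have h1 := gaussCoeff_pos hq (show b ≤ finrank F Y - finrank F W by omega)
  have h2 : (0 : ℚ) <
      {A : Submodule F V | X ≤ A ∧ A ≤ Y ∧ finrank F A = finrank F X + b ∧ A ⊓ W = X}.ncard := by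
    rw [h]
    have : (0 : ℚ) < Nat.card F := by positivity
    positivity
  exact Set.nonempty_of_ncard_ne_zero (by exact_mod_cast h2.ne')

theorem exists_between {X Y : Submodule F V} (hXY : X ≤ Y) {d : ℕ} (h1 : finrank F X ≤ d)
    (h2 : d ≤ finrank F Y) : ∃ A, X ≤ A ∧ A ≤ Y ∧ finrank F A = d := by
  obtain ⟨A, hA⟩ := exists_between_skew le_rfl hXY (d - finrank F X) (by omega)
  exact ⟨A, hA.1, hA.2.1, by rw [hA.2.2.1]; omega⟩

/-- Let `U` be a complement in `B` of some `D'` between `X ⊓ B` and `B`. If `A ⊓ B` is larger than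
`D'`, then dimensions force `A` to meet `U`. When `X ⊓ B` has dimension at most `t`, it is enlarged
to a `D'` of dimension `t`; when it is large but lies at infinity, `D' = X ⊓ B` works, since `A ⊓ B`
leaves `H` and is strictly bigger. -/
theorem exists_transversal (htk : t ≤ k) {X B : Submodule F V} (hB : finrank F B = k + 1)
    (hXB : ¬ Meets H t X B) :
    ∃ U : Submodule F V, finrank F U ≤ k - t + 1 ∧ X ⊓ U = ⊥ ∧
      ∀ A, X ≤ A → Meets H t A B → U ⊓ A ≠ ⊥ := by
  have aux : ∀ D', X ⊓ B ≤ D' → D' ≤ B → t ≤ finrank F D' →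
      (∀ A, X ≤ A → Meets H t A B → finrank F D' < finrank F ↥(A ⊓ B)) →
      ∃ U : Submodule F V, finrank F U ≤ k - t + 1 ∧ X ⊓ U = ⊥ ∧
      ∀ A, X ≤ A → Meets H t A B → U ⊓ A ≠ ⊥ := by
    intro D' hD hDB ht hlt
    obtain ⟨U, -, hUB, hU, hUD⟩ := exists_between_skew (bot_le : ⊥ ≤ D') hDB
      (k + 1 - finrank F D') (by have := Submodule.finrank_mono hDB; omega)
    rw [finrank_bot] at hU
    refine ⟨U, by omega, ?_, ?_⟩
    · rw [eq_bot_iff, ← hUD]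
      exact le_inf inf_le_right ((inf_le_inf le_rfl hUB).trans hD)
    · intro A hXA hAB hUA
      have h1 := Submodule.finrank_sup_add_finrank_inf_eq U (A ⊓ B)
      rw [← inf_assoc, hUA, bot_inf_eq, finrank_bot] at h1
      have h2 := Submodule.finrank_mono (sup_le hUB (inf_le_right : A ⊓ B ≤ B))
      have h3 := hlt A hXA hAB
      omega
  rcases le_or_gt (finrank F ↥(X ⊓ B)) t with h | h
  · obtain ⟨D', h1, h2, h3⟩ := exists_between (inf_le_right : X ⊓ B ≤ B) h (by omega)
    exact aux D' h1 h2 h3.ge fun A _ hAB => by have := hAB.2; omega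
  · have hle : X ⊓ B ≤ H := by
      by_contra h'
      exact hXB ⟨h', h⟩
    refine aux _ le_rfl inf_le_right h.le fun A hXA hAB => ?_
    refine Submodule.finrank_lt_finrank_of_lt (lt_of_le_of_ne (inf_le_inf hXA le_rfl) ?_)
    intro h'
    exact hAB.1 (h' ▸ hle)

/-- The basic branching step: each member through `X` also contains one of the at most `θ_{k-t}`
points of the transversal `U`, and adjoining that point raises the dimension of `X` by exactly one.
-/
theorem ncard_le_of_not_meets (htk : t ≤ k) {X B : Submodule F V} (hB : finrank F B = k + 1)
    (hXB : ¬ Meets H t X B) (hX : ∀ A ∈ S, X ≤ A) (hSB : ∀ A ∈ S, Meets H t A B) {C : ℚ}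
    (hC0 : 0 ≤ C)
    (hC : ∀ Y, X ≤ Y → finrank F Y = finrank F X + 1 → ({A ∈ S | Y ≤ A}.ncard : ℚ) ≤ C) :
    (S.ncard : ℚ) ≤ thetaNum (Nat.card F) (k - t) * C := by
  have hq : 2 ≤ Nat.card F := Finite.one_lt_card
  obtain ⟨U, hU, hXU, hUS⟩ := exists_transversal htk hB hXB
  have h := ncard_le_mul_of_rel (S := S) (I := {L | L ≤ U ∧ finrank F L = 1})
    (fun L A => X ⊔ L ≤ A) (C := C) ?_ ?_
  · refine h.trans (mul_le_mul_of_nonneg_right ?_ hC0)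
    rw [ncard_below]
    cases hu : finrank F U with
    | zero =>
      rw [gaussCoeff_eq_zero _ zero_lt_one]
      exact (thetaNum_pos hq _).le
    | succ u => exact thetaNum_mono hq (by omega)
  · intro A hA
    obtain ⟨v, hv, hv0⟩ := (Submodule.ne_bot_iff _).1 (hUS A (hX A hA) (hSB A hA))
    refine ⟨span F {v}, ⟨?_, finrank_span_singleton hv0⟩, ?_⟩
    · rw [span_singleton_le_iff_mem]; exact hv.1
    · refine sup_le (hX A hA) ?_
      rw [span_singleton_le_iff_mem]; exact hv.2
  · rintro L ⟨hL, hL1⟩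
    refine hC _ le_sup_left ?_
    have h1 := Submodule.finrank_sup_add_finrank_inf_eq X L
    have h2 : X ⊓ L = ⊥ := by
      rw [eq_bot_iff, ← hXU]
      exact inf_le_inf le_rfl hL
    rw [h2, finrank_bot] at h1
    omega

theorem ncard_above_le (hS : ∀ A ∈ S, IsSpace H k A) (X : Submodule F V)
    (hX : finrank F X ≤ k + 1) :
    ({A ∈ S | X ≤ A}.ncard : ℚ)
      ≤ gaussCoeff (Nat.card F) (finrank F V - finrank F X) (k + 1 - finrank F X) := by
  rw [← ncard_above X hX]
  have : {A ∈ S | X ≤ A} ⊆ {A : Submodule F V | X ≤ A ∧ finrank F A = k + 1} :=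
    fun A hA => ⟨hA.2, (hS A hA.1).2⟩
  exact_mod_cast Set.ncard_le_ncard this (Set.toFinite _)

theorem degree_le (hS : IsIntersecting H k t S) (htk : t ≤ k) {c : ℕ} (hc : c ≤ k + 1)
    (hcover : ∀ E : Submodule F V, finrank F E < c → ¬ IsCover H t S E) (i : ℕ) (X : Submodule F V)
    (hX : finrank F X + i = c) :
    ({A ∈ S | X ≤ A}.ncard : ℚ) ≤ thetaNum (Nat.card F) (k - t) ^ i *
      gaussCoeff (Nat.card F) (finrank F V - c) (k + 1 - c) := by
  have hq : 2 ≤ Nat.card F := Finite.one_lt_card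
  induction i generalizing X with
  | zero =>
    obtain rfl : finrank F X = c := hX
    simpa using ncard_above_le hS.1 X hc
  | succ i ih =>
    have := hcover X (by omega)
    simp only [IsCover, not_forall] at this
    obtain ⟨B, hB, hXB⟩ := this
    rw [pow_succ', mul_assoc]
    refine ncard_le_of_not_meets htk (hS.1 B hB).2 hXB (fun A hA => hA.2)
      (fun A hA => hS.meets htk hA.1 hB)
      (mul_nonneg (pow_nonneg (thetaNum_pos hq _).le _) (gaussCoeff_nonneg hq _ _)) ?_
    intro Y hXY hY
    refine le_trans ?_ (ih Y (by omega))
    have : {A ∈ {A ∈ S | X ≤ A} | Y ≤ A} ⊆ {A ∈ S | Y ≤ A} := fun A hA => ⟨hA.1.1, hA.2⟩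
    exact_mod_cast Set.ncard_le_ncard this (Set.toFinite _)

theorem ncard_lt_of_no_small_cover {m b : ℕ} (hS : IsIntersecting H (t + b + 2) t S)
    (hV : finrank F V = m + t + 3) (hq : 3 ≤ Nat.card F) (ht : 0 < t)
    (hm : 2 * t + 2 * b + 5 ≤ m) (hne : S.Nonempty)
    (hcover : ∀ E : Submodule F V, finrank F E < t + 3 → ¬ IsCover H t S E) :
    (S.ncard : ℚ) < sizeOne (Nat.card F) (m + t + 2) (t + b + 2) t := by
  classical
  obtain ⟨A₀, hA₀⟩ := hne
  have hex : ∃ c, ∃ E : Submodule F V, finrank F E = c ∧ IsCover H t S E :=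
    ⟨_, A₀, rfl, fun B hB => hS.meets (by omega) hA₀ hB⟩
  obtain ⟨E, hEc, hE⟩ := Nat.find_spec hex
  have hmin : ∀ E' : Submodule F V, finrank F E' < Nat.find hex → ¬ IsCover H t S E' :=
    fun E' h1 h2 => Nat.find_min hex h1 ⟨E', rfl, h2⟩
  -- Members of `S` are themselves covers, which caps the least dimension at `k + 1`.
  have hle : Nat.find hex ≤ t + b + 3 := Nat.find_min' hex
    ⟨A₀, (hS.1 A₀ hA₀).2, fun B hB => hS.meets (by omega) hA₀ hB⟩
  have hge : t + 3 ≤ Nat.find hex := by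
    by_contra h
    exact hcover E (by omega) hE
  obtain ⟨j, hj⟩ := Nat.exists_eq_add_of_le hge
  rw [hj] at hEc hmin hle
  refine lt_of_le_of_lt ?_ (large_cover_bound hq ht hm (show j ≤ b by omega))
  rw [← hEc, ← ncard_below E (t + 1)]
  refine ncard_le_mul_of_rel (fun X A => X ≤ A) ?_ ?_
  · intro A hA
    obtain ⟨X, -, hX, hXd⟩ := exists_between (bot_le : ⊥ ≤ E ⊓ A) (d := t + 1) (by simp) (hE A hA).2
    exact ⟨X, ⟨hX.trans inf_le_left, hXd⟩, hX.trans inf_le_right⟩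
  · rintro X ⟨-, hX⟩
    have := degree_le hS (by omega) (by omega) hmin (j + 2) X (by omega)
    rwa [show t + b + 2 - t = b + 2 by omega, show t + b + 2 + 1 - (t + 3 + j) = b - j by omega,
      hV, show m + t + 3 - (t + 3 + j) = m - j by omega] at this

end

end AffLin

/-! ### Counting a set through the fibers of a map. -/

theorem ncard_eq_sum_fiber {α ι : Type*} [Finite α] {S : Set α} {I : Set ι}
    (hI : I.Finite) (f : α → ι) (h : ∀ a ∈ S, f a ∈ I) :
    (S.ncard : ℚ) = ∑ i ∈ hI.toFinset, ({a ∈ S | f a = i}.ncard : ℚ) := by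
  classical
  have := Fintype.ofFinite α
  have h1 := Finset.card_eq_sum_card_fiberwise (s := S.toFinset) (t := hI.toFinset) (f := f)
    (fun a ha => by simpa using h a (by simpa using ha))
  rw [Set.ncard_eq_toFinset_card', h1, Nat.cast_sum]
  refine Finset.sum_congr rfl fun i _ => ?_
  rw [Set.ncard_eq_toFinset_card']
  congr 2
  ext a
  simp

theorem ncard_eq_mul_of_fiber {α ι : Type*} [Finite α] {S : Set α} {I : Set ι}
    (hI : I.Finite) (f : α → ι) (h : ∀ a ∈ S, f a ∈ I) {C : ℚ}
    (hC : ∀ i ∈ I, ({a ∈ S | f a = i}.ncard : ℚ) = C) : (S.ncard : ℚ) = I.ncard * C := by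
  rw [ncard_eq_sum_fiber hI f h, Finset.sum_congr rfl fun i hi => hC i (by simpa using hi),
    Finset.sum_const, nsmul_eq_mul, Set.ncard_eq_toFinset_card I hI]

theorem ncard_le_mul_of_fiber {α ι : Type*} [Finite α] {S : Set α} {I : Set ι}
    (hI : I.Finite) (f : α → ι) (h : ∀ a ∈ S, f a ∈ I) {C : ℚ}
    (hC : ∀ i ∈ I, ({a ∈ S | f a = i}.ncard : ℚ) ≤ C) :
    (S.ncard : ℚ) ≤ I.ncard * C ∧
      ((S.ncard : ℚ) = I.ncard * C → ∀ i ∈ I, ({a ∈ S | f a = i}.ncard : ℚ) = C) := by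
  have h0 : (I.ncard : ℚ) * C = ∑ i ∈ hI.toFinset, C := by
    rw [Finset.sum_const, nsmul_eq_mul, Set.ncard_eq_toFinset_card I hI]
  rw [ncard_eq_sum_fiber hI f h, h0]
  have h1 : ∀ i ∈ hI.toFinset, ({a ∈ S | f a = i}.ncard : ℚ) ≤ C :=
    fun i hi => hC i (by simpa using hi)
  refine ⟨Finset.sum_le_sum h1, fun he i hi => ?_⟩
  exact (Finset.sum_eq_sum_iff_of_le h1).1 he i (by simpa using hi)

namespace AffLin

open Module Submodule

variable {F V : Type*} [Field F] [AddCommGroup V] [Module F V] [Finite V] [Finite F]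
  {H : Submodule F V} {k t : ℕ} {S : Set (Submodule F V)}

omit [Finite V] [Finite F] in
theorem isSpace_of_le {d : ℕ} {X A : Submodule F V} (hX : ¬ X ≤ H) (hXA : X ≤ A)
    (hA : finrank F A = d + 1) : IsSpace H d A :=
  ⟨fun h => hX (hXA.trans h), hA⟩

/-- The number of `k`-spaces that meet `Γ` in its hyperplane `X`. -/
theorem ncard_inf_eq {X Γ : Submodule F V} (hXΓ : X ≤ Γ) (hX : ¬ X ≤ H)
    (hdim : finrank F Γ = finrank F X + 1) (hk : finrank F Γ ≤ k + 1) :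
    ({A | IsSpace H k A ∧ A ⊓ Γ = X}.ncard : ℚ)
      = gaussCoeff (Nat.card F) (finrank F V - finrank F X) (k + 1 - finrank F X)
        - gaussCoeff (Nat.card F) (finrank F V - finrank F Γ) (k + 1 - finrank F Γ) := by
  rw [← ncard_above X (show finrank F X ≤ k + 1 by omega), ← ncard_above Γ hk]
  have hsub : {A : Submodule F V | Γ ≤ A ∧ finrank F A = k + 1}
      ⊆ {A : Submodule F V | X ≤ A ∧ finrank F A = k + 1} :=
    fun A hA => ⟨hXΓ.trans hA.1, hA.2⟩
  have h : {A | IsSpace H k A ∧ A ⊓ Γ = X} = {A : Submodule F V | X ≤ A ∧ finrank F A = k + 1} \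
      {A : Submodule F V | Γ ≤ A ∧ finrank F A = k + 1} := by
    ext A
    constructor
    · rintro ⟨hA, rfl⟩
      refine ⟨⟨inf_le_left, hA.2⟩, fun h => ?_⟩
      rw [inf_eq_right.2 h.1] at hdim
      omega
    · rintro ⟨⟨h1, h2⟩, h3⟩
      refine ⟨isSpace_of_le hX h1 h2, (eq_of_le_of_finrank_ge (le_inf h1 hXΓ) ?_).symm⟩
      have h4 : A ⊓ Γ < Γ := lt_of_le_of_ne inf_le_right fun h => h3 ⟨inf_eq_right.1 h, h2⟩
      have := Submodule.finrank_lt_finrank_of_lt h4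
      omega
  rw [h, Set.cast_ncard_sdiff hsub (Set.toFinite _)]

/-! ### Families whose members all meet a `(t+2)`-space in at least a `(t+1)`-space. -/

section CaseTwo

variable {m b : ℕ} {Γ : Submodule F V}

/-- If all traces on `Γ` in the class coincide, `ncard_inf_eq` counts the available `k`-spaces. If
two traces differ, each trace `X` is disjoint in the affine sense from some other member's trace, so
`X` and that member meet only at infinity. Branching then leaves at most `θ_{b+2} * G` members per
trace, and `parallel_bound` makes the class strictly smaller. -/
theorem parallel_class (hV : finrank F V = m + t + 3) (hq : 3 ≤ Nat.card F) (ht : 0 < t)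
    (hm : 2 * t + 2 * b + 5 ≤ m) (hS : IsIntersecting H (t + b + 2) t S)
    (hΓ : IsSpace H (t + 2) Γ) (hSΓ : ∀ A ∈ S, Meets H (t + 1) A Γ) {D : Submodule F V}
    (hDΓ : D ≤ Γ) (hDH : D ≤ H) (hD : finrank F D = t + 1) :
    ({A ∈ {A ∈ S | ¬ Γ ≤ A} | A ⊓ Γ ⊓ H = D}.ncard : ℚ)
        ≤ gaussCoeff (Nat.card F) (m + 1) (b + 1) - gaussCoeff (Nat.card F) m b ∧
      (({A ∈ {A ∈ S | ¬ Γ ≤ A} | A ⊓ Γ ⊓ H = D}.ncard : ℚ)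
          = gaussCoeff (Nat.card F) (m + 1) (b + 1) - gaussCoeff (Nat.card F) m b →
        ∃ X, IsSpace H (t + 1) X ∧ X ≤ Γ ∧ X ⊓ H = D ∧
          {A ∈ {A ∈ S | ¬ Γ ≤ A} | A ⊓ Γ ⊓ H = D} = {A | IsSpace H (t + b + 2) A ∧ A ⊓ Γ = X}) := by
  have hq2 : 2 ≤ Nat.card F := by omega
  have hpar := parallel_bound hq ht hm
  have hG := gaussCoeff_nonneg hq2 m b
  have hT := thetaNum_pos hq2 (b + 2)
  have hpos : 0 < gaussCoeff (Nat.card F) (m + 1) (b + 1) - gaussCoeff (Nat.card F) m b :=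
    lt_of_le_of_lt (by positivity) hpar
  have hdim : ∀ A ∈ S, ¬ Γ ≤ A → finrank F ↥(A ⊓ Γ) = t + 2 := by
    intro A hA hΓA
    have h1 := (hSΓ A hA).2
    have h2 : A ⊓ Γ < Γ := lt_of_le_of_ne inf_le_right fun h => hΓA (inf_eq_right.1 h)
    have h3 := Submodule.finrank_lt_finrank_of_lt h2
    have := hΓ.2
    omega
  set SD := {A ∈ {A ∈ S | ¬ Γ ≤ A} | A ⊓ Γ ⊓ H = D} with hSD
  rcases SD.eq_empty_or_nonempty with he | ⟨A₁, hA₁⟩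
  · rw [he, Set.ncard_empty, Nat.cast_zero]
    exact ⟨hpos.le, fun h => absurd h hpos.ne⟩
  by_cases hall : ∀ A ∈ SD, A ⊓ Γ = A₁ ⊓ Γ
  · have hX : ¬ A₁ ⊓ Γ ≤ H := (hSΓ A₁ hA₁.1.1).1
    have hXd := hdim A₁ hA₁.1.1 hA₁.1.2
    have hcount := ncard_inf_eq (k := t + b + 2) (inf_le_right : A₁ ⊓ Γ ≤ Γ) hX
      (by rw [hXd, hΓ.2]) (by rw [hΓ.2]; omega)
    rw [hXd, hΓ.2, hV, show m + t + 3 - (t + 2) = m + 1 by omega,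
      show t + b + 2 + 1 - (t + 2) = b + 1 by omega, show m + t + 3 - (t + 2 + 1) = m by omega,
      show t + b + 2 + 1 - (t + 2 + 1) = b by omega] at hcount
    have hsub : SD ⊆ {A | IsSpace H (t + b + 2) A ∧ A ⊓ Γ = A₁ ⊓ Γ} :=
      fun A hA => ⟨hS.1 A hA.1.1, hall A hA⟩
    rw [← hcount]
    refine ⟨by exact_mod_cast Set.ncard_le_ncard hsub (Set.toFinite _), fun h => ?_⟩
    refine ⟨A₁ ⊓ Γ, ⟨hX, hXd⟩, inf_le_right, hA₁.2, ?_⟩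
    refine Set.eq_of_subset_of_ncard_le hsub ?_ (Set.toFinite _)
    exact_mod_cast h.ge
  · push Not at hall
    obtain ⟨A₂, hA₂, hne⟩ := hall
    have hlt : (SD.ncard : ℚ)
        < gaussCoeff (Nat.card F) (m + 1) (b + 1) - gaussCoeff (Nat.card F) m b := by
      refine lt_of_le_of_lt ?_ hpar
      -- One of these `q + 1` subspaces is `Γ ⊓ H`, which is nobody's trace; the overcount is
      -- harmless.
      have hcard : ({X : Submodule F V | D ≤ X ∧ X ≤ Γ ∧ finrank F X = t + 2}.ncard : ℚ)
          = Nat.card F + 1 := by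
        rw [ncard_between hDΓ (by omega), hΓ.2, hD, show t + 2 + 1 - (t + 1) = 1 + 1 by omega,
          show t + 2 - (t + 1) = 1 by omega, gaussCoeff_one, thetaNum_succ' hq2 0,
          thetaNum_zero hq2, mul_one]
      rw [← hcard]
      refine ncard_le_mul_of_rel (fun X A => A ⊓ Γ = X) ?_ ?_
      · intro A hA
        exact ⟨A ⊓ Γ, ⟨by rw [← hA.2]; exact inf_le_left, inf_le_right, hdim A hA.1.1 hA.1.2⟩, rfl⟩
      · rintro X ⟨hDX, hXΓ, hX⟩
        obtain ⟨B, hB, hBX⟩ : ∃ B ∈ SD, B ⊓ Γ ≠ X := by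
          by_cases h : A₁ ⊓ Γ = X
          · exact ⟨A₂, hA₂, fun h' => hne (h'.trans h.symm)⟩
          · exact ⟨A₁, hA₁, h⟩
        have hXB : ¬ Meets H t X B := by
          intro hXB
          refine hXB.1 ?_
          have h1 : D ≤ X ⊓ B := le_inf hDX (by
            rw [← hB.2]; exact inf_le_left.trans inf_le_left)
          have h2 : X ⊓ B < X := by
            refine lt_of_le_of_ne inf_le_left fun h => hBX ?_
            refine (eq_of_le_of_finrank_ge (le_inf (inf_eq_left.1 h) hXΓ) ?_).symm
            rw [hdim B hB.1.1 hB.1.2, hX]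
          have h3 := Submodule.finrank_lt_finrank_of_lt h2
          rw [← eq_of_le_of_finrank_ge h1 (by omega)]
          exact hDH
        have := ncard_le_of_not_meets (S := {A ∈ SD | A ⊓ Γ = X}) (by omega)
          (hS.1 B hB.1.1).2 hXB (fun A hA => by rw [← hA.2]; exact inf_le_left)
          (fun A hA => hS.meets (by omega) hA.1.1.1 hB.1.1) hG ?_
        · rwa [show t + b + 2 - t = b + 2 by omega] at this
        · intro Y _ hY
          have := ncard_above_le (S := {A ∈ SD | A ⊓ Γ = X}) (fun A hA => hS.1 A hA.1.1.1) Y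
            (by omega)
          rwa [hY, hX, hV, show m + t + 3 - (t + 2 + 1) = m by omega,
            show t + b + 2 + 1 - (t + 2 + 1) = b by omega] at this
    exact ⟨hlt.le, fun h => absurd h hlt.ne⟩

theorem ncard_le_sizeTwo (hH : finrank F H + 1 = finrank F V)
    (hV : finrank F V = m + t + 3) (hq : 3 ≤ Nat.card F) (ht : 0 < t)
    (hm : 2 * t + 2 * b + 5 ≤ m) (hS : IsIntersecting H (t + b + 2) t S)
    (hΓ : IsSpace H (t + 2) Γ) (hSΓ : ∀ A ∈ S, Meets H (t + 1) A Γ) :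
    (S.ncard : ℚ) ≤ sizeTwo (Nat.card F) (m + t + 2) (t + b + 2) t ∧
      ((S.ncard : ℚ) = sizeTwo (Nat.card F) (m + t + 2) (t + b + 2) t →
        IsExampleTwo H (t + b + 2) t S) := by
  have hq2 : 2 ≤ Nat.card F := by omega
  set I := {D : Submodule F V | D ≤ Γ ⊓ H ∧ finrank F D = t + 1} with hI
  have hIcard : (I.ncard : ℚ) = thetaNum (Nat.card F) (t + 1) := by
    have h1 := finrank_inf_hyperplane hH hΓ.1
    rw [hΓ.2] at h1
    rw [hI, ncard_below, show finrank F ↥(Γ ⊓ H) = t + 1 + 1 by omega, gaussCoeff_succ_self hq2]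
  have hfib : ∀ A ∈ {A ∈ S | ¬ Γ ≤ A}, A ⊓ Γ ⊓ H ∈ I := by
    rintro A ⟨hA, hΓA⟩
    refine ⟨inf_le_inf inf_le_right le_rfl, ?_⟩
    have h1 := (hSΓ A hA)
    have h2 : A ⊓ Γ < Γ := lt_of_le_of_ne inf_le_right fun h => hΓA (inf_eq_right.1 h)
    have h3 := Submodule.finrank_lt_finrank_of_lt h2
    have h4 := finrank_inf_hyperplane hH h1.1
    have := h1.2
    have := hΓ.2
    omega
  have hclass := fun (D : Submodule F V) (hD : D ∈ I) =>
    parallel_class hV hq ht hm hS hΓ hSΓ (hD.1.trans inf_le_left) (hD.1.trans inf_le_right) hD.2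
  obtain ⟨hle, heq⟩ := ncard_le_mul_of_fiber (Set.toFinite I) (fun A => A ⊓ Γ ⊓ H) hfib
    (fun D hD => (hclass D hD).1)
  have habove := ncard_above Γ (d := t + b + 2 + 1) (by rw [hΓ.2]; omega)
  rw [hΓ.2, hV, show m + t + 3 - (t + 2 + 1) = m by omega,
    show t + b + 2 + 1 - (t + 2 + 1) = b by omega] at habove
  have hsub : {A ∈ S | Γ ≤ A} ⊆ {A : Submodule F V | Γ ≤ A ∧ finrank F A = t + b + 2 + 1} :=
    fun A hA => ⟨hA.2, (hS.1 A hA.1).2⟩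
  have hle' : ({A ∈ S | Γ ≤ A}.ncard : ℚ) ≤ gaussCoeff (Nat.card F) m b := by
    rw [← habove]
    exact_mod_cast Set.ncard_le_ncard hsub (Set.toFinite _)
  have hsplit : (S.ncard : ℚ) = {A ∈ S | Γ ≤ A}.ncard + {A ∈ S | ¬ Γ ≤ A}.ncard := by
    have := Set.ncard_inter_add_ncard_sdiff_eq_ncard S {A | Γ ≤ A} (Set.toFinite _)
    rw [← this]
    push_cast
    rfl
  rw [sizeTwo_eq, hsplit, ← hIcard]
  refine ⟨by linarith, fun h => ?_⟩
  have e1 : {A ∈ S | Γ ≤ A} = {A : Submodule F V | Γ ≤ A ∧ finrank F A = t + b + 2 + 1} := by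
    refine Set.eq_of_subset_of_ncard_le hsub ?_ (Set.toFinite _)
    have : ({A : Submodule F V | Γ ≤ A ∧ finrank F A = t + b + 2 + 1}.ncard : ℚ)
        ≤ {A ∈ S | Γ ≤ A}.ncard := by rw [habove]; linarith
    exact_mod_cast this
  have e2 : ∀ D : Submodule F V, ∃ X, D ∈ I → IsSpace H (t + 1) X ∧ X ≤ Γ ∧ X ⊓ H = D ∧
      {A ∈ {A ∈ S | ¬ Γ ≤ A} | A ⊓ Γ ⊓ H = D} = {A | IsSpace H (t + b + 2) A ∧ A ⊓ Γ = X} := by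
    intro D
    by_cases hD : D ∈ I
    · obtain ⟨X, hX⟩ := (hclass D hD).2 (heq (by linarith) D hD)
      exact ⟨X, fun _ => hX⟩
    -- A dummy value: only the `X D` with `D ∈ I` are used.
    · exact ⟨⊥, fun h => absurd h hD⟩
  choose X hX using e2
  have hXinj : Set.InjOn X I := by
    intro D hD D' hD' h
    rw [← (hX D hD).2.2.1, ← (hX D' hD').2.2.1, h]
  refine ⟨Γ, X '' I, hΓ, ⟨⟨?_, ?_⟩, ?_⟩, ?_, ?_⟩
  · rintro _ ⟨D, hD, rfl⟩
    exact ⟨(hX D hD).1, (hX D hD).2.1⟩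
  · rintro _ ⟨D, hD, rfl⟩ _ ⟨D', hD', rfl⟩ hne h
    rw [(hX D hD).2.2.1, (hX D' hD').2.2.1] at h
    exact hne (by rw [h])
  -- `X '' I` already uses every possible part at infinity, so nothing can be added.
  · intro R hR hsubR A hA
    have hD : A ⊓ H ∈ I := by
      refine ⟨inf_le_inf (hR.1 A hA).2 le_rfl, ?_⟩
      have h1 := finrank_inf_hyperplane hH (hR.1 A hA).1.1
      have := (hR.1 A hA).1.2
      omega
    refine ⟨_, hD, ?_⟩
    by_contra hne
    exact hR.2 (hsubR ⟨_, hD, rfl⟩) hA hne (hX _ hD).2.2.1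
  · rw [hXinj.ncard_image, hIcard]
  · ext A
    constructor
    · intro hA
      refine ⟨hS.1 A hA, ?_⟩
      by_cases hΓA : Γ ≤ A
      · exact Or.inl hΓA
      · have hD := hfib A ⟨hA, hΓA⟩
        have hmem : A ∈ {B ∈ {A ∈ S | ¬ Γ ≤ A} | B ⊓ Γ ⊓ H = A ⊓ Γ ⊓ H} := ⟨⟨hA, hΓA⟩, rfl⟩
        rw [(hX _ hD).2.2.2] at hmem
        exact Or.inr ⟨_, hD, hmem.2.symm⟩
    · rintro ⟨hA, hΓA | ⟨D, hD, hAD⟩⟩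
      · have : A ∈ {A : Submodule F V | Γ ≤ A ∧ finrank F A = t + b + 2 + 1} := ⟨hΓA, hA.2⟩
        rw [← e1] at this
        exact this.1
      · have : A ∈ {A | IsSpace H (t + b + 2) A ∧ A ⊓ Γ = X D} := ⟨hA, hAD.symm⟩
        rw [← (hX D hD).2.2.2] at this
        exact this.1.1

theorem IsExampleTwo.ncard_eq (hV : finrank F V = m + t + 3)
    (hS : IsExampleTwo H (t + b + 2) t S) :
    (S.ncard : ℚ) = sizeTwo (Nat.card F) (m + t + 2) (t + b + 2) t := by
  obtain ⟨Γ, R, hΓ, hR, hRcard, rfl⟩ := hS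
  have habove := ncard_above Γ (d := t + b + 2 + 1) (by rw [hΓ.2]; omega)
  rw [hΓ.2, hV, show m + t + 3 - (t + 2 + 1) = m by omega,
    show t + b + 2 + 1 - (t + 2 + 1) = b by omega] at habove
  have hfib := ncard_eq_mul_of_fiber (S := {A | IsSpace H (t + b + 2) A ∧ A ⊓ Γ ∈ R})
    (Set.toFinite R) (fun A => A ⊓ Γ) (fun A hA => hA.2)
    (C := gaussCoeff (Nat.card F) (m + 1) (b + 1) - gaussCoeff (Nat.card F) m b) (by
      intro X hX
      obtain ⟨hXs, hXΓ⟩ := hR.1.1 X hX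
      have hcount := ncard_inf_eq (k := t + b + 2) hXΓ hXs.1 (by rw [hXs.2, hΓ.2])
        (by rw [hΓ.2]; omega)
      rw [hXs.2, hΓ.2, hV, show m + t + 3 - (t + 1 + 1) = m + 1 by omega,
        show t + b + 2 + 1 - (t + 1 + 1) = b + 1 by omega,
        show m + t + 3 - (t + 2 + 1) = m by omega,
        show t + b + 2 + 1 - (t + 2 + 1) = b by omega] at hcount
      rw [← hcount]
      congr 2
      ext A
      exact ⟨fun hA => ⟨hA.1.1, hA.2⟩, fun hA => ⟨⟨hA.1, by rw [hA.2]; exact hX⟩, hA.2⟩⟩)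
  have hdisj : Disjoint {A : Submodule F V | Γ ≤ A ∧ finrank F A = t + b + 2 + 1}
      {A | IsSpace H (t + b + 2) A ∧ A ⊓ Γ ∈ R} := by
    rw [Set.disjoint_left]
    rintro A ⟨hA, -⟩ ⟨-, hAR⟩
    rw [inf_eq_right.2 hA] at hAR
    have h1 := (hR.1.1 _ hAR).1.2
    have h2 := hΓ.2
    omega
  have hunion : {A | IsSpace H (t + b + 2) A ∧ (Γ ≤ A ∨ A ⊓ Γ ∈ R)}
      = {A : Submodule F V | Γ ≤ A ∧ finrank F A = t + b + 2 + 1} ∪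
        {A | IsSpace H (t + b + 2) A ∧ A ⊓ Γ ∈ R} := by
    ext A
    constructor
    · rintro ⟨h, h1 | h1⟩
      · exact Or.inl ⟨h1, h.2⟩
      · exact Or.inr ⟨h, h1⟩
    · rintro (⟨h1, h2⟩ | ⟨h1, h2⟩)
      · exact ⟨isSpace_of_le hΓ.1 h1 h2, Or.inl h1⟩
      · exact ⟨h1, Or.inr h2⟩
  rw [hunion, Set.ncard_union_eq hdisj (Set.toFinite _) (Set.toFinite _), Nat.cast_add, habove,
    hfib, hRcard, sizeTwo_eq]
  ring

end CaseTwo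

end AffLin

namespace AffLin

open Module Submodule

variable {F V : Type*} [Field F] [AddCommGroup V] [Module F V] [Finite V] [Finite F]
  {H : Submodule F V} {k t : ℕ} {S : Set (Submodule F V)}

theorem gaussCoeff_one_le {q : ℕ} (hq : 2 ≤ q) {x y : ℕ} (h : x ≤ y + 1) :
    gaussCoeff q x 1 ≤ thetaNum q y := by
  cases x with
  | zero =>
    rw [gaussCoeff_eq_zero _ zero_lt_one]
    exact (thetaNum_pos hq _).le
  | succ x => exact thetaNum_mono hq (by omega)

/-! ### The size of Example 1. -/

section Size

variable {m b : ℕ}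

/-- Take all `k`-spaces through `δ` and remove those whose trace on `W` is only `δ`. A larger trace
needs no separate check at infinity, because it contains `δ`. -/
theorem ncard_through_meeting (hV : finrank F V = m + t + 3) {δ W : Submodule F V}
    (hδ : IsSpace H t δ) (hδW : δ ≤ W) (hW : finrank F W = t + b + 4) :
    ({A | IsSpace H (t + b + 2) A ∧ δ ≤ A ∧ Meets H (t + 1) A W}.ncard : ℚ)
      = gaussCoeff (Nat.card F) (m + 2) (b + 2)
        - (Nat.card F : ℚ) ^ ((b + 3) * (b + 2)) * gaussCoeff (Nat.card F) (m - b - 1) (b + 2) := by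
  have h1 := ncard_above δ (d := t + b + 2 + 1) (by rw [hδ.2]; omega)
  have h2 := ncard_between_skew le_top hδW le_top (b + 2)
  rw [hδ.2, hV, show m + t + 3 - (t + 1) = m + 2 by omega,
    show t + b + 2 + 1 - (t + 1) = b + 2 by omega] at h1
  rw [hδ.2, hW, finrank_top, hV, show t + b + 4 - (t + 1) = b + 3 by omega,
    show m + t + 3 - (t + b + 4) = m - b - 1 by omega] at h2
  rw [← h1, ← h2]
  have hsub : {A : Submodule F V | δ ≤ A ∧ A ≤ ⊤ ∧ finrank F A = t + 1 + (b + 2) ∧ A ⊓ W = δ}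
      ⊆ {A : Submodule F V | δ ≤ A ∧ finrank F A = t + b + 2 + 1} :=
    fun A hA => ⟨hA.1, by rw [hA.2.2.1]; omega⟩
  have h : {A | IsSpace H (t + b + 2) A ∧ δ ≤ A ∧ Meets H (t + 1) A W}
      = {A : Submodule F V | δ ≤ A ∧ finrank F A = t + b + 2 + 1} \
        {A : Submodule F V | δ ≤ A ∧ A ≤ ⊤ ∧ finrank F A = t + 1 + (b + 2) ∧ A ⊓ W = δ} := by
    ext A
    constructor
    · rintro ⟨hA, hδA, hAW⟩
      refine ⟨⟨hδA, hA.2⟩, fun h => ?_⟩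
      have := hAW.2
      rw [h.2.2.2, hδ.2] at this
      omega
    · rintro ⟨⟨hδA, hA⟩, h3⟩
      refine ⟨isSpace_of_le hδ.1 hδA hA, hδA, fun h => hδ.1 ((le_inf hδA hδW).trans h), ?_⟩
      have h4 : δ < A ⊓ W := lt_of_le_of_ne (le_inf hδA hδW) fun h =>
        h3 ⟨hδA, le_top, by rw [hA]; omega, h.symm⟩
      have := Submodule.finrank_lt_finrank_of_lt h4
      have := hδ.2
      omega
  rw [h, Set.cast_ncard_sdiff hsub (Set.toFinite _)]

omit [Finite F] in
theorem finrank_sup_of_meet (ht : 0 < t) {δ π : Submodule F V} (hδ : IsSpace H t δ)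
    (hπ : IsSpace H k π) (hπδ : IsSpace H (t - 1) (π ⊓ δ)) : finrank F ↥(π ⊔ δ) = k + 2 := by
  have := Submodule.finrank_sup_add_finrank_inf_eq π δ
  rw [hδ.2, hπ.2, hπδ.2] at this
  omega

/-- `A ↦ A ⊓ H` is injective on `S₁`, and maximality makes its image the set of all hyperplanes of
`W ⊓ H` not containing `δ ⊓ H`: there are `θ_k` hyperplanes, of which `θ_{k-t}` are excluded. -/
theorem ncard_of_maximal_isAdmissible (hH : finrank F H + 1 = finrank F V) (htk : t ≤ k)
    {δ π : Submodule F V} (hδ : IsSpace H t δ)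
    (hW : finrank F ↥(π ⊔ δ) = k + 2) {S₁ : Set (Submodule F V)}
    (hS₁ : Maximal (IsAdmissible H k π δ) S₁) :
    (S₁.ncard : ℚ) = thetaNum (Nat.card F) k - thetaNum (Nat.card F) (k - t) := by
  have hq : 2 ≤ Nat.card F := Finite.one_lt_card
  obtain ⟨hπS, hall, hdist⟩ := hS₁.1
  set W := π ⊔ δ with hWdef
  have hδW : δ ≤ W := le_sup_right
  have hWH : ¬ W ≤ H := fun h => hδ.1 (hδW.trans h)
  have hWH' := finrank_inf_hyperplane hH hWH
  have hδH' := finrank_inf_hyperplane hH hδ.1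
  rw [hδ.2] at hδH'
  have hinj : Set.InjOn (fun A => A ⊓ H) S₁ := by
    intro A hA B hB h
    by_contra hne
    exact hdist hA hB hne h
  have himage : (fun A => A ⊓ H) '' S₁ = {D : Submodule F V | D ≤ W ⊓ H ∧ finrank F D = k} \
      {D : Submodule F V | δ ⊓ H ≤ D ∧ D ≤ W ⊓ H ∧ finrank F D = k} := by
    ext D
    constructor
    · rintro ⟨A, hA, rfl⟩
      obtain ⟨h1, h2, h3⟩ := hall A hA
      have h4 := finrank_inf_hyperplane hH h1.1
      rw [h1.2] at h4
      refine ⟨⟨inf_le_inf h2 le_rfl, ?_⟩, fun h => h3 h.1⟩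
      change finrank F ↥(A ⊓ H) = k
      omega
    · rintro ⟨⟨h1, h2⟩, h3⟩
      by_contra hD
      -- A missing `D` is extended by one dimension off infinity, giving an affine `k`-space in `W`
      -- that could be added.
      obtain ⟨A, hDA, hAW, hA, hAH⟩ := exists_between_skew h1 (inf_le_left : W ⊓ H ≤ W) 1
        (by omega)
      have hAH' : A ⊓ H = D := by rw [← hAH, ← inf_assoc, inf_eq_left.2 hAW]
      have hAH'' : ¬ A ≤ H := by
        intro h
        rw [inf_eq_left.2 h] at hAH'
        rw [hAH'] at hA
        omega
      have hins : IsAdmissible H k π δ (insert A S₁) := by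
        refine ⟨Or.inr hπS, ?_, ?_⟩
        · rintro B (rfl | hB)
          · refine ⟨⟨hAH'', by omega⟩, hAW, ?_⟩
            rw [hAH']
            exact fun h => h3 ⟨h, h1, h2⟩
          · exact hall B hB
        · refine hdist.insert fun B hB _ => ?_
          have : A ⊓ H ≠ B ⊓ H := fun h => hD ⟨B, hB, by rw [← hAH', h]⟩
          exact ⟨this, this.symm⟩
      exact hD ⟨A, hS₁.2 hins (Set.subset_insert _ _) (Set.mem_insert _ _), hAH'⟩
  have hsub : {D : Submodule F V | δ ⊓ H ≤ D ∧ D ≤ W ⊓ H ∧ finrank F D = k}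
      ⊆ {D : Submodule F V | D ≤ W ⊓ H ∧ finrank F D = k} := fun D hD => hD.2
  rw [← hinj.ncard_image, himage, Set.cast_ncard_sdiff hsub (Set.toFinite _), ncard_below, ncard_between (inf_le_inf hδW le_rfl) (by omega),
    show finrank F ↥(W ⊓ H) = k + 1 by omega, show finrank F ↥(δ ⊓ H) = t by omega,
    gaussCoeff_succ_self hq, show k + 1 - t = k - t + 1 by omega, gaussCoeff_succ_self hq]

theorem IsExampleOne.ncard_eq (hH : finrank F H + 1 = finrank F V)
    (hV : finrank F V = m + t + 3) (ht : 0 < t) (hS : IsExampleOne H (t + b + 2) t S) :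
    (S.ncard : ℚ) = sizeOne (Nat.card F) (m + t + 2) (t + b + 2) t := by
  obtain ⟨δ, π, S₁, hδ, hπ, hπδ, hS₁, rfl⟩ := hS
  have hW := finrank_sup_of_meet ht hδ hπ hπδ
  have hdisj : Disjoint S₁ {A | IsSpace H (t + b + 2) A ∧ δ ≤ A ∧ Meets H (t + 1) A (π ⊔ δ)} := by
    rw [Set.disjoint_left]
    rintro A hA ⟨-, hδA, -⟩
    exact (hS₁.1.2.1 A hA).2.2 (inf_le_inf hδA le_rfl)
  rw [Set.ncard_union_eq hdisj (Set.toFinite _) (Set.toFinite _), Nat.cast_add,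
    ncard_of_maximal_isAdmissible hH (by omega) hδ hW hS₁,
    ncard_through_meeting hV hδ le_sup_right hW, sizeOne, show m + t + 2 - t = m + 2 by omega,
    show t + b + 2 - t = b + 2 by omega, show m + t + 2 - (t + b + 2) - 1 = m - b - 1 by omega]
  ring

end Size

/-! ### Covers of dimension `t + 2`: common `t`-space, Example 1, and the classification. -/

section CaseOne

omit [Finite F] in
-- `E ⊓ π` is a hyperplane of `E` not containing `δ`, so together with `δ` it spans `E`.
theorem inf_sup_of_cover {δ π E : Submodule F V} (hδ : finrank F δ = t + 1) (hδE : δ ≤ E)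
    (hE : finrank F E = t + 2) (hEπ : Meets H t E π) (hδπ : ¬ δ ≤ π) :
    finrank F ↥(π ⊓ δ) = t ∧ E ≤ π ⊔ δ := by
  have h1 : E ⊓ π < E := lt_of_le_of_ne inf_le_left fun h => hδπ (hδE.trans (inf_eq_left.1 h))
  have h2 := Submodule.finrank_lt_finrank_of_lt h1
  have h3 := hEπ.2
  have h4 : π ⊓ δ < δ := lt_of_le_of_ne inf_le_right fun h => hδπ (inf_eq_right.1 h)
  have h5 := Submodule.finrank_lt_finrank_of_lt h4
  have h6 : E ⊓ π ⊓ δ = π ⊓ δ := by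
    rw [inf_comm E, inf_assoc, inf_eq_right.2 hδE]
  have h7 := Submodule.finrank_sup_add_finrank_inf_eq (E ⊓ π) δ
  rw [h6] at h7
  have h8 : E ⊓ π ⊔ δ ≤ E := sup_le inf_le_left hδE
  have h9 := Submodule.finrank_mono h8
  refine ⟨by omega, ?_⟩
  rw [← eq_of_le_of_finrank_ge h8 (by omega)]
  exact sup_le_sup inf_le_right le_rfl

omit [Finite F] in
theorem le_finrank_inf_sup {δ π σ : Submodule F V} (hδ : finrank F δ = t + 1)
    (hπδ : finrank F ↥(π ⊓ δ) = t) (hδσ : δ ≤ σ) (hσπ : Meets H t σ π) :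
    t + 2 ≤ finrank F ↥(σ ⊓ (π ⊔ δ)) := by
  have h1 := Submodule.finrank_sup_add_finrank_inf_eq δ (σ ⊓ π)
  have h2 := Submodule.finrank_mono (show δ ⊔ σ ⊓ π ≤ σ ⊓ (π ⊔ δ) from
    sup_le (le_inf hδσ le_sup_right) (le_inf inf_le_left (inf_le_right.trans le_sup_left)))
  have h3 := Submodule.finrank_mono (show δ ⊓ (σ ⊓ π) ≤ π ⊓ δ from
    le_inf (inf_le_right.trans inf_le_right) inf_le_left)
  have := hσπ.2
  omega

variable {m b : ℕ}

theorem degree_le_of_not_isCover (hV : finrank F V = m + t + 3)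
    (hS : IsIntersecting H (t + b + 2) t S) {X : Submodule F V} (hX : finrank F X = t + 2)
    (hcover : ¬ IsCover H t S X) :
    ({A ∈ S | X ≤ A}.ncard : ℚ)
      ≤ thetaNum (Nat.card F) (b + 2) * gaussCoeff (Nat.card F) m b := by
  have hq : 2 ≤ Nat.card F := Finite.one_lt_card
  simp only [IsCover, not_forall] at hcover
  obtain ⟨B, hB, hXB⟩ := hcover
  have := ncard_le_of_not_meets (S := {A ∈ S | X ≤ A}) (by omega) (hS.1 B hB).2 hXB
    (fun A hA => hA.2) (fun A hA => hS.meets (by omega) hA.1 hB) (gaussCoeff_nonneg hq m b) ?_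
  · rwa [show t + b + 2 - t = b + 2 by omega] at this
  · intro Y _ hY
    have := ncard_above_le (S := {A ∈ S | X ≤ A}) (fun A hA => hS.1 A hA.1) Y (by omega)
    rwa [hY, hX, hV, show m + t + 3 - (t + 2 + 1) = m by omega,
      show t + b + 2 + 1 - (t + 2 + 1) = b by omega] at this

/-- The three theta factors are the traces on `E`, then two branching steps. The second is
legitimate because a `(t + 2)`-dimensional subspace of a member not through `δ` cannot be a cover.
-/
theorem ncard_not_through_le (hV : finrank F V = m + t + 3)
    (hS : IsIntersecting H (t + b + 2) t S) {δ E : Submodule F V}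
    (hno : ∀ X : Submodule F V, finrank F X < t + 2 → ¬ IsCover H t S X)
    (hE : IsCover H t S E) (hEd : finrank F E = t + 2)
    (hall : ∀ E, IsCover H t S E → finrank F E = t + 2 → δ ≤ E) :
    ({A ∈ S | ¬ δ ≤ A}.ncard : ℚ) ≤ thetaNum (Nat.card F) (t + 1) *
      (thetaNum (Nat.card F) (b + 2) *
        (thetaNum (Nat.card F) (b + 2) * gaussCoeff (Nat.card F) m b)) := by
  have hq : 2 ≤ Nat.card F := Finite.one_lt_card
  have hG := gaussCoeff_nonneg hq m b
  have hT := thetaNum_pos hq (b + 2)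
  have hI : ({X : Submodule F V | X ≤ E ∧ finrank F X = t + 1}.ncard : ℚ)
      = thetaNum (Nat.card F) (t + 1) := by
    rw [ncard_below, hEd, show t + 2 = t + 1 + 1 by omega, gaussCoeff_succ_self hq]
  rw [← hI]
  refine ncard_le_mul_of_rel (fun X A => E ⊓ A = X) ?_ ?_
  · rintro A ⟨hA, hδA⟩
    refine ⟨_, ⟨inf_le_left, ?_⟩, rfl⟩
    have h1 : E ⊓ A < E := lt_of_le_of_ne inf_le_left fun h =>
      hδA ((hall E hE hEd).trans (inf_eq_left.1 h))
    have h2 := Submodule.finrank_lt_finrank_of_lt h1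
    have := (hE A hA).2
    omega
  · rintro X ⟨-, hX⟩
    have hXc := hno X (by omega)
    simp only [IsCover, not_forall] at hXc
    obtain ⟨B, hB, hXB⟩ := hXc
    have := ncard_le_of_not_meets (S := {A ∈ {A ∈ S | ¬ δ ≤ A} | E ⊓ A = X}) (by omega)
      (hS.1 B hB).2 hXB (fun A hA => by rw [← hA.2]; exact inf_le_right)
      (fun A hA => hS.meets (by omega) hA.1.1 hB)
      (C := thetaNum (Nat.card F) (b + 2) * gaussCoeff (Nat.card F) m b) (by positivity) ?_
    · rwa [show t + b + 2 - t = b + 2 by omega] at this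
    · intro Y _ hY
      by_cases hYc : IsCover H t S Y
      · have : {A ∈ {A ∈ {A ∈ S | ¬ δ ≤ A} | E ⊓ A = X} | Y ≤ A} = ∅ := by
          refine Set.eq_empty_of_forall_notMem fun A hA => ?_
          exact hA.1.1.2 ((hall Y hYc (by omega)).trans hA.2)
        rw [this, Set.ncard_empty, Nat.cast_zero]
        positivity
      · refine le_trans ?_ (degree_le_of_not_isCover hV hS (show finrank F Y = t + 2 by omega) hYc)
        have : {A ∈ {A ∈ {A ∈ S | ¬ δ ≤ A} | E ⊓ A = X} | Y ≤ A} ⊆ {A ∈ S | Y ≤ A} :=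
          fun A hA => ⟨hA.1.1.1, hA.2⟩
        exact_mod_cast Set.ncard_le_ncard this (Set.toFinite _)

/-- Every member through `δ` also meets `π`, hence contains one of the `θ_{b+2}` subspaces of
dimension `t + 2` between `δ` and `π ⊔ δ`. A cover lies in at most `M` members; a non-cover branches
once more. -/
theorem ncard_through_le (hV : finrank F V = m + t + 3)
    (hS : IsIntersecting H (t + b + 2) t S) {δ π : Submodule F V} (hδ : finrank F δ = t + 1)
    (hπ : π ∈ S) (hπδ : finrank F ↥(π ⊓ δ) = t) (hW : finrank F ↥(π ⊔ δ) = t + b + 4) {c : ℚ}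
    (hc : c = {E : Submodule F V | (δ ≤ E ∧ E ≤ π ⊔ δ ∧ finrank F E = t + 2)
      ∧ IsCover H t S E}.ncard) :
    ({A ∈ S | δ ≤ A}.ncard : ℚ) ≤ c * gaussCoeff (Nat.card F) (m + 1) (b + 1)
        + (thetaNum (Nat.card F) (b + 2) - c) *
          (thetaNum (Nat.card F) (b + 2) * gaussCoeff (Nat.card F) m b) := by
  have hq : 2 ≤ Nat.card F := Finite.one_lt_card
  set 𝓕 := {E : Submodule F V | δ ≤ E ∧ E ≤ π ⊔ δ ∧ finrank F E = t + 2} with h𝓕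
  set 𝓒 := {E : Submodule F V | (δ ≤ E ∧ E ≤ π ⊔ δ ∧ finrank F E = t + 2)
      ∧ IsCover H t S E} with h𝓒
  have hsub : 𝓒 ⊆ 𝓕 := fun E hE => hE.1
  have h𝓕card : (𝓕.ncard : ℚ) = thetaNum (Nat.card F) (b + 2) := by
    rw [h𝓕, ncard_between le_sup_right (by omega), hW, hδ,
      show t + b + 4 - (t + 1) = b + 2 + 1 by omega, show t + 2 - (t + 1) = 1 by omega,
      gaussCoeff_one]
  have hdiff : ((𝓕 \ 𝓒).ncard : ℚ) = thetaNum (Nat.card F) (b + 2) - c := by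
    rw [Set.cast_ncard_sdiff hsub (Set.toFinite _), h𝓕card, hc]
  have hex : ∀ A ∈ {A ∈ S | δ ≤ A}, ∃ E ∈ 𝓕, E ≤ A := by
    rintro A ⟨hA, hδA⟩
    obtain ⟨E, h1, h2, h3⟩ := exists_between (le_inf hδA (le_sup_right : δ ≤ π ⊔ δ))
      (d := t + 2) (by omega) (le_finrank_inf_sup hδ hπδ hδA (hS.meets (by omega) hA hπ))
    exact ⟨E, ⟨h1, h2.trans inf_le_right, h3⟩, h2.trans inf_le_left⟩
  have h1 : ({A ∈ {A ∈ S | δ ≤ A} | ∃ E ∈ 𝓒, E ≤ A}.ncard : ℚ)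
      ≤ 𝓒.ncard * gaussCoeff (Nat.card F) (m + 1) (b + 1) := by
    refine ncard_le_mul_of_rel (fun E A => E ≤ A) (fun A hA => hA.2) fun E hE => ?_
    have := ncard_above_le (S := {A ∈ {A ∈ S | δ ≤ A} | ∃ E ∈ 𝓒, E ≤ A})
      (fun A hA => hS.1 A hA.1.1) E (by rw [hE.1.2.2]; omega)
    rwa [hE.1.2.2, hV, show m + t + 3 - (t + 2) = m + 1 by omega,
      show t + b + 2 + 1 - (t + 2) = b + 1 by omega] at this
  have h2 : ({A ∈ {A ∈ S | δ ≤ A} | ∃ E ∈ 𝓕 \ 𝓒, E ≤ A}.ncard : ℚ)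
      ≤ (𝓕 \ 𝓒).ncard * (thetaNum (Nat.card F) (b + 2) * gaussCoeff (Nat.card F) m b) := by
    refine ncard_le_mul_of_rel (fun E A => E ≤ A) (fun A hA => hA.2) fun E hE => ?_
    refine le_trans ?_ (degree_le_of_not_isCover hV hS hE.1.2.2 fun h => hE.2 ⟨hE.1, h⟩)
    have : {A ∈ {A ∈ {A ∈ S | δ ≤ A} | ∃ E ∈ 𝓕 \ 𝓒, E ≤ A} | E ≤ A} ⊆ {A ∈ S | E ≤ A} :=
      fun A hA => ⟨hA.1.1.1, hA.2⟩
    exact_mod_cast Set.ncard_le_ncard this (Set.toFinite _)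
  have h3 : {A ∈ S | δ ≤ A} ⊆ {A ∈ {A ∈ S | δ ≤ A} | ∃ E ∈ 𝓒, E ≤ A} ∪
      {A ∈ {A ∈ S | δ ≤ A} | ∃ E ∈ 𝓕 \ 𝓒, E ≤ A} := by
    intro A hA
    obtain ⟨E, hE, hEA⟩ := hex A hA
    by_cases h : E ∈ 𝓒
    · exact Or.inl ⟨hA, E, h, hEA⟩
    · exact Or.inr ⟨hA, E, ⟨hE, h⟩, hEA⟩
  have h4 := (Set.ncard_le_ncard h3 (Set.toFinite _)).trans (Set.ncard_union_le _ _)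
  have h5 : ({A ∈ S | δ ≤ A}.ncard : ℚ) ≤ {A ∈ {A ∈ S | δ ≤ A} | ∃ E ∈ 𝓒, E ≤ A}.ncard
      + {A ∈ {A ∈ S | δ ≤ A} | ∃ E ∈ 𝓕 \ 𝓒, E ≤ A}.ncard := by exact_mod_cast h4
  rw [hdiff] at h2
  rw [← hc] at h1
  linarith

/-- If more than `q ^ (b + 2)` of the `(t+1)`-spaces through `δ` in `⟨π, δ⟩` are covers, then all
members not through `δ` are hyperplanes of `⟨π, δ⟩` that meet `δ`. -/
theorem sup_eq_of_many_covers (hH : finrank F H + 1 = finrank F V) (hq : 3 ≤ Nat.card F)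
    (hS : IsIntersecting H (t + b + 2) t S) {δ W : Submodule F V} (hδ : IsSpace H t δ)
    (hδW : δ ≤ W) (hW : finrank F W = t + b + 4)
    (hc : (Nat.card F : ℚ) ^ (b + 2) < {E : Submodule F V | (δ ≤ E ∧ E ≤ W ∧ finrank F E = t + 2)
      ∧ IsCover H t S E}.ncard) {σ : Submodule F V} (hσ : σ ∈ S) (hδσ : ¬ δ ≤ σ) :
    finrank F ↥(σ ⊓ δ) = t ∧ σ ⊔ δ = W ∧ ¬ σ ⊓ δ ≤ H := by
  have hq2 : 2 ≤ Nat.card F := by omega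
  set 𝓒 := {E : Submodule F V | (δ ≤ E ∧ E ≤ W ∧ finrank F E = t + 2) ∧ IsCover H t S E} with h𝓒
  have h0 : (0 : ℚ) < 𝓒.ncard := lt_of_le_of_lt (by positivity) hc
  obtain ⟨E₀, hE₀⟩ : 𝓒.Nonempty := Set.nonempty_of_ncard_ne_zero (by exact_mod_cast h0.ne')
  have hmeet : ∀ E ∈ 𝓒, finrank F ↥(σ ⊓ δ) = t ∧ E ≤ σ ⊔ δ := fun E hE =>
    inf_sup_of_cover hδ.2 hE.1.1 hE.1.2.2 (hE.2 σ hσ) hδσ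
  have hσδ := (hmeet E₀ hE₀).1
  have hσd := (hS.1 σ hσ).2
  have hsup : finrank F ↥(σ ⊔ δ) = t + b + 4 := by
    have := Submodule.finrank_sup_add_finrank_inf_eq σ δ
    rw [hσδ, hδ.2, hσd] at this
    omega
  -- Otherwise all counted covers lie in the proper subspace `W ⊓ (σ ⊔ δ)`, which leaves room for
  -- only `θ_{b+1} < q ^ (b + 2)` of them.
  have hWeq : σ ⊔ δ = W := by
    by_contra hne
    have h1 : W ⊓ (σ ⊔ δ) < W := by
      refine lt_of_le_of_ne inf_le_left fun h => hne ?_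
      exact (eq_of_le_of_finrank_ge (inf_eq_left.1 h) (by omega)).symm
    have h2 := Submodule.finrank_lt_finrank_of_lt h1
    have h3 : 𝓒 ⊆ {E | δ ≤ E ∧ E ≤ W ⊓ (σ ⊔ δ) ∧ finrank F E = t + 2} :=
      fun E hE => ⟨hE.1.1, le_inf hE.1.2.1 (hmeet E hE).2, hE.1.2.2⟩
    have h4 : (𝓒.ncard : ℚ) ≤ thetaNum (Nat.card F) (b + 1) := by
      calc (𝓒.ncard : ℚ) ≤ _ := by exact_mod_cast Set.ncard_le_ncard h3 (Set.toFinite _)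
        _ = _ := ncard_between (le_inf hδW le_sup_right) (by rw [hδ.2]; omega)
        _ ≤ _ := by
          rw [hδ.2, show t + 2 - (t + 1) = 1 by omega]
          exact gaussCoeff_one_le hq2 (by omega)
    have h5 := thetaNum_le_pow hq (b + 1)
    have h6 := thetaNum_pos hq2 (b + 1)
    linarith
  refine ⟨hσδ, hWeq, fun hpar => ?_⟩
  have hσH := finrank_inf_hyperplane hH (hS.1 σ hσ).1
  -- If `σ ⊓ δ` is at infinity, `Y` is a hyperplane of `W` meeting `σ` only at infinity, so no cover
  -- lies in `Y`. That leaves at most `θ_{b+2} - θ_{b+1} = q ^ (b + 2)` covers, which is where the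
  -- threshold comes from.
  set Y := δ ⊔ σ ⊓ H with hY
  have hYd : finrank F Y = t + b + 3 := by
    have h1 := Submodule.finrank_sup_add_finrank_inf_eq δ (σ ⊓ H)
    have h2 : δ ⊓ (σ ⊓ H) = σ ⊓ δ := by
      rw [← inf_assoc, inf_comm δ, inf_eq_left.2 hpar]
    rw [h2, hσδ, hδ.2, ← hY] at h1
    omega
  have hYW : Y ≤ W := sup_le hδW (inf_le_left.trans (hWeq ▸ le_sup_left))
  have hYσ : Y ⊓ σ ≤ H := by
    have : Y ⊓ σ = σ ⊓ H ⊔ δ ⊓ σ := by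
      rw [hY, sup_comm, sup_inf_assoc_of_le _ inf_le_left]
    rw [this, inf_comm δ]
    exact sup_le inf_le_right hpar
  have h3 : 𝓒 ⊆ {E | δ ≤ E ∧ E ≤ W ∧ finrank F E = t + 2} \
      {E | δ ≤ E ∧ E ≤ Y ∧ finrank F E = t + 2} :=
    fun E hE => ⟨hE.1, fun h => (hE.2 σ hσ).1 ((inf_le_inf h.2.1 le_rfl).trans hYσ)⟩
  have hsub : {E | δ ≤ E ∧ E ≤ Y ∧ finrank F E = t + 2}
      ⊆ {E | δ ≤ E ∧ E ≤ W ∧ finrank F E = t + 2} :=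
    fun E hE => ⟨hE.1, hE.2.1.trans hYW, hE.2.2⟩
  have h4 : (𝓒.ncard : ℚ) ≤ thetaNum (Nat.card F) (b + 2) - thetaNum (Nat.card F) (b + 1) := by
    calc (𝓒.ncard : ℚ) ≤ _ := by exact_mod_cast Set.ncard_le_ncard h3 (Set.toFinite _)
      _ = _ := Set.cast_ncard_sdiff hsub (Set.toFinite _)
      _ = _ := by
        rw [ncard_between hδW (by rw [hδ.2]; omega),
          ncard_between (le_sup_left : δ ≤ Y) (by rw [hδ.2]; omega), hW, hYd, hδ.2,
          show t + b + 4 - (t + 1) = b + 2 + 1 by omega, show t + 2 - (t + 1) = 1 by omega,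
          show t + b + 3 - (t + 1) = b + 1 + 1 by omega, gaussCoeff_one, gaussCoeff_one]
  have h5 := thetaNum_succ hq2 (b + 1)
  rw [show b + 1 + 1 = b + 2 by omega] at h5
  linarith

/-- `S₁` is the set of members not through `δ`. They are hyperplanes of `W = π ⊔ δ`, which makes
every `(t + 1)`-space between `δ` and `W` a cover; maximality of `S` then supplies all of the second
part of the example. -/
theorem isExampleOne_of_sup_eq (hH : finrank F H + 1 = finrank F V) (ht : 0 < t)
    (hS : Maximal (IsIntersecting H (t + b + 2) t) S) {δ π : Submodule F V} (hδ : IsSpace H t δ)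
    (hπ : π ∈ S) (hδπ : ¬ δ ≤ π)
    (hsup : ∀ σ ∈ S, ¬ δ ≤ σ →
      finrank F ↥(σ ⊓ δ) = t ∧ σ ⊔ δ = π ⊔ δ ∧ ¬ σ ⊓ δ ≤ H) :
    IsExampleOne H (t + b + 2) t S := by
  have hπd := (hS.1.1 π hπ).2
  have hδH := finrank_inf_hyperplane hH hδ.1
  have hW : finrank F ↥(π ⊔ δ) = t + b + 4 := by
    have := Submodule.finrank_sup_add_finrank_inf_eq π δ
    rw [(hsup π hπ hδπ).1, hδ.2, hπd] at this
    omega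
  have hhyp : ∀ σ : Submodule F V, finrank F σ = t + b + 2 + 1 → σ ≤ π ⊔ δ → ∀ X ≤ π ⊔ δ,
      finrank F X ≤ finrank F ↥(σ ⊓ X) + 1 := by
    intro σ hσ hσW X hX
    have h1 := Submodule.finrank_sup_add_finrank_inf_eq σ X
    have h2 := Submodule.finrank_mono (sup_le hσW hX)
    omega
  have hcover : ∀ E, δ ≤ E → E ≤ π ⊔ δ → finrank F E = t + 2 → IsCover H t S E := by
    intro E hδE hEW hE σ hσ
    by_cases hδσ : δ ≤ σ
    · refine ⟨fun h => hδ.1 ((le_inf hδE hδσ).trans h), ?_⟩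
      have := Submodule.finrank_mono (le_inf hδE hδσ)
      have := hδ.2
      omega
    · obtain ⟨-, h2, h3⟩ := hsup σ hσ hδσ
      refine Meets.symm ⟨fun h => h3 ((inf_le_inf le_rfl hδE).trans h), ?_⟩
      have := hhyp σ (hS.1.1 σ hσ).2 (h2 ▸ le_sup_left) E hEW
      omega
  have hthrough : ∀ σ ∈ S, δ ≤ σ → t + 2 ≤ finrank F ↥(σ ⊓ (π ⊔ δ)) := fun σ hσ hδσ =>
    le_finrank_inf_sup hδ.2 (hsup π hπ hδπ).1 hδσ (hS.1.meets (by omega) hσ hπ)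
  refine ⟨δ, π, {σ ∈ S | ¬ δ ≤ σ}, hδ, hS.1.1 π hπ, ⟨(hsup π hπ hδπ).2.2, ?_⟩, ⟨⟨?_, ?_, ?_⟩, ?_⟩,
    ?_⟩
  · rw [(hsup π hπ hδπ).1]
    omega
  · exact ⟨hπ, hδπ⟩
  · rintro σ ⟨hσ, hδσ⟩
    obtain ⟨h1, h2, h3⟩ := hsup σ hσ hδσ
    refine ⟨hS.1.1 σ hσ, h2 ▸ le_sup_left, fun h => h3 ?_⟩
    have h4 : δ ⊓ H ≤ σ ⊓ δ := le_inf (h.trans inf_le_left) inf_le_left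
    have := hδ.2
    rw [← eq_of_le_of_finrank_ge h4 (by omega)]
    exact inf_le_right
  · rintro σ ⟨hσ, -⟩ τ ⟨hτ, -⟩ hne h
    have hσH := finrank_inf_hyperplane hH (hS.1.1 σ hσ).1
    have h1 : σ ⊓ H ≤ σ ⊓ τ := le_inf inf_le_left (h.le.trans inf_le_left)
    have h2 : σ ⊓ τ < σ := by
      refine lt_of_le_of_ne inf_le_left fun h' => hne ?_
      refine eq_of_le_of_finrank_ge (inf_eq_left.1 h') ?_
      rw [(hS.1.1 σ hσ).2, (hS.1.1 τ hτ).2]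
    have h3 := Submodule.finrank_lt_finrank_of_lt h2
    refine (hS.1.2 hσ hτ hne).1 ?_
    rw [← eq_of_le_of_finrank_ge h1 (by omega)]
    exact inf_le_right
  -- An admissible `σ` meets every member. Against a member `B` through `δ`, `σ` cuts the trace of
  -- `B` on `W` in codimension at most one, and `σ ⊓ δ` supplies affine points; against any other
  -- member, both are hyperplanes of `W` with different parts at infinity. Hence `σ ∈ S`.
  · intro A hA hsub σ hσ
    obtain ⟨hσs, hσW, hσδ⟩ := hA.2.1 σ hσ
    have hδσ : ¬ δ ≤ σ := fun h => hσδ (inf_le_inf h le_rfl)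
    refine ⟨?_, hδσ⟩
    by_contra hσS
    refine hσS (hS.2 (hS.1.insert hσs fun B hB => ?_) (Set.subset_insert _ _)
      (Set.mem_insert _ _))
    have hσH := finrank_inf_hyperplane hH hσs.1
    have hσs2 := hσs.2
    by_cases hδB : δ ≤ B
    · have hσδ' : ¬ σ ⊓ δ ≤ H := by
        intro h
        have h1 : σ ⊓ δ ≤ δ ⊓ H := le_inf inf_le_right h
        have h2 := hhyp σ hσs.2 hσW δ le_sup_right
        refine hσδ ?_
        rw [← eq_of_le_of_finrank_ge h1 (by omega)]
        exact le_inf inf_le_left h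
      refine ⟨fun h => hσδ' ((inf_le_inf le_rfl hδB).trans h), ?_⟩
      have h1 := hhyp σ hσs.2 hσW (B ⊓ (π ⊔ δ)) inf_le_right
      have h2 := hthrough B hB hδB
      have h3 := Submodule.finrank_mono
        (inf_le_inf le_rfl inf_le_left : σ ⊓ (B ⊓ (π ⊔ δ)) ≤ σ ⊓ B)
      omega
    · have hBA := hsub ⟨hB, hδB⟩
      have hne : σ ≠ B := fun h => hσS (h ▸ hB)
      have hBs := (hA.2.1 B hBA).1
      have hBs2 := hBs.2
      have hBH := finrank_inf_hyperplane hH hBs.1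
      have h1 := hhyp σ hσs.2 hσW B (hA.2.1 B hBA).2.1
      refine ⟨fun h => hA.2.2 hσ hBA hne ?_, by omega⟩
      have h2 := eq_of_le_of_finrank_ge (le_inf inf_le_left h : σ ⊓ B ≤ σ ⊓ H) (by omega)
      have h3 := eq_of_le_of_finrank_ge (le_inf inf_le_right h : σ ⊓ B ≤ B ⊓ H) (by omega)
      exact h2.symm.trans h3
  · ext σ
    constructor
    · intro hσ
      by_cases hδσ : δ ≤ σ
      · exact Or.inr ⟨hS.1.1 σ hσ, hδσ, fun h => hδ.1 ((le_inf hδσ le_sup_right).trans h),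
          hthrough σ hσ hδσ⟩
      · exact Or.inl ⟨hσ, hδσ⟩
    · rintro (h | ⟨h1, h2, h3⟩)
      · exact h.1
      · obtain ⟨E, e1, e2, e3⟩ := exists_between (le_inf h2 (le_sup_right : δ ≤ π ⊔ δ))
          (d := t + 2) (by rw [hδ.2]; omega) h3.2
        exact mem_of_isCover hS ⟨π, hπ⟩ (hcover E e1 (e2.trans inf_le_right) e3)
          (e2.trans inf_le_left) h1.2

theorem ncard_lt_or_isExampleOne (hH : finrank F H + 1 = finrank F V)
    (hV : finrank F V = m + t + 3) (hq : 3 ≤ Nat.card F) (ht : 0 < t)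
    (hm : 2 * t + 2 * b + 5 ≤ m) (hS : Maximal (IsIntersecting H (t + b + 2) t) S)
    {δ E : Submodule F V} (hδ : IsSpace H t δ)
    (hno : ∀ X : Submodule F V, finrank F X < t + 2 → ¬ IsCover H t S X)
    (hE : IsCover H t S E) (hEd : finrank F E = t + 2)
    (hall : ∀ E, IsCover H t S E → finrank F E = t + 2 → δ ≤ E) :
    (S.ncard : ℚ) < sizeOne (Nat.card F) (m + t + 2) (t + b + 2) t ∨
      IsExampleOne H (t + b + 2) t S := by
  have hδc := hno δ (by rw [hδ.2]; omega)
  simp only [IsCover, not_forall] at hδc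
  obtain ⟨π, hπ, hπδ'⟩ := hδc
  have hδπ : ¬ δ ≤ π := by
    intro h
    refine hπδ' ⟨?_, ?_⟩
    · rw [inf_eq_left.2 h]; exact hδ.1
    · rw [inf_eq_left.2 h, hδ.2]
  have hπδ := (inf_sup_of_cover hδ.2 (hall E hE hEd) hEd (hE π hπ) hδπ).1
  have hW : finrank F ↥(π ⊔ δ) = t + b + 4 := by
    have := Submodule.finrank_sup_add_finrank_inf_eq π δ
    rw [hπδ, hδ.2, (hS.1.1 π hπ).2] at this
    omega
  obtain ⟨c, hc⟩ : ∃ c : ℚ, c = {E : Submodule F V | (δ ≤ E ∧ E ≤ π ⊔ δ ∧ finrank F E = t + 2)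
      ∧ IsCover H t S E}.ncard := ⟨_, rfl⟩
  rcases le_or_gt c ((Nat.card F : ℚ) ^ (b + 2)) with hle | hlt
  · left
    refine lt_of_le_of_lt ?_ (one_cover_bound hq ht hm hle)
    have h1 := ncard_through_le hV hS.1 hδ.2 hπ hπδ hW hc
    have h2 := ncard_not_through_le hV hS.1 hno hE hEd hall
    have h3 := Set.ncard_inter_add_ncard_sdiff_eq_ncard S {A | δ ≤ A} (Set.toFinite _)
    have h4 : (S.ncard : ℚ) = {A ∈ S | δ ≤ A}.ncard + {A ∈ S | ¬ δ ≤ A}.ncard := by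
      rw [← h3]
      push_cast
      rfl
    linarith
  · right
    rw [hc] at hlt
    exact isExampleOne_of_sup_eq hH ht hS hδ hπ hδπ fun σ hσ hδσ =>
      sup_eq_of_many_covers hH hq hS.1 hδ le_sup_right hW hlt hσ hδσ

/-- There is room for a `k`-space `A` through `E₁` with `A ⊓ (E₁ ⊔ E₂) = E₁`. It belongs to `S`, so
`E₂` must meet it, and `E₂ ⊓ A` is just `E₁ ⊓ E₂`. -/
theorem meets_of_isCover (hV : finrank F V = m + t + 3) (hm : 2 * t + 2 * b + 5 ≤ m)
    (hS : Maximal (IsIntersecting H (t + b + 2) t) S) (hne : S.Nonempty) {E₁ E₂ : Submodule F V}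
    (h₁ : IsCover H t S E₁) (h₁d : finrank F E₁ = t + 2)
    (h₂ : IsCover H t S E₂) (h₂d : finrank F E₂ = t + 2) : Meets H t E₁ E₂ := by
  have hsup := Submodule.finrank_sup_add_finrank_inf_eq E₁ E₂
  obtain ⟨A, hA, -, hAd, hAE⟩ := exists_between_skew (le_sup_left : E₁ ≤ E₁ ⊔ E₂) le_top (b + 1)
    (by rw [finrank_top]; omega)
  have := h₂ A (mem_of_isCover hS hne h₁ hA (by omega))
  have h : E₂ ⊓ A = E₁ ⊓ E₂ := by
    conv_rhs => rw [← hAE, inf_assoc, inf_eq_right.2 (le_sup_right : E₂ ≤ E₁ ⊔ E₂), inf_comm]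
  unfold Meets at this
  rwa [h] at this

omit [Finite F] in
/-- Three covers without a common `t`-space span a `(t+2)`-space that meets all members of `S` in at
least a `(t+1)`-space. -/
theorem meets_sup_of_isCover {E₁ E₂ E₃ : Submodule F V} (h₁ : IsCover H t S E₁) (h₁d : finrank F E₁ = t + 2)
    (h₂ : IsCover H t S E₂) (h₂d : finrank F E₂ = t + 2) (hne : E₁ ≠ E₂)
    (h₃ : IsCover H t S E₃) (h₃d : finrank F E₃ = t + 2) (h₁₂ : Meets H t E₁ E₂)
    (h₃₁ : Meets H t E₃ E₁) (h₃₂ : Meets H t E₃ E₂) (hδ : ¬ E₁ ⊓ E₂ ≤ E₃) :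
    IsSpace H (t + 2) (E₁ ⊔ E₂) ∧ ∀ A ∈ S, Meets H (t + 1) A (E₁ ⊔ E₂) := by
  have hlt : E₁ ⊓ E₂ < E₁ := lt_of_le_of_ne inf_le_left fun h =>
    hne (eq_of_le_of_finrank_ge (inf_eq_left.1 h) (by omega))
  have hlt' := Submodule.finrank_lt_finrank_of_lt hlt
  have hδd : finrank F ↥(E₁ ⊓ E₂) = t + 1 := by have := h₁₂.2; omega
  have hsup := Submodule.finrank_sup_add_finrank_inf_eq E₁ E₂
  have h3le : E₃ ≤ E₁ ⊔ E₂ := by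
    have h1 : E₃ ⊓ E₁ ⊔ E₃ ⊓ E₂ ≤ E₃ := sup_le inf_le_left inf_le_left
    have h2 : E₃ ⊓ E₁ ⊓ (E₃ ⊓ E₂) < E₁ ⊓ E₂ := by
      refine lt_of_le_of_ne (inf_le_inf inf_le_right inf_le_right) fun h => hδ ?_
      rw [← h]
      exact inf_le_left.trans inf_le_left
    have h3 := Submodule.finrank_lt_finrank_of_lt h2
    have h4 := Submodule.finrank_sup_add_finrank_inf_eq (E₃ ⊓ E₁) (E₃ ⊓ E₂)
    have := h₃₁.2
    have := h₃₂.2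
    rw [← eq_of_le_of_finrank_ge h1 (by omega)]
    exact sup_le_sup inf_le_right inf_le_right
  refine ⟨⟨fun h => h₁₂.1 (inf_le_left.trans (le_sup_left.trans h)), by omega⟩, fun A hA => ?_⟩
  refine ⟨fun h => (h₁ A hA).1 (le_trans (le_inf inf_le_right (inf_le_left.trans le_sup_left)) h),
    ?_⟩
  by_contra hlt
  -- If the trace of `A` on the span had dimension only `t + 1`, it would lie in all three covers
  -- and equal `E₁ ⊓ E₂`, forcing the latter into `E₃`.
  have key : ∀ E, IsCover H t S E → E ≤ E₁ ⊔ E₂ → A ⊓ (E₁ ⊔ E₂) ≤ E := by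
    intro E hE hEle
    have h1 := (hE A hA).2
    rw [← eq_of_le_of_finrank_ge (le_inf inf_le_right (inf_le_left.trans hEle) :
      E ⊓ A ≤ A ⊓ (E₁ ⊔ E₂)) (by omega)]
    exact inf_le_left
  have h1 : E₁ ⊓ A ≤ A ⊓ (E₁ ⊔ E₂) := le_inf inf_le_right (inf_le_left.trans le_sup_left)
  have h2 := Submodule.finrank_mono h1
  have h3 := (h₁ A hA).2
  refine hδ ?_
  rw [← eq_of_le_of_finrank_ge (le_inf (key E₁ h₁ le_sup_left) (key E₂ h₂ le_sup_right)) (by omega)]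
  exact key E₃ h₃ h3le

theorem classification (hH : finrank F H + 1 = finrank F V)
    (hV : finrank F V = m + t + 3) (hq : 3 ≤ Nat.card F) (ht : 0 < t)
    (hm : 2 * t + 2 * b + 5 ≤ m) (hS : Maximal (IsIntersecting H (t + b + 2) t) S) :
    (∃ δ, IsSpace H t δ ∧ S = {A | IsSpace H (t + b + 2) A ∧ δ ≤ A}) ∨
      (S.ncard : ℚ) < sizeOne (Nat.card F) (m + t + 2) (t + b + 2) t ∨
      IsExampleOne H (t + b + 2) t S ∨
      ((S.ncard : ℚ) ≤ sizeTwo (Nat.card F) (m + t + 2) (t + b + 2) t ∧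
      ((S.ncard : ℚ) = sizeTwo (Nat.card F) (m + t + 2) (t + b + 2) t →
        IsExampleTwo H (t + b + 2) t S)) := by
  have hq2 : 2 ≤ Nat.card F := by omega
  rcases S.eq_empty_or_nonempty with rfl | hne
  · right; left
    rw [Set.ncard_empty, Nat.cast_zero]
    refine lt_of_le_of_lt ?_ (large_cover_bound hq ht hm (Nat.zero_le b))
    have h1 := gaussCoeff_nonneg hq2 (t + 3 + 0) (t + 1)
    have h2 := gaussCoeff_nonneg hq2 (m - 0) (b - 0)
    have h3 := thetaNum_pos hq2 (b + 2)
    positivity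
  by_cases hsmall : ∃ E : Submodule F V, finrank F E < t + 2 ∧ IsCover H t S E
  · obtain ⟨E, h1, h2⟩ := hsmall
    exact Or.inl ⟨E, eq_pencil_of_isCover hS hne h2 (by omega)⟩
  have hno : ∀ X : Submodule F V, finrank F X < t + 2 → ¬ IsCover H t S X :=
    fun X h1 h2 => hsmall ⟨X, h1, h2⟩
  right
  by_cases hmid : ∃ E : Submodule F V, finrank F E = t + 2 ∧ IsCover H t S E
  swap
  · left
    refine ncard_lt_of_no_small_cover hS.1 hV hq ht hm hne fun E h1 h2 => ?_
    rcases Nat.lt_or_ge (finrank F E) (t + 2) with h | h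
    · exact hno E h h2
    · exact hmid ⟨E, by omega, h2⟩
  obtain ⟨E₁, h₁d, h₁⟩ := hmid
  have hmeet := fun {E E' : Submodule F V} (h : IsCover H t S E) (hd : finrank F E = t + 2)
    (h' : IsCover H t S E') (hd' : finrank F E' = t + 2) =>
    meets_of_isCover hV hm hS hne h hd h' hd'
  by_cases hcommon : ∃ δ, IsSpace H t δ ∧ ∀ E, IsCover H t S E → finrank F E = t + 2 → δ ≤ E
  · obtain ⟨δ, hδ, hall⟩ := hcommon
    rcases ncard_lt_or_isExampleOne hH hV hq ht hm hS hδ hno h₁ h₁d hall with h | h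
    · exact Or.inl h
    · exact Or.inr (Or.inl h)
  right; right
  push Not at hcommon
  obtain ⟨E₂, h₂, h₂d, hne₂⟩ : ∃ E₂, IsCover H t S E₂ ∧ finrank F E₂ = t + 2 ∧ E₁ ≠ E₂ := by
    by_contra hcon
    push Not at hcon
    have h1 : ¬ E₁ ≤ H := fun h => (hmeet h₁ h₁d h₁ h₁d).1 (inf_le_left.trans h)
    have h2 := finrank_inf_hyperplane hH h1
    -- Were `E₁` the only cover of its dimension, any affine `t`-space inside it would be common to
    -- all of them; one is built from a `t`-dimensional part at infinity and one further dimension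
    -- off `H`.
    obtain ⟨D, -, hDH, hD⟩ := exists_between (bot_le : ⊥ ≤ E₁ ⊓ H) (d := t) (by simp) (by omega)
    obtain ⟨δ, hDδ, hδE, hδd, hδH⟩ := exists_between_skew hDH (inf_le_left : E₁ ⊓ H ≤ E₁) 1
      (by omega)
    have hδ : IsSpace H t δ := by
      refine ⟨fun h => ?_, by omega⟩
      rw [inf_eq_left.2 (le_inf hδE h)] at hδH
      rw [hδH] at hδd
      omega
    obtain ⟨E, hE, hEd, hδE'⟩ := hcommon δ hδ
    exact hδE' (hcon E hE hEd ▸ hδE)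
  have hm12 := hmeet h₁ h₁d h₂ h₂d
  have hlt : E₁ ⊓ E₂ < E₁ := lt_of_le_of_ne inf_le_left fun h =>
    hne₂ (eq_of_le_of_finrank_ge (inf_eq_left.1 h) (by omega))
  have hlt' := Submodule.finrank_lt_finrank_of_lt hlt
  obtain ⟨E₃, h₃, h₃d, hδ⟩ := hcommon (E₁ ⊓ E₂) ⟨hm12.1, by have := hm12.2; omega⟩
  obtain ⟨hΓ, hSΓ⟩ := meets_sup_of_isCover h₁ h₁d h₂ h₂d hne₂ h₃ h₃d hm12
    (hmeet h₃ h₃d h₁ h₁d) (hmeet h₃ h₃d h₂ h₂d) hδ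
  exact ncard_le_sizeTwo hH hV hq ht hm hS.1 hΓ hSΓ

end CaseOne

end AffLin

/-! ### Homogenization: transfer between affine subspaces and linear subspaces off infinity. -/

namespace AG

open Module

variable {F : Type*} [Field F] {n : ℕ}

/-- The hyperplane at infinity: the vectors of `F ^ n × F` with last coordinate `0`. -/
def infinity (F : Type*) [Field F] (n : ℕ) : Submodule F (AG F n × F) :=
  LinearMap.range (LinearMap.inl F (AG F n) F)

theorem mem_infinity {v : AG F n × F} : v ∈ infinity F n ↔ v.2 = 0 := by
  rw [infinity, LinearMap.range_inl]
  rfl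

/-- The affine subspace of `F ^ n` cut out by a linear subspace of `F ^ n × F`. -/
def affinePart (A : Submodule F (AG F n × F)) : AffineSubspace F (AG F n) where
  carrier := {x | (x, (1 : F)) ∈ A}
  smul_vsub_vadd_mem' := by
    intro c p₁ p₂ p₃ h₁ h₂ h₃
    have h := A.add_mem (A.smul_mem c (A.sub_mem h₁ h₂)) h₃
    have e : c • ((p₁, (1 : F)) - (p₂, (1 : F))) + (p₃, (1 : F)) = (c • (p₁ -ᵥ p₂) +ᵥ p₃, 1) := by
      ext <;> simp
    rwa [e] at h

theorem mem_affinePart {A : Submodule F (AG F n × F)} {x : AG F n} :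
    x ∈ affinePart A ↔ (x, (1 : F)) ∈ A := Iff.rfl

theorem affinePart_inf (A B : Submodule F (AG F n × F)) :
    affinePart (A ⊓ B) = affinePart A ⊓ affinePart B := by
  ext x
  rfl

theorem nonempty_affinePart {A : Submodule F (AG F n × F)} :
    (affinePart A : Set (AG F n)).Nonempty ↔ ¬ A ≤ infinity F n := by
  constructor
  · rintro ⟨x, hx⟩ h
    exact one_ne_zero (mem_infinity.1 (h (mem_affinePart.1 hx)))
  · intro h
    obtain ⟨⟨v, c⟩, hv, hc⟩ := SetLike.not_le_iff_exists.1 h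
    have hc0 : c ≠ 0 := fun h0 => hc (mem_infinity.2 h0)
    refine ⟨c⁻¹ • v, ?_⟩
    have := A.smul_mem c⁻¹ hv
    rwa [Prod.smul_mk, smul_eq_mul, inv_mul_cancel₀ hc0] at this

theorem mem_direction_affinePart {A : Submodule F (AG F n × F)} (hA : ¬ A ≤ infinity F n)
    {v : AG F n} : v ∈ (affinePart A).direction ↔ (v, (0 : F)) ∈ A := by
  obtain ⟨p, hp⟩ := nonempty_affinePart.2 hA
  rw [AffineSubspace.mem_direction_iff_eq_vsub_right hp]
  constructor
  · rintro ⟨x, hx, rfl⟩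
    have := A.sub_mem (mem_affinePart.1 hx) (mem_affinePart.1 hp)
    simpa using this
  · intro hv
    refine ⟨v + p, ?_, by simp⟩
    have := A.add_mem hv (mem_affinePart.1 hp)
    rw [Prod.mk_add_mk, zero_add] at this
    exact this

theorem map_direction_affinePart {A : Submodule F (AG F n × F)} (hA : ¬ A ≤ infinity F n) :
    (affinePart A).direction.map (LinearMap.inl F (AG F n) F) = A ⊓ infinity F n := by
  ext ⟨v, c⟩
  constructor
  · rintro ⟨w, hw, h⟩
    rw [← h]
    exact ⟨(mem_direction_affinePart hA).1 hw, mem_infinity.2 rfl⟩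
  · rintro ⟨h1, h2⟩
    obtain rfl : c = 0 := mem_infinity.1 h2
    exact ⟨v, (mem_direction_affinePart hA).2 h1, rfl⟩

theorem direction_affinePart_le_iff {A B : Submodule F (AG F n × F)} (hA : ¬ A ≤ infinity F n)
    (hB : ¬ B ≤ infinity F n) :
    (affinePart A).direction ≤ (affinePart B).direction ↔
      A ⊓ infinity F n ≤ B ⊓ infinity F n := by
  rw [← map_direction_affinePart hA, ← map_direction_affinePart hB,
    Submodule.map_le_map_iff_of_injective LinearMap.inl_injective]

theorem direction_affinePart_eq_iff {A B : Submodule F (AG F n × F)} (hA : ¬ A ≤ infinity F n)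
    (hB : ¬ B ≤ infinity F n) :
    (affinePart A).direction = (affinePart B).direction ↔
      A ⊓ infinity F n = B ⊓ infinity F n := by
  rw [le_antisymm_iff, le_antisymm_iff, direction_affinePart_le_iff hA hB,
    direction_affinePart_le_iff hB hA]

theorem affinePart_le_iff {A B : Submodule F (AG F n × F)} (hA : ¬ A ≤ infinity F n) :
    affinePart A ≤ affinePart B ↔ A ≤ B := by
  refine ⟨fun h => ?_, fun h x hx => h hx⟩
  obtain ⟨p, hp⟩ := nonempty_affinePart.2 hA
  rintro ⟨v, c⟩ hv
  rcases eq_or_ne c 0 with rfl | hc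
  · have h1 := A.add_mem hv (mem_affinePart.1 hp)
    rw [Prod.mk_add_mk, zero_add] at h1
    have := B.sub_mem (mem_affinePart.1 (h h1)) (mem_affinePart.1 (h hp))
    simpa using this
  · have h1 := A.smul_mem c⁻¹ hv
    rw [Prod.smul_mk, smul_eq_mul, inv_mul_cancel₀ hc] at h1
    have := B.smul_mem c (mem_affinePart.1 (h h1))
    rwa [Prod.smul_mk, smul_smul, mul_inv_cancel₀ hc, one_smul, smul_eq_mul, mul_one] at this

/-- With a base point `p`, the cone over `σ` consists of the `(v, c)` for which `v - c • p` lies in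
the direction of `σ`. -/
theorem exists_affinePart_eq {σ : AffineSubspace F (AG F n)} (hσ : (σ : Set (AG F n)).Nonempty) :
    ∃ A : Submodule F (AG F n × F), ¬ A ≤ infinity F n ∧ affinePart A = σ := by
  obtain ⟨p, hp⟩ := hσ
  have h : affinePart (σ.direction.comap (LinearMap.fst F (AG F n) F
      - (LinearMap.snd F (AG F n) F).smulRight p)) = σ := by
    ext x
    rw [mem_affinePart, Submodule.mem_comap]
    simp only [LinearMap.sub_apply, LinearMap.fst_apply, LinearMap.smulRight_apply,
      LinearMap.snd_apply, one_smul]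
    rw [← vsub_eq_sub, AffineSubspace.vsub_right_mem_direction_iff_mem hp]
  refine ⟨_, nonempty_affinePart.1 ?_, h⟩
  rw [h]
  exact ⟨p, hp⟩

theorem affinePart_sup {A B : Submodule F (AG F n × F)} (hA : ¬ A ≤ infinity F n)
    (hB : ¬ B ≤ infinity F n) : affinePart (A ⊔ B) = affinePart A ⊔ affinePart B := by
  refine le_antisymm ?_ (sup_le (fun x hx => le_sup_left (a := A) hx)
    fun x hx => le_sup_right (a := A) hx)
  obtain ⟨C, -, hC⟩ := exists_affinePart_eq
    ((nonempty_affinePart.2 hA).mono (le_sup_left : affinePart A ≤ affinePart A ⊔ affinePart B))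
  rw [← hC]
  have h1 : A ≤ C := (affinePart_le_iff hA).1 (hC ▸ le_sup_left)
  have h2 : B ≤ C := (affinePart_le_iff hB).1 (hC ▸ le_sup_right)
  exact (affinePart_le_iff fun h => hA (le_sup_left.trans h)).2 (sup_le h1 h2)

theorem affinePart_injOn : Set.InjOn (affinePart (F := F) (n := n)) {A | ¬ A ≤ infinity F n} := by
  intro A hA B hB h
  exact le_antisymm ((affinePart_le_iff hA).1 h.le) ((affinePart_le_iff hB).1 h.ge)

theorem finrank_infinity (F : Type*) [Field F] (n : ℕ) :
    finrank F (infinity F n) + 1 = finrank F (AG F n × F) := by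
  rw [infinity, LinearMap.finrank_range_of_inj LinearMap.inl_injective, finrank_prod,
    finrank_self]

theorem exists_image_eq {S : Set (AffineSubspace F (AG F n))}
    (hS : ∀ σ ∈ S, (σ : Set (AG F n)).Nonempty) :
    ∃ T : Set (Submodule F (AG F n × F)), (∀ A ∈ T, ¬ A ≤ infinity F n) ∧ affinePart '' T = S := by
  refine ⟨{A | ¬ A ≤ infinity F n ∧ affinePart A ∈ S}, fun A hA => hA.1, ?_⟩
  ext σ
  constructor
  · rintro ⟨A, hA, rfl⟩
    exact hA.2
  · intro hσ
    obtain ⟨A, hA, rfl⟩ := exists_affinePart_eq (hS σ hσ)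
    exact ⟨A, ⟨hA, hσ⟩, rfl⟩

/-- `affinePart` gives an inclusion-preserving bijection between sets of linear subspaces off
infinity and sets of nonempty affine subspaces, so maximality transfers as soon as the property
does. -/
theorem maximal_image_iff {P : Set (AffineSubspace F (AG F n)) → Prop}
    {P' : Set (Submodule F (AG F n × F)) → Prop}
    (hP : ∀ S, P S → ∀ σ ∈ S, (σ : Set (AG F n)).Nonempty)
    (hP' : ∀ T, P' T → ∀ A ∈ T, ¬ A ≤ infinity F n)
    (h : ∀ T, (∀ A ∈ T, ¬ A ≤ infinity F n) → (P (affinePart '' T) ↔ P' T))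
    {T : Set (Submodule F (AG F n × F))} (hT : ∀ A ∈ T, ¬ A ≤ infinity F n) :
    Maximal P (affinePart '' T) ↔ Maximal P' T := by
  constructor
  · rintro ⟨h1, h2⟩
    refine ⟨(h T hT).1 h1, fun T' hT' hle => ?_⟩
    have h3 := h2 ((h T' (hP' T' hT')).2 hT') (Set.image_mono hle)
    exact (affinePart_injOn.image_subset_image_iff (hP' T' hT') hT).1 h3
  · rintro ⟨h1, h2⟩
    refine ⟨(h T hT).2 h1, fun S hS hle => ?_⟩
    obtain ⟨T', hT', rfl⟩ := exists_image_eq (hP S hS)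
    exact Set.image_mono (h2 ((h T' hT').1 hS)
      ((affinePart_injOn.image_subset_image_iff hT hT').1 hle))

theorem distinctAtInfinity_image {T : Set (Submodule F (AG F n × F))}
    (hT : ∀ A ∈ T, ¬ A ≤ infinity F n) :
    DistinctAtInfinity (affinePart '' T) ↔ AffLin.DistinctAtInfinity (infinity F n) T := by
  rw [DistinctAtInfinity, (affinePart_injOn.mono hT).pairwise_image]
  constructor
  · intro h A hA B hB hne
    exact fun h' => h hA hB hne ((direction_affinePart_eq_iff (hT A hA) (hT B hB)).2 h')
  · intro h A hA B hB hne
    exact fun h' => h hA hB hne ((direction_affinePart_eq_iff (hT A hA) (hT B hB)).1 h')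

variable [Finite F]

theorem finrank_direction_affinePart {A : Submodule F (AG F n × F)} (hA : ¬ A ≤ infinity F n) :
    finrank F (affinePart A).direction + 1 = finrank F A := by
  rw [← AffLin.finrank_inf_hyperplane (finrank_infinity F n) hA, ← map_direction_affinePart hA,
    ← (Submodule.equivMapOfInjective _ LinearMap.inl_injective _).finrank_eq]

theorem isSpace_affinePart {d : ℕ} {A : Submodule F (AG F n × F)} :
    IsSpace d (affinePart A) ↔ AffLin.IsSpace (infinity F n) d A := by
  rw [IsSpace, AffLin.IsSpace, nonempty_affinePart]
  refine and_congr_right fun hA => ?_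
  rw [← finrank_direction_affinePart hA, Nat.add_right_cancel_iff]

theorem meetInAtLeast_affinePart {d : ℕ} {A B : Submodule F (AG F n × F)} :
    MeetInAtLeast d (affinePart A) (affinePart B) ↔ AffLin.Meets (infinity F n) d A B := by
  rw [MeetInAtLeast, AffLin.Meets, ← affinePart_inf, nonempty_affinePart]
  refine and_congr_right fun hA => ?_
  rw [← finrank_direction_affinePart hA, Nat.add_le_add_iff_right]

variable {k t : ℕ}

theorem isIntersecting_image {T : Set (Submodule F (AG F n × F))}
    (hT : ∀ A ∈ T, ¬ A ≤ infinity F n) :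
    IsIntersecting k t (affinePart '' T) ↔ AffLin.IsIntersecting (infinity F n) k t T := by
  rw [IsIntersecting, AffLin.IsIntersecting, (affinePart_injOn.mono hT).pairwise_image,
    Set.forall_mem_image]
  simp only [isSpace_affinePart]
  refine and_congr_right fun _ => ?_
  constructor
  · exact fun h A hA B hB hne => meetInAtLeast_affinePart.1 (h hA hB hne)
  · exact fun h A hA B hB hne => meetInAtLeast_affinePart.2 (h hA hB hne)

theorem isMaximalIntersecting_image {T : Set (Submodule F (AG F n × F))}
    (hT : ∀ A ∈ T, ¬ A ≤ infinity F n) :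
    IsMaximalIntersecting k t (affinePart '' T) ↔
      Maximal (AffLin.IsIntersecting (infinity F n) k t) T :=
  maximal_image_iff (fun _ hS σ hσ => (hS.1 σ hσ).1) (fun _ hT A hA => (hT.1 A hA).1)
    (fun _ hT => isIntersecting_image hT) hT

theorem maximal_isAdmissible_image {π δ : Submodule F (AG F n × F)} (hπ : ¬ π ≤ infinity F n)
    (hδ : ¬ δ ≤ infinity F n) {T : Set (Submodule F (AG F n × F))}
    (hT : ∀ A ∈ T, ¬ A ≤ infinity F n) :
    Maximal (IsAdmissible k (affinePart π) (affinePart δ)) (affinePart '' T) ↔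
      Maximal (AffLin.IsAdmissible (infinity F n) k π δ) T := by
  refine maximal_image_iff (fun _ hS σ hσ => (hS.2.1 σ hσ).1.1)
    (fun _ hT A hA => (hT.2.1 A hA).1.1) (fun T hT => ?_) hT
  rw [IsAdmissible, AffLin.IsAdmissible, distinctAtInfinity_image hT, Set.forall_mem_image,
    affinePart_injOn.mem_image_iff hT hπ, ← affinePart_sup hπ hδ]
  refine and_congr_right fun _ => and_congr_left fun _ => forall₂_congr fun A hA => ?_
  rw [isSpace_affinePart, affinePart_le_iff (hT A hA), direction_affinePart_le_iff hδ (hT A hA)]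

theorem maximal_isParallelDistinct_image {Γ : Submodule F (AG F n × F)}
    {T : Set (Submodule F (AG F n × F))} (hT : ∀ A ∈ T, ¬ A ≤ infinity F n) :
    Maximal (IsParallelDistinct t (affinePart Γ)) (affinePart '' T) ↔
      Maximal (AffLin.IsParallelDistinct (infinity F n) t Γ) T := by
  refine maximal_image_iff (fun _ hS σ hσ => (hS.1 σ hσ).1.1)
    (fun _ hT A hA => (hT.1 A hA).1.1) (fun T hT => ?_) hT
  rw [IsParallelDistinct, AffLin.IsParallelDistinct, distinctAtInfinity_image hT,
    Set.forall_mem_image]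
  refine and_congr_left fun _ => forall₂_congr fun A hA => ?_
  rw [isSpace_affinePart, affinePart_le_iff (hT A hA)]

theorem setOf_isSpace_eq_image {p : AffineSubspace F (AG F n) → Prop}
    {p' : Submodule F (AG F n × F) → Prop}
    (h : ∀ A, ¬ A ≤ infinity F n → (p (affinePart A) ↔ p' A)) :
    {σ | IsSpace k σ ∧ p σ} = affinePart '' {A | AffLin.IsSpace (infinity F n) k A ∧ p' A} := by
  ext σ
  constructor
  · rintro ⟨h1, h2⟩
    obtain ⟨A, hA, rfl⟩ := exists_affinePart_eq h1.1
    exact ⟨A, ⟨isSpace_affinePart.1 h1, (h A hA).1 h2⟩, rfl⟩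
  · rintro ⟨A, ⟨h1, h2⟩, rfl⟩
    exact ⟨isSpace_affinePart.2 h1, (h A h1.1).2 h2⟩

theorem isExampleOne_image {T : Set (Submodule F (AG F n × F))}
    (hT : ∀ A ∈ T, ¬ A ≤ infinity F n) :
    IsExampleOne k t (affinePart '' T) ↔ AffLin.IsExampleOne (infinity F n) k t T := by
  have key : ∀ {δ π : Submodule F (AG F n × F)}, ¬ δ ≤ infinity F n → ¬ π ≤ infinity F n →
      {σ | IsSpace k σ ∧ affinePart δ ≤ σ ∧ MeetInAtLeast (t + 1) σ (affinePart π ⊔ affinePart δ)}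
        = affinePart '' {A | AffLin.IsSpace (infinity F n) k A ∧ δ ≤ A ∧
            AffLin.Meets (infinity F n) (t + 1) A (π ⊔ δ)} := by
    intro δ π hδ hπ
    refine setOf_isSpace_eq_image fun A hA => ?_
    rw [affinePart_le_iff hδ, ← affinePart_sup hπ hδ, meetInAtLeast_affinePart]
  constructor
  · rintro ⟨δ, π, S₁, hδ, hπ, hπδ, hS₁, hS⟩
    obtain ⟨δ, hδ', rfl⟩ := exists_affinePart_eq hδ.1
    obtain ⟨π, hπ', rfl⟩ := exists_affinePart_eq hπ.1
    obtain ⟨T₁, hT₁, rfl⟩ := exists_image_eq fun σ hσ => (hS₁.1.2.1 σ hσ).1.1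
    rw [← affinePart_inf] at hπδ
    rw [key hδ' hπ', ← Set.image_union] at hS
    refine ⟨δ, π, T₁, isSpace_affinePart.1 hδ, isSpace_affinePart.1 hπ, isSpace_affinePart.1 hπδ,
      (maximal_isAdmissible_image hπ' hδ' hT₁).1 hS₁, ?_⟩
    refine (affinePart_injOn.image_eq_image_iff hT ?_).1 hS
    rintro A (hA | hA)
    · exact hT₁ A hA
    · exact hA.1.1
  · rintro ⟨δ, π, T₁, hδ, hπ, hπδ, hT₁, rfl⟩
    refine ⟨affinePart δ, affinePart π, affinePart '' T₁, isSpace_affinePart.2 hδ,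
      isSpace_affinePart.2 hπ, ?_, (maximal_isAdmissible_image hπ.1 hδ.1
        fun A hA => (hT₁.1.2.1 A hA).1.1).2 hT₁, ?_⟩
    · rw [← affinePart_inf]
      exact isSpace_affinePart.2 hπδ
    · rw [key hδ.1 hπ.1, Set.image_union]

theorem isExampleTwo_image {T : Set (Submodule F (AG F n × F))}
    (hT : ∀ A ∈ T, ¬ A ≤ infinity F n) :
    IsExampleTwo k t (affinePart '' T) ↔ AffLin.IsExampleTwo (infinity F n) k t T := by
  have key : ∀ {Γ : Submodule F (AG F n × F)} {R : Set (Submodule F (AG F n × F))},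
      ¬ Γ ≤ infinity F n → (∀ A ∈ R, AffLin.IsSpace (infinity F n) (t + 1) A) →
      {σ | IsSpace k σ ∧ (affinePart Γ ≤ σ ∨ σ ⊓ affinePart Γ ∈ affinePart '' R)}
        = affinePart '' {A | AffLin.IsSpace (infinity F n) k A ∧ (Γ ≤ A ∨ A ⊓ Γ ∈ R)} := by
    intro Γ R hΓ hR
    refine setOf_isSpace_eq_image fun A hA => ?_
    rw [affinePart_le_iff hΓ, ← affinePart_inf]
    refine or_congr_right ⟨?_, fun h => ⟨_, h, rfl⟩⟩
    rintro ⟨X, hX, h⟩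
    -- Injectivity needs `A ⊓ Γ` off infinity; this follows because its affine part equals that of
    -- `X`, which is nonempty.
    have hXs := isSpace_affinePart.2 (hR X hX)
    rw [h] at hXs
    rwa [← affinePart_injOn (hR X hX).1 (isSpace_affinePart.1 hXs).1 h]
  constructor
  · rintro ⟨Γ, R, hΓ, hR, hRcard, hS⟩
    obtain ⟨Γ, hΓ', rfl⟩ := exists_affinePart_eq hΓ.1
    obtain ⟨R, hR', rfl⟩ := exists_image_eq fun σ hσ => (hR.1.1 σ hσ).1.1
    rw [maximal_isParallelDistinct_image hR'] at hR
    rw [(affinePart_injOn.mono hR').ncard_image] at hRcard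
    rw [key hΓ' fun A hA => (hR.1.1 A hA).1] at hS
    exact ⟨Γ, R, isSpace_affinePart.1 hΓ, hR, hRcard,
      (affinePart_injOn.image_eq_image_iff hT fun A hA => hA.1.1).1 hS⟩
  · rintro ⟨Γ, R, hΓ, hR, hRcard, rfl⟩
    have hR' : ∀ A ∈ R, ¬ A ≤ infinity F n := fun A hA => (hR.1.1 A hA).1.1
    refine ⟨affinePart Γ, affinePart '' R, isSpace_affinePart.2 hΓ,
      (maximal_isParallelDistinct_image hR').2 hR, ?_, ?_⟩
    · rw [(affinePart_injOn.mono hR').ncard_image, hRcard]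
    · rw [key hΓ.1 fun A hA => (hR.1.1 A hA).1]

end AG

/-! ### The theorem: the classification combined with the comparison of sizes. -/

theorem mainTheorem2 {F : Type*} [Field F] [Finite F] (q n k t : ℕ) (hq : Nat.card F = q)
    (ht : 0 < t) (hk : t + 1 < k)
    (hn : (4 ≤ q ∧ 2 * k + t + 2 < n) ∨ (q = 3 ∧ 2 * k + t + 3 < n))
    (S : Set (AffineSubspace F (AG F n))) (hS : AG.IsMaximalIntersecting k t S)
    (hpencil : ¬ AG.IsPencil k t S) :
    (S.ncard : ℚ) ≤ fA q n k t ∧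
      (2 * t + 1 < k → ((S.ncard : ℚ) = fA q n k t ↔ AG.IsExampleOne k t S)) ∧
      (k ≤ 2 * t + 1 → ¬ (k = 3 ∧ t = 1) →
        ((S.ncard : ℚ) = fA q n k t ↔ AG.IsExampleTwo k t S)) ∧
      (k = 3 ∧ t = 1 →
        ((S.ncard : ℚ) = fA q n k t ↔ AG.IsExampleOne k t S ∨ AG.IsExampleTwo k t S)) := by
  subst hq
  obtain ⟨b, rfl⟩ : ∃ b, k = t + b + 2 := ⟨k - t - 2, by omega⟩
  obtain ⟨m, rfl⟩ : ∃ m, n = m + t + 2 := ⟨n - t - 2, by omega⟩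
  have hq3 : 3 ≤ Nat.card F := by omega
  -- This is `2 * k + t + 2 < n` in the new parameters.
  have hm : 2 * t + 2 * b + 5 ≤ m := by omega
  have hV : Module.finrank F (AG F (m + t + 2) × F) = m + t + 3 := by
    rw [Module.finrank_prod, Module.finrank_fin_fun, Module.finrank_self]
  obtain ⟨T, hT, rfl⟩ := AG.exists_image_eq fun σ hσ => (hS.1.1 σ hσ).1
  rw [AG.isExampleOne_image hT, AG.isExampleTwo_image hT,
    (AG.affinePart_injOn.mono hT).ncard_image]
  rw [AG.isMaximalIntersecting_image hT] at hS
  have hone := AffLin.IsExampleOne.ncard_eq (S := T) (b := b) (AG.finrank_infinity F (m + t + 2)) hV ht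
  have htwo := AffLin.IsExampleTwo.ncard_eq (H := AG.infinity F (m + t + 2)) (S := T) (b := b) hV
  have hcl : (T.ncard : ℚ) < sizeOne (Nat.card F) (m + t + 2) (t + b + 2) t ∨
      AffLin.IsExampleOne (AG.infinity F (m + t + 2)) (t + b + 2) t T ∨
      ((T.ncard : ℚ) ≤ sizeTwo (Nat.card F) (m + t + 2) (t + b + 2) t ∧
      ((T.ncard : ℚ) = sizeTwo (Nat.card F) (m + t + 2) (t + b + 2) t →
        AffLin.IsExampleTwo (AG.infinity F (m + t + 2)) (t + b + 2) t T)) := by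
    refine (AffLin.classification (AG.finrank_infinity F (m + t + 2)) hV hq3 ht hm hS).resolve_left ?_
    rintro ⟨δ, hδ, hTδ⟩
    refine hpencil ⟨AG.affinePart δ, AG.isSpace_affinePart.2 hδ, ?_⟩
    rw [AG.setOf_isSpace_eq_image (p' := fun A => δ ≤ A) fun A _ => AG.affinePart_le_iff hδ.1,
      ← hTδ]
  rw [fA_eq]
  refine ⟨?_, fun hkt => ?_, fun hkt hne => ?_, ?_⟩
  · rcases hcl with h | h | h
    · exact h.le.trans (le_max_left _ _)
    · exact (hone h).le.trans (le_max_left _ _)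
    · exact h.1.trans (le_max_right _ _)
  · have hlt := sizeTwo_lt_sizeOne hq3 ht hm (show t ≤ b by omega)
    rw [max_eq_left hlt.le]
    refine ⟨fun h => ?_, hone⟩
    rcases hcl with h' | h' | h'
    · exact absurd h h'.ne
    · exact h'
    · exact absurd h (h'.1.trans_lt hlt).ne
  · have hlt : sizeOne (Nat.card F) (m + t + 2) (t + b + 2) t
        < sizeTwo (Nat.card F) (m + t + 2) (t + b + 2) t := by
      rcases Nat.lt_or_ge (b + 1) t with h | h
      · exact sizeOne_lt_sizeTwo hq3 ht hm h
      -- Here `k = 2 * t + 1`, and excluding `(k, t) = (3, 1)` gives `b > 0`.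
      · obtain rfl : t = b + 1 := by omega
        exact sizeOne_lt_sizeTwo_of_eq hq3 (by omega) hm
    rw [max_eq_right hlt.le]
    refine ⟨fun h => ?_, htwo⟩
    rcases hcl with h' | h' | h'
    · exact absurd h (h'.trans hlt).ne
    · exact absurd ((hone h').symm.trans h) hlt.ne
    · exact h'.2 h
  · rintro ⟨hk3, rfl⟩
    obtain rfl : b = 0 := by omega
    have heq : sizeOne (Nat.card F) (m + 1 + 2) (1 + 0 + 2) 1
        = sizeTwo (Nat.card F) (m + 1 + 2) (1 + 0 + 2) 1 :=
      sizeOne_eq_sizeTwo (by omega) (by omega)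
    rw [heq, max_self]
    rw [heq] at hone hcl
    refine ⟨fun h => ?_, fun h => h.elim hone htwo⟩
    rcases hcl with h' | h' | h'
    · exact absurd h h'.ne
    · exact Or.inl h'
    · exact Or.inr (h'.2 h)
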